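/- Let $n\ge 3$, write $x=(\tilde x,\hat x)\in\mathbb R^2\times\mathbb R^{n-2}=\mathbb R^n$, and let $Q$ be the image of the open cube $]-1,1[^n$ under a rigid motion of $\mathbb R^n$. Let $\hat\Delta\subset\mathbb R^{n-2}$ be a closed nondegenerate $(n-2)$-simplex with boundary $\partial\hat\Delta$, and put $\Delta=\{0_{\mathbb R^2}\}\times\hat\Delta$, $\partial\Delta=\{0_{\mathbb R^2}\}\times\partial\hat\Delta$. Assume that $\Delta\setminus\partial\Delta\subset Q$. Let $\Delta_2,\dots,\Delta_{m}$ be finitely many (possibly no) closed $(n-2)$-simplices in $\mathbb R^n$, each of which meets $\Delta$ only at points of $\partial\Delta$. Let $u\in W^{1,1}(Q,\mathbb S^1)$ be smooth in $Q\setminus(\Delta\cup\Delta_2\cup\dots\cup\Delta_{m})$, where $\mathbb S^1\subset\mathbb R^2$ is the unit circle. Assume that there is $d\in\mathbb Z$ such that for every $\hat x$ in the interior of $\hat\Delta$ the degree of $u(\cdot,\hat x)$ around $0_{\mathbb R^2}$, i.e. the degree of its restriction to all small circles centred at $0_{\mathbb R^2}$, equals $d$. For $\varepsilon>0$ put $$\Delta_\varepsilon=\{(\tilde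 x,\hat x)\in\mathbb R^2\times\hat\Delta:\ |\tilde x|\le\varepsilon\,\mathrm{dist}(\hat x,\partial\hat\Delta)\}.$$ Then there are $\varepsilon_0>0$ and a function $R$ with $R(\varepsilon)\to0$ as $\varepsilon\to0^+$, and with $R(\varepsilon)=O(\varepsilon)$ as $\varepsilon\to 0^+$ in case $\int_{\Delta_\varepsilon}|\nabla u|\,dx=O(\varepsilon)$, such that for a.e. $\varepsilon\in(0,\varepsilon_0)$ the following holds. The set $\Delta_\varepsilon\setminus\partial\Delta$ is contained in $Q$ and does not meet $\Delta_2\cup\dots\cup\Delta_m$, and there is a map $v_\varepsilon$, smooth on $\Delta_\varepsilon\setminus\partial\Delta$ (up to the lateral boundary) with values in $\mathbb R^2$, which belongs to $W^{1,1}(\mathrm{int}\,\Delta_\varepsilon,\mathbb R^2)$, agrees with $u$ on the boundary of $\Delta_\varepsilon$ in the sense of traces and pointwise on $(\partial\Delta_\varepsilon)\setminus\partial\Delta$, and satisfies $$\mathbf M\bigl(G_{v_\varepsilon}\llcorner \Delta_\varepsilon\times\mathbb R^2\bigr)\le \pi\,|d|\,\mathcal H^{n-2}(\Delta)+R(\varepsilon).$$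 Here $G_{v}$ is the $n$-current carried by the graph of $v$, i.e. $G_v(\omega)=\int(\mathrm{Id}\bowtie v)^\#\omega$ with $(\mathrm{Id}\bowtie v)(x)=(x,v(x))$, and $\mathbf M$ is the mass, the supremum of $G_v(\omega)$ over smooth $n$-forms $\omega$ of comass at most one and with compact support in $\mathrm{int}\,\Delta_\varepsilon\times\mathbb R^2$. -/

import Mathlib

open Set Filter Topology MeasureTheory Asymptotics
open scoped ContDiff ENNReal

noncomputable section

namespace Dipole

/-- Euclidean space `ℝⁿ`. -/
abbrev Eu (n : ℕ) : Type := EuclideanSpace ℝ (Fin n)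

/-! ### Sobolev maps and traces -/

/-- The Sobolev class `W^{1,1}(U, ℝ²)`: `u` is summable on `U` and has a summable weak gradient,
defined by integration by parts against compactly supported smooth functions in `U`. -/
def MemW11 {n : ℕ} (U : Set (Eu n)) (u : Eu n → Eu 2) : Prop :=
  IntegrableOn u U ∧
    ∃ g : Eu n → (Eu n →L[ℝ] Eu 2), IntegrableOn g U ∧
      ∀ φ : Eu n → ℝ, ContDiff ℝ ∞ φ → HasCompactSupport φ → tsupport φ ⊆ U →
        ∀ e : Eu n, ∫ x in U, (fderiv ℝ φ x e) • u x = - ∫ x in U, φ x • g x e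

/-- The Sobolev class `W^{1,1}(U, 𝕊¹)`. -/
def MemW11Circle {n : ℕ} (U : Set (Eu n)) (u : Eu n → Eu 2) : Prop :=
  MemW11 U u ∧ ∀ᵐ x ∂(volume.restrict U), ‖u x‖ = 1

/-- `u` and `v` have the same trace on the boundary of the bounded Lipschitz domain `U`: the
difference `u - v`, extended by zero outside `U`, is a Sobolev map on the whole space. -/
def EqTrace {n : ℕ} (U : Set (Eu n)) (u v : Eu n → Eu 2) : Prop :=
  MemW11 univ (U.indicator (fun x => u x - v x))

/-! ### The current carried by a graph, and its mass -/

/-- The space `ℝⁿ × ℝ²` containing the graphs, with its Euclidean structure. -/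
abbrev GraphSpace (n : ℕ) : Type := WithLp 2 (Eu n × Eu 2)

/-- Differential `n`-forms on `ℝⁿ × ℝ²`. -/
abbrev NForm (n : ℕ) : Type := GraphSpace n → (GraphSpace n) [⋀^Fin n]→L[ℝ] ℝ

/-- `η` is a smooth `n`-form with compact support in `U × ℝ²`. -/
def IsTestForm {n : ℕ} (U : Set (Eu n)) (η : NForm n) : Prop :=
  ContDiff ℝ ∞ η ∧ HasCompactSupport η ∧ tsupport η ⊆ {z | z.fst ∈ U}

/-- The comass norm of `η` is at most one: at every point `η` is at most one in absolute value on
simple unit `n`-vectors, that is, on the `n`-vectors `τ₁ ∧ ⋯ ∧ τₙ` of orthonormal frames. -/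
def ComassLeOne {n : ℕ} (η : NForm n) : Prop :=
  ∀ z : GraphSpace n, ∀ τ : Fin n → GraphSpace n, Orthonormal ℝ τ → |η z τ| ≤ 1

/-- The graph current `G_v(η) = ∫_U (Id ⋈ v)^# η` over `U`, where `(Id ⋈ v)(x) = (x, v x)`. The
pulled back form is evaluated on the standard basis of `ℝⁿ`. -/
def graphCurrent {n : ℕ} (U : Set (Eu n)) (v : Eu n → Eu 2) (η : NForm n) : ℝ :=
  ∫ x in U, η (WithLp.toLp 2 (x, v x)) (fun i =>
    WithLp.toLp 2 (EuclideanSpace.single i (1 : ℝ), fderiv ℝ v x (EuclideanSpace.single i 1)))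

/-- The mass in `U × ℝ²` of the current carried by the graph of `v`: the supremum of `G_v(η)` over
the test forms of comass at most one. It is used for maps that are smooth in the open set `U`; the
integrand in `G_v(η)` is then continuous with compact support in `U`. -/
def graphMass {n : ℕ} (U : Set (Eu n)) (v : Eu n → Eu 2) : ℝ≥0∞ :=
  ⨆ (η : NForm n) (_ : IsTestForm U η) (_ : ComassLeOne η),
    ENNReal.ofReal (graphCurrent U v η)

/-! ### Simplices and cones -/

/-- The relative boundary of a simplex. -/
def simplexBdry {k m : ℕ} (Δ : Affine.Simplex ℝ (Eu k) m) : Set (Eu k) :=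
  Δ.closedInterior \ Δ.interior

/-- The first component `x̃ ∈ ℝ²` of `x = (x̃, x̂) ∈ ℝ² × ℝᵐ = ℝ^{m+2}`. -/
def tildePart {m : ℕ} (x : Eu (m + 2)) : Eu 2 := WithLp.toLp 2 ![x 0, x 1]

/-- The second component `x̂ ∈ ℝᵐ` of `x = (x̃, x̂) ∈ ℝ² × ℝᵐ = ℝ^{m+2}`. -/
def hatPart {m : ℕ} (x : Eu (m + 2)) : Eu m := WithLp.toLp 2 (fun j => x j.succ.succ)

/-- The point `(a, p) ∈ ℝ² × ℝᵐ = ℝ^{m+2}`. -/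
def join {m : ℕ} (a : Eu 2) (p : Eu m) : Eu (m + 2) :=
  WithLp.toLp 2 (Matrix.vecCons (a 0) (Matrix.vecCons (a 1) (fun j => p j)))

theorem tildePart_join {m : ℕ} (a : Eu 2) (p : Eu m) : tildePart (join a p) = a := by
  ext i
  fin_cases i <;> simp [tildePart, join]

theorem hatPart_join {m : ℕ} (a : Eu 2) (p : Eu m) : hatPart (join a p) = p := by
  ext i
  simp [hatPart, join]

/-- The set `{0_{ℝ²}} × A ⊆ ℝ^{m+2}`. -/
def flat {m : ℕ} (A : Set (Eu m)) : Set (Eu (m + 2)) :=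
  {x | tildePart x = 0 ∧ hatPart x ∈ A}

/-- The cone neighbourhood
`Δ_ε = {(x̃, x̂) : x̂ ∈ Δ̂, |x̃| ≤ ε dist(x̂, ∂Δ̂)}` of `Δ = {0} × Δ̂`. -/
def coneNhd {m : ℕ} (Δ : Affine.Simplex ℝ (Eu m) m) (ε : ℝ) : Set (Eu (m + 2)) :=
  {x | hatPart x ∈ Δ.closedInterior ∧
    ‖tildePart x‖ ≤ ε * Metric.infDist (hatPart x) (simplexBdry Δ)}

/-- The open cube `]-1, 1[ⁿ`. -/
def cube (n : ℕ) : Set (Eu n) := {x | ∀ i, |x i| < 1}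

/-! ### Degree -/

/-- The point `r (cos t, sin t)` of the plane. -/
def circlePt (r t : ℝ) : Eu 2 := WithLp.toLp 2 ![r * Real.cos t, r * Real.sin t]

/-- The loop `f : ℝ / 2πℤ → 𝕊¹`, given as a function of the angle, is continuous of degree `d`: it
has a continuous angle function, which increases by `2πd` over a period. -/
def LoopHasDegree (f : ℝ → Eu 2) (d : ℤ) : Prop :=
  ∃ θ : ℝ → ℝ, Continuous θ ∧ (∀ t, f t = circlePt 1 (θ t)) ∧
    ∀ t, θ (t + 2 * Real.pi) = θ t + 2 * Real.pi * d

/-- The degree of `u(·, p)` around `0 ∈ ℝ²` is `d`: so is the degree of its restriction to all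
small circles around the origin. -/
def HasDegreeAround {m : ℕ} (u : Eu (m + 2) → Eu 2) (p : Eu m) (d : ℤ) : Prop :=
  ∀ᶠ r in 𝓝[>] (0 : ℝ), LoopHasDegree (fun t => u (join (circlePt r t) p)) d

end Dipole

end

/-!
Why the filling exists. Near `Δ = {0} × Δ'` the field `u` is singular only along the axis
`x̃ = 0`, because a finite union of simplices that meet `Δ` in `∂Δ` only stays away from thin cones
around `Δ`: a simplex that avoids the relative interior of `Δ` is separated from it by an affine
function, obtained from Farkas' lemma, which on `Δ` grows at least linearly in the distance to `∂Δ`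
(`eventually_coneNhd_subset`). On the punctured tube around `Δ`, whose fibres over the convex
interior of `Δ'` are punctured discs, the field of degree `d` has the form `u = exp (i (d t + ψ))`
with the angle `t` of `x̃` and a *single-valued* smooth function `ψ` (`exists_phase`).

The singularity is removed in a much thinner tube `|x̃| < δ κ(x̂)`, where `κ` is smooth, positive on
the interior of `Δ'` and zero outside. In terms of `q = |x̃| / (δ κ)` the competitor is
`f(q) exp (i (d t + g(q) ψ))`: from the wall of the tube inwards the phase is first deformed to `d t`
(`3/4 ≥ q ≥ 1/2`, modulus one), and then the modulus drops to zero (`1/2 ≥ q ≥ 1/4`). The map agrees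
with `u` near the wall and vanishes near the axis, so it is smooth (`TubeData.contDiffAt_filled`).

The graph of `v` has mass at most `∫ 1 + 2 |∇v| + J`, where `J` bounds the `2 × 2` minors of `∇v`:
an `n`-form of comass one is estimated on the frame `(eᵢ, ∂ᵢv)`, whose part of second order in `∇v`
consists of these minors (`graphMass_le`).

* The minors vanish where `|v| = 1`. Where the modulus varies the phase is exactly `d t`, and
  the minors integrate over each two-dimensional slice to `|d|` times the area `π` of the unit disc,
  up to a factor `1 + O(δ)` due to the slope of `κ` (`TubeData.lintegral_minorBound_le`).
* The gradient of `v` is bounded by that of `u`, by `1 / |x̃|` and by `|ψ| / |x̃|`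
  (`TubeData.norm_fderiv_core_le`) with constants independent of `δ`. The last term is summable by
  Hardy's inequality on the rays from the axis, as `|∇ψ| ≤ |∇u| + |d| / |x̃|`
  (`TubeData.lintegral_abs_ψ_ne_top`); this is where `κ |ψ| ≤ 1` at the radius `ρ / 2` is used, and
  no information on the decay of `ψ` is needed. Hence these terms are as small as desired for small
  `δ`, and `δ` is chosen in dependence of `ε`.

What remains is the volume of the cone, of order `ε²`, and twice the integral of `|∇u|` over
the cone. The axis has codimension two and therefore does not contribute to weak gradients
(`memW11_univ_of_differentiableAt`), which gives the equality of the traces.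
-/


open Set Filter Topology MeasureTheory Asymptotics
open scoped ContDiff ENNReal

noncomputable section

namespace Dipole

/-! ### Forms of comass one on graphs -/

/-- The graph map `a ↦ (a, L a)` of a linear map `L`. -/
def graphMap {n : ℕ} (L : Eu n →L[ℝ] Eu 2) : Eu n →ₗ[ℝ] GraphSpace n where
  toFun a := WithLp.toLp 2 (a, L a)
  map_add' a b := by rw [map_add]; rfl
  map_smul' c a := by rw [map_smul]; rfl

theorem inner_graphMap {n : ℕ} (L : Eu n →L[ℝ] Eu 2) (a b : Eu n) :
    inner ℝ (graphMap L a) (graphMap L b) = inner ℝ a b + inner ℝ (L a) (L b) := by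
  simp [graphMap, WithLp.prod_inner_apply]

/-- A linear map on `ℝⁿ` admits an orthonormal basis with pairwise orthogonal images: an
eigenbasis of `L† L`. -/
theorem exists_orthonormalBasis_inner_map_eq_zero {n : ℕ} (L : Eu n →L[ℝ] Eu 2) :
    ∃ f : OrthonormalBasis (Fin n) ℝ (Eu n), ∀ i j, i ≠ j → inner ℝ (L (f i)) (L (f j)) = 0 := by
  have hsym : (L.adjoint ∘L L : Eu n →L[ℝ] Eu n).toLinearMap.IsSymmetric := by
    intro a b
    simp [ContinuousLinearMap.adjoint_inner_left, ContinuousLinearMap.adjoint_inner_right]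
  have hn : Module.finrank ℝ (Eu n) = n := by simp
  refine ⟨hsym.eigenvectorBasis hn, fun i j hij => ?_⟩
  have h1 := hsym.apply_eigenvectorBasis hn j
  have h2 : inner ℝ (L (hsym.eigenvectorBasis hn i)) (L (hsym.eigenvectorBasis hn j)) =
      inner ℝ (hsym.eigenvectorBasis hn i)
        ((L.adjoint ∘L L : Eu n →L[ℝ] Eu n).toLinearMap (hsym.eigenvectorBasis hn j)) := by
    exact (ContinuousLinearMap.adjoint_inner_right L _ _).symm
  rw [h2, h1]
  simp only [inner_smul_right]
  rw [(hsym.eigenvectorBasis hn).orthonormal.2 hij]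
  simp

theorem norm_mul_norm_eq_abs_det {a b : Eu 2} (h : inner ℝ a b = 0) :
    ‖a‖ * ‖b‖ = |a 0 * b 1 - a 1 * b 0| := by
  have h' : a 0 * b 0 + a 1 * b 1 = 0 := by
    simpa [PiLp.inner_apply, Fin.sum_univ_two, mul_comm] using h
  rw [← abs_of_nonneg (mul_nonneg (norm_nonneg a) (norm_nonneg b)), ← sq_eq_sq_iff_abs_eq_abs,
    mul_pow, EuclideanSpace.real_norm_sq_eq, EuclideanSpace.real_norm_sq_eq]
  simp only [Fin.sum_univ_two]
  linear_combination (a 0 * b 0 + a 1 * b 1) * h'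

theorem sqrt_one_add_sq_le {a : ℝ} (ha : 0 ≤ a) : Real.sqrt (1 + a ^ 2) ≤ 1 + a := by
  rw [Real.sqrt_le_left (by positivity)]
  nlinarith

/-- For orthonormal `f` with orthogonal images at most two factors differ from one, since the
images lie in a plane. -/
theorem prod_sqrt_one_add_le {n : ℕ} (L : Eu n →L[ℝ] Eu 2) {J : ℝ} (hJ0 : 0 ≤ J)
    (hJ : ∀ a b, |L a 0 * L b 1 - L a 1 * L b 0| ≤ J * ‖a‖ * ‖b‖)
    (f : OrthonormalBasis (Fin n) ℝ (Eu n))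
    (hf : ∀ i j, i ≠ j → inner ℝ (L (f i)) (L (f j)) = 0) :
    ∏ i, Real.sqrt (1 + ‖L (f i)‖ ^ 2) ≤ 1 + 2 * ‖L‖ + J := by
  classical
  have hle : ∀ i, ‖L (f i)‖ ≤ ‖L‖ := fun i => by
    simpa using L.le_opNorm (f i)
  set S : Finset (Fin n) := Finset.univ.filter (fun i => L (f i) ≠ 0) with hS
  have hprod : ∏ i, Real.sqrt (1 + ‖L (f i)‖ ^ 2) = ∏ i ∈ S, Real.sqrt (1 + ‖L (f i)‖ ^ 2) := by
    symm
    apply Finset.prod_subset (Finset.subset_univ _)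
    intro i _ hi
    have : L (f i) = 0 := by simpa [hS] using hi
    simp [this]
  have hcard : S.card ≤ 2 := by
    have hli : LinearIndependent ℝ (fun i : S => L (f i)) := by
      apply linearIndependent_of_ne_zero_of_inner_eq_zero (𝕜 := ℝ)
      · intro i
        exact (Finset.mem_filter.1 i.2).2
      · intro i j hij
        exact hf _ _ (fun h => hij (Subtype.ext h))
    have := hli.fintype_card_le_finrank
    simpa using this
  rw [hprod]
  have hL := norm_nonneg L
  interval_cases hc : S.card
  · rw [Finset.card_eq_zero.1 hc]
    simp
    linarith
  · obtain ⟨i, hi⟩ := Finset.card_eq_one.1 hc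
    rw [hi, Finset.prod_singleton]
    have := sqrt_one_add_sq_le (norm_nonneg (L (f i)))
    linarith [hle i]
  · obtain ⟨i, j, hij, hi⟩ := Finset.card_eq_two.1 hc
    rw [hi, Finset.prod_pair hij]
    have h1 := sqrt_one_add_sq_le (norm_nonneg (L (f i)))
    have h2 := sqrt_one_add_sq_le (norm_nonneg (L (f j)))
    have h3 : ‖L (f i)‖ * ‖L (f j)‖ ≤ J := by
      rw [norm_mul_norm_eq_abs_det (hf i j hij)]
      simpa using hJ (f i) (f j)
    calc _ ≤ (1 + ‖L (f i)‖) * (1 + ‖L (f j)‖) := by gcongr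
      _ ≤ _ := by nlinarith [hle i, hle j]

/-- The integrand of the graph current: a covector of comass at most one is bounded on the graph
frame of `L` by `1 + 2 ‖L‖ + J`, where `J` bounds the `2 × 2` minors of `L`. -/
theorem abs_form_graph_le {n : ℕ} (ζ : (GraphSpace n) [⋀^Fin n]→L[ℝ] ℝ)
    (hζ : ∀ τ : Fin n → GraphSpace n, Orthonormal ℝ τ → |ζ τ| ≤ 1)
    (L : Eu n →L[ℝ] Eu 2) {J : ℝ} (hJ0 : 0 ≤ J)
    (hJ : ∀ a b, |L a 0 * L b 1 - L a 1 * L b 0| ≤ J * ‖a‖ * ‖b‖) :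
    |ζ (fun i => WithLp.toLp 2
      (EuclideanSpace.single i (1 : ℝ), L (EuclideanSpace.single i 1)))| ≤ 1 + 2 * ‖L‖ + J := by
  classical
  obtain ⟨f, hf⟩ := exists_orthonormalBasis_inner_map_eq_zero L
  set A : (Eu n) [⋀^Fin n]→ₗ[ℝ] ℝ := ζ.toAlternatingMap.compLinearMap (graphMap L) with hA
  set e := EuclideanSpace.basisFun (Fin n) ℝ with he
  have h1 : ζ (fun i => WithLp.toLp 2
      (EuclideanSpace.single i (1 : ℝ), L (EuclideanSpace.single i 1))) = A e := by
    simp [hA, he, graphMap]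
  have h2 : |A e| = |A f| := by
    have := congrArg (fun B : (Eu n) [⋀^Fin n]→ₗ[ℝ] ℝ => B e)
      (AlternatingMap.eq_smul_basis_det f.toBasis A)
    simp only [AlternatingMap.smul_apply, OrthonormalBasis.coe_toBasis, smul_eq_mul] at this
    rw [this, abs_mul]
    have hd : |f.toBasis.det e| = 1 := by
      rcases f.det_to_matrix_orthonormalBasis_real e with h | h <;> simp [h]
    rw [hd, mul_one]
  set N : Fin n → ℝ := fun i => Real.sqrt (1 + ‖L (f i)‖ ^ 2) with hN
  have hNpos : ∀ i, 0 < N i := fun i => by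
    simp only [hN]
    positivity
  have hNsq : ∀ i, N i * N i = 1 + ‖L (f i)‖ ^ 2 := fun i => Real.mul_self_sqrt (by positivity)
  set τ : Fin n → GraphSpace n := fun i => (N i)⁻¹ • graphMap L (f i) with hτ
  have hort : Orthonormal ℝ τ := by
    rw [orthonormal_iff_ite]
    intro i j
    simp only [hτ, inner_smul_left, inner_smul_right, inner_graphMap]
    by_cases hij : i = j
    · subst hij
      have : inner ℝ (f i) (f i) + inner ℝ (L (f i)) (L (f i)) = N i * N i := by
        rw [hNsq, real_inner_self_eq_norm_sq, real_inner_self_eq_norm_sq]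
        simp
      rw [this]
      have := (hNpos i).ne'
      simp
      field_simp
    · rw [hf i j hij, f.orthonormal.2 hij]
      simp [hij]
  have h3 : A f = (∏ i, N i) * ζ τ := by
    have : (fun i => graphMap L (f i)) = fun i => N i • τ i := by
      funext i
      simp only [hτ, smul_smul]
      rw [mul_inv_cancel₀ (hNpos i).ne', one_smul]
    have h4 : A f = ζ (fun i => graphMap L (f i)) := by
      simp [hA]
    rw [h4, this]
    exact ζ.toContinuousMultilinearMap.map_smul_univ N τ
  rw [h1, h2, h3, abs_mul, abs_of_pos (Finset.prod_pos fun i _ => hNpos i)]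
  calc (∏ i, N i) * |ζ τ| ≤ (∏ i, N i) * 1 := by
        exact mul_le_mul_of_nonneg_left (hζ τ hort) (Finset.prod_nonneg fun i _ => (hNpos i).le)
    _ = ∏ i, N i := mul_one _
    _ ≤ _ := prod_sqrt_one_add_le L hJ0 hJ f hf

/-- The mass of a graph over an open set, in terms of the gradient and of the minors. -/
theorem graphMass_le {n : ℕ} {U : Set (Eu n)} {v : Eu n → Eu 2} (hU : MeasurableSet U)
    {J : Eu n → ℝ} (hJ0 : ∀ x ∈ U, 0 ≤ J x)
    (hJ : ∀ᵐ x ∂(volume.restrict U), ∀ a b, |fderiv ℝ v x a 0 * fderiv ℝ v x b 1 -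
      fderiv ℝ v x a 1 * fderiv ℝ v x b 0| ≤ J x * ‖a‖ * ‖b‖) :
    graphMass U v ≤ ∫⁻ x in U, ENNReal.ofReal (1 + 2 * ‖fderiv ℝ v x‖ + J x) := by
  refine iSup_le fun η => iSup_le fun _ => iSup_le fun hη => ?_
  refine le_trans (ENNReal.ofReal_le_ofReal (le_abs_self _)) ?_
  rw [← Real.enorm_eq_ofReal_abs]
  refine le_trans (enorm_integral_le_lintegral_enorm _) ?_
  refine lintegral_mono_ae ?_
  filter_upwards [hJ, ae_restrict_mem hU] with x hx hxU
  rw [Real.enorm_eq_ofReal_abs]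
  exact ENNReal.ofReal_le_ofReal (abs_form_graph_le _ (hη _) _ (hJ0 x hxU) hx)

/-! ### Farkas' lemma -/

/-- **Farkas' lemma** for finitely many linear functionals, by induction on their number. -/
theorem farkas {V : Type*} [AddCommGroup V] [Module ℝ V] :
    ∀ (k : ℕ) (a : Fin k → V →ₗ[ℝ] ℝ) (b : V →ₗ[ℝ] ℝ),
      (∀ x, (∀ i, a i x ≤ 0) → b x ≤ 0) →
        ∃ c : Fin k → ℝ, (∀ i, 0 ≤ c i) ∧ b = ∑ i, c i • a i := by
  intro k
  induction k with
  | zero =>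
    intro a b h
    refine ⟨fun _ => 0, fun _ => le_rfl, ?_⟩
    ext x
    have h1 := h x (fun i => i.elim0)
    have h2 := h (-x) (fun i => i.elim0)
    simp only [map_neg] at h2
    simp
    linarith
  | succ k ih =>
    intro a b h
    by_cases hk : ∀ x, (∀ i : Fin k, a i.succ x ≤ 0) → b x ≤ 0
    · obtain ⟨c, hc, hb⟩ := ih (fun i => a i.succ) b hk
      refine ⟨Fin.cons 0 c, fun i => ?_, ?_⟩
      · refine Fin.cases ?_ (fun j => ?_) i <;> simp [hc]
      · rw [Fin.sum_univ_succ]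
        simpa using hb
    · push Not at hk
      obtain ⟨y, hy, hby⟩ := hk
      have hay : 0 < a 0 y := by
        by_contra hneg
        push Not at hneg
        exact absurd (h y (fun i => Fin.cases hneg hy i)) (not_le.2 hby)
      -- Eliminate the first functional by projecting along `y`.
      obtain ⟨c, hc, hb⟩ := ih (fun i => a i.succ - (a i.succ y / a 0 y) • a 0)
        (b - (b y / a 0 y) • a 0) (by
          intro x hx
          have h1 := h (x - (a 0 x / a 0 y) • y) (fun i => by
            refine Fin.cases ?_ (fun j => ?_) i
            · simp [hay.ne']
            · have := hx j
              simp only [LinearMap.sub_apply, LinearMap.smul_apply, smul_eq_mul] at this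
              simp only [map_sub, map_smul, smul_eq_mul]
              calc _ = a j.succ x - a j.succ y / a 0 y * a 0 x := by ring
                _ ≤ 0 := this)
          simp only [map_sub, map_smul, smul_eq_mul] at h1
          simp only [LinearMap.sub_apply, LinearMap.smul_apply, smul_eq_mul]
          calc _ = b x - a 0 x / a 0 y * b y := by ring
            _ ≤ 0 := h1)
      refine ⟨Fin.cons (b y / a 0 y - ∑ i, c i * (a i.succ y / a 0 y)) c, fun i => ?_, ?_⟩
      · refine Fin.cases ?_ (fun j => ?_) i
        · simp only [Fin.cons_zero]
          have : ∑ i, c i * (a i.succ y / a 0 y) ≤ 0 :=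
            Finset.sum_nonpos fun i _ => mul_nonpos_of_nonneg_of_nonpos (hc i)
              (div_nonpos_of_nonpos_of_nonneg (hy i) hay.le)
          have := div_pos hby hay
          linarith
        · simpa using hc j
      · rw [Fin.sum_univ_succ]
        ext x
        have hx := LinearMap.congr_fun hb x
        simp only [LinearMap.sub_apply, LinearMap.smul_apply, smul_eq_mul, LinearMap.sum_apply,
          mul_sub, Finset.sum_sub_distrib] at hx
        simp only [Fin.cons_zero, Fin.cons_succ, LinearMap.add_apply, LinearMap.smul_apply,
          smul_eq_mul, LinearMap.sum_apply, sub_mul, Finset.sum_mul]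
        have : ∀ i, c i * (a i.succ y / a 0 y) * a 0 x = c i * (a i.succ y / a 0 y * a 0 x) :=
          fun i => by ring
        simp only [this]
        linarith

theorem farkas_fintype {V ι : Type*} [AddCommGroup V] [Module ℝ V] [Fintype ι]
    (a : ι → V →ₗ[ℝ] ℝ) (b : V →ₗ[ℝ] ℝ) (h : ∀ x, (∀ i, a i x ≤ 0) → b x ≤ 0) :
    ∃ c : ι → ℝ, (∀ i, 0 ≤ c i) ∧ b = ∑ i, c i • a i := by
  set e := (Fintype.equivFin ι).symm
  obtain ⟨c, hc, hb⟩ := farkas _ (fun i => a (e i)) b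
    fun x hx => h x fun i => by simpa using hx (e.symm i)
  refine ⟨fun i => c (e.symm i), fun i => hc _, ?_⟩
  rw [hb, ← e.sum_comp]
  simp

/-! ### Full-dimensional simplices -/

section Simplex

variable {m : ℕ} (S : Affine.Simplex ℝ (Eu m) m)

/-- The vertices of a full-dimensional simplex as an affine basis. -/
def simplexBasis : AffineBasis (Fin (m + 1)) ℝ (Eu m) :=
  ⟨S.points, S.independent, by
    rw [S.independent.affineSpan_eq_top_iff_card_eq_finrank_add_one]
    simp⟩

theorem affineCombination_coord (p : Eu m) :
    Finset.univ.affineCombination ℝ S.points (fun i => (simplexBasis S).coord i p) = p :=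
  (simplexBasis S).affineCombination_coord_eq_self p

theorem mem_interior_iff (hm : 1 ≤ m) (p : Eu m) :
    p ∈ S.interior ↔ ∀ i, 0 < (simplexBasis S).coord i p := by
  have hsum := (simplexBasis S).sum_coord_apply_eq_one p
  conv_lhs => rw [← affineCombination_coord S p]
  rw [S.affineCombination_mem_interior_iff hsum]
  refine ⟨fun h i => (h i).1, fun h i => ⟨h i, ?_⟩⟩
  obtain ⟨j, hj⟩ : ∃ j : Fin (m + 1), j ≠ i := by
    have : Nontrivial (Fin (m + 1)) := Fin.nontrivial_iff_two_le.2 (by omega)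
    exact exists_ne i
  rw [← hsum]
  exact Finset.single_lt_sum hj (Finset.mem_univ _) (Finset.mem_univ _) (h j)
    (fun k _ _ => (h k).le)

theorem continuous_simplexCoord (i : Fin (m + 1)) : Continuous ((simplexBasis S).coord i) :=
  ((simplexBasis S).coord i).continuous_of_finiteDimensional

theorem isOpen_simplexInterior (hm : 1 ≤ m) : IsOpen S.interior := by
  have : S.interior = ⋂ i, {p | 0 < (simplexBasis S).coord i p} := by
    ext p
    simp [mem_interior_iff S hm]
  rw [this]
  exact isOpen_iInter_of_finite fun i => isOpen_lt continuous_const (continuous_simplexCoord S i)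

theorem convex_simplexInterior (hm : 1 ≤ m) : Convex ℝ S.interior := by
  have : S.interior = ⋂ i, (simplexBasis S).coord i ⁻¹' Ioi 0 := by
    ext p
    simp [mem_interior_iff S hm]
  rw [this]
  exact convex_iInter fun i => (convex_Ioi 0).affine_preimage _

theorem nonempty_simplexInterior (hm : 1 ≤ m) : S.interior.Nonempty := by
  have hpos : (0 : ℝ) < (m : ℝ) + 1 := by positivity
  refine ⟨Finset.univ.affineCombination ℝ S.points (fun _ => ((m : ℝ) + 1)⁻¹), ?_⟩
  have h1 : (1 : ℝ) ≤ m := by exact_mod_cast hm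
  rw [S.affineCombination_mem_interior_iff]
  · exact fun i => ⟨by positivity, inv_lt_one_of_one_lt₀ (by linarith)⟩
  · simp
    field_simp

theorem isClosed_simplexBdry (hm : 1 ≤ m) : IsClosed (simplexBdry S) :=
  S.isClosed_closedInterior.sdiff (isOpen_simplexInterior S hm)

theorem nonempty_simplexBdry (hm : 1 ≤ m) : (simplexBdry S).Nonempty := by
  refine ⟨S.points 0, S.point_mem_closedInterior 0, fun h => ?_⟩
  rw [mem_interior_iff S hm] at h
  obtain ⟨j, hj⟩ : ∃ j : Fin (m + 1), j ≠ 0 := by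
    have : Nontrivial (Fin (m + 1)) := Fin.nontrivial_iff_two_le.2 (by omega)
    exact exists_ne 0
  have := h j
  rw [show S.points 0 = simplexBasis S 0 from rfl, AffineBasis.coord_apply_ne _ hj] at this
  exact lt_irrefl _ this

theorem infDist_bdry_pos (hm : 1 ≤ m) {p : Eu m} (hp : p ∈ S.interior) :
    0 < Metric.infDist p (simplexBdry S) :=
  ((isClosed_simplexBdry S hm).notMem_iff_infDist_pos (nonempty_simplexBdry S hm)).1
    fun h => h.2 hp

theorem ball_infDist_subset (hm : 1 ≤ m) {p : Eu m} (hp : p ∈ S.interior) :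
    Metric.ball p (Metric.infDist p (simplexBdry S)) ⊆ S.interior := by
  have hdisj : Disjoint (Metric.ball p (Metric.infDist p (simplexBdry S))) (simplexBdry S) :=
    Metric.disjoint_ball_infDist
  have hpre : IsPreconnected (Metric.ball p (Metric.infDist p (simplexBdry S))) :=
    (convex_ball _ _).isPreconnected
  intro q hq
  by_contra hq'
  have hqc : q ∉ S.closedInterior := fun h => hdisj.le_bot ⟨hq, h, hq'⟩
  obtain ⟨z, hz, hz1, hz2⟩ := hpre S.interior S.closedInteriorᶜ (isOpen_simplexInterior S hm)
    S.isClosed_closedInterior.isOpen_compl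
    (fun y hy => by
      by_cases h : y ∈ S.interior
      · exact Or.inl h
      · exact Or.inr fun h' => hdisj.le_bot ⟨hy, h', h⟩)
    ⟨p, Metric.mem_ball_self (infDist_bdry_pos S hm hp), hp⟩ ⟨q, hq, hqc⟩
  exact hz2 (S.interior_subset_closedInterior hz1)

/-- A nonnegative affine function on the simplex that does not vanish identically in the interior
grows at least linearly with the distance to the boundary: its slope is felt on the whole ball
around `p` that touches the boundary. -/
theorem exists_mul_infDist_le (hm : 1 ≤ m) (l : Eu m →L[ℝ] ℝ) (γ : ℝ)
    (h0 : ∀ p ∈ S.interior, 0 ≤ l p + γ) {p₀ : Eu m} (hp₀ : p₀ ∈ S.interior)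
    (hpos : 0 < l p₀ + γ) :
    ∃ c : ℝ, 0 < c ∧ ∀ p ∈ S.interior, c * Metric.infDist p (simplexBdry S) ≤ l p + γ := by
  by_cases hl : l = 0
  · obtain ⟨q, hq⟩ := nonempty_simplexBdry S hm
    obtain ⟨M, hM⟩ := (S.isCompact_closedInterior.isBounded).subset_closedBall q
    have hM0 : 0 ≤ M := by
      have := hM (S.interior_subset_closedInterior hp₀)
      exact le_trans dist_nonneg this
    subst hl
    simp only [zero_apply, zero_add] at hpos ⊢
    refine ⟨γ / (M + 1), by positivity, fun p hp => ?_⟩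
    have h1 : Metric.infDist p (simplexBdry S) ≤ M + 1 :=
      (Metric.infDist_le_dist_of_mem hq).trans
        ((hM (S.interior_subset_closedInterior hp)).out.trans (by linarith))
    calc _ ≤ γ / (M + 1) * (M + 1) := by gcongr
      _ = γ := by field_simp
  · set g := (InnerProductSpace.toDual ℝ (Eu m)).symm l with hg
    have hlg : ∀ p, l p = inner ℝ g p := fun p => by
      rw [hg, InnerProductSpace.toDual_symm_apply]
    have hg0 : 0 < ‖g‖ := by
      rw [norm_pos_iff]
      simpa [hg] using hl
    refine ⟨‖g‖, hg0, fun p hp => ?_⟩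
    have key : ∀ s ∈ Ioo 0 (Metric.infDist p (simplexBdry S)), ‖g‖ * s ≤ l p + γ := by
      intro s hs
      have hmem : p - (s / ‖g‖) • g ∈ S.interior := by
        apply ball_infDist_subset S hm hp
        rw [Metric.mem_ball, dist_eq_norm]
        simp only [sub_sub_cancel_left, norm_neg, norm_smul, norm_div, Real.norm_eq_abs,
          abs_norm]
        rw [div_mul_cancel₀ _ hg0.ne', abs_of_pos hs.1]
        exact hs.2
      have := h0 _ hmem
      rw [map_sub, map_smul, hlg g, real_inner_self_eq_norm_sq, smul_eq_mul] at this
      have h2 : s / ‖g‖ * ‖g‖ ^ 2 = ‖g‖ * s := by field_simp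
      linarith
    have hD := infDist_bdry_pos S hm hp
    have hlim : Tendsto (fun s => ‖g‖ * s) (𝓝[<] Metric.infDist p (simplexBdry S))
        (𝓝 (‖g‖ * Metric.infDist p (simplexBdry S))) :=
      (tendsto_nhdsWithin_of_tendsto_nhds tendsto_id).const_mul _
    refine le_of_tendsto hlim ?_
    filter_upwards [Ioo_mem_nhdsLT hD] with s hs using key s hs

end Simplex

/-! ### The splitting `ℝ^{m+2} = ℝ² × ℝᵐ` -/

/-- The projection `x ↦ x̃` as a continuous linear map. -/
def tildeL (m : ℕ) : Eu (m + 2) →L[ℝ] Eu 2 :=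
  LinearMap.toContinuousLinearMap
    { toFun := tildePart
      map_add' := fun x y => by ext i; fin_cases i <;> simp [tildePart]
      map_smul' := fun c x => by ext i; fin_cases i <;> simp [tildePart] }

/-- The projection `x ↦ x̂` as a continuous linear map. -/
def hatL (m : ℕ) : Eu (m + 2) →L[ℝ] Eu m :=
  LinearMap.toContinuousLinearMap
    { toFun := hatPart
      map_add' := fun x y => by ext i; simp [hatPart]
      map_smul' := fun c x => by ext i; simp [hatPart] }

@[simp] theorem tildeL_apply {m : ℕ} (x : Eu (m + 2)) : tildeL m x = tildePart x := rfl

@[simp] theorem hatL_apply {m : ℕ} (x : Eu (m + 2)) : hatL m x = hatPart x := rfl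

theorem join_tildePart_hatPart {m : ℕ} (x : Eu (m + 2)) : join (tildePart x) (hatPart x) = x := by
  ext i
  refine Fin.cases ?_ (fun i => Fin.cases ?_ (fun j => ?_) i) i <;>
    simp [join, tildePart, hatPart]

theorem norm_sq_join {m : ℕ} (a : Eu 2) (p : Eu m) : ‖join a p‖ ^ 2 = ‖a‖ ^ 2 + ‖p‖ ^ 2 := by
  simp only [EuclideanSpace.real_norm_sq_eq, Fin.sum_univ_succ, join]
  simp [add_assoc]

theorem norm_sq_eq {m : ℕ} (x : Eu (m + 2)) : ‖x‖ ^ 2 = ‖tildePart x‖ ^ 2 + ‖hatPart x‖ ^ 2 := by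
  conv_lhs => rw [← join_tildePart_hatPart x]
  exact norm_sq_join _ _

theorem norm_tildePart_le {m : ℕ} (x : Eu (m + 2)) : ‖tildePart x‖ ≤ ‖x‖ := by
  have := norm_sq_eq x
  exact abs_le_of_sq_le_sq' (by nlinarith [sq_nonneg ‖hatPart x‖]) (norm_nonneg _) |>.2

theorem norm_hatPart_le {m : ℕ} (x : Eu (m + 2)) : ‖hatPart x‖ ≤ ‖x‖ := by
  have := norm_sq_eq x
  exact abs_le_of_sq_le_sq' (by nlinarith [sq_nonneg ‖tildePart x‖]) (norm_nonneg _) |>.2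

/-- The map `(a, p) ↦ join a p` as a continuous linear map. -/
def joinL (m : ℕ) : (Eu 2 × Eu m) →L[ℝ] Eu (m + 2) :=
  LinearMap.toContinuousLinearMap
    { toFun := fun q => join q.1 q.2
      map_add' := fun x y => by
        ext i
        refine Fin.cases ?_ (fun i => Fin.cases ?_ (fun j => ?_) i) i <;> simp [join]
      map_smul' := fun c x => by
        ext i
        refine Fin.cases ?_ (fun i => Fin.cases ?_ (fun j => ?_) i) i <;> simp [join] }

@[simp] theorem joinL_apply {m : ℕ} (q : Eu 2 × Eu m) : joinL m q = join q.1 q.2 := rfl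

theorem continuous_tildePart {m : ℕ} : Continuous (tildePart : Eu (m + 2) → Eu 2) :=
  (tildeL m).continuous

theorem continuous_hatPart {m : ℕ} : Continuous (hatPart : Eu (m + 2) → Eu m) :=
  (hatL m).continuous

theorem continuous_join {m : ℕ} : Continuous (fun q : Eu 2 × Eu m => join q.1 q.2) :=
  (joinL m).continuous

/-! ### The cone neighbourhood avoids the other simplices -/

/-- If the closed simplices `T` and `{0} × S` meet only at boundary points of the latter, some
affine function is nonpositive on `T` and positive on `{0} × int S`. Otherwise, by Farkas' lemma,
each vertex of `S` is a nonnegative combination of the vertices of `T` and the negatives of the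
vertices of `S`, and adding these relations gives a point of `T` in the interior of `S`. -/
theorem exists_affine_separating {m : ℕ} (hm : 1 ≤ m) (S : Affine.Simplex ℝ (Eu m) m)
    (T : Affine.Simplex ℝ (Eu (m + 2)) m)
    (hT : T.closedInterior ∩ flat S.closedInterior ⊆ flat (simplexBdry S)) :
    ∃ (l : Eu (m + 2) →L[ℝ] ℝ) (γ : ℝ), (∀ x ∈ T.closedInterior, l x + γ ≤ 0) ∧
      ∀ p ∈ S.interior, 0 < l (join 0 p) + γ := by
  -- The functional `(g, γ) ↦ ⟪x, g⟫ + γ` on the space of affine functions.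
  let ev : Eu (m + 2) → (Eu (m + 2) × ℝ →ₗ[ℝ] ℝ) := fun x =>
    ((innerSL ℝ x).toLinearMap.comp (LinearMap.fst ℝ _ _)) + LinearMap.snd ℝ _ _
  have hev : ∀ x y, ev x y = inner ℝ x y.1 + y.2 := fun x y => rfl
  let sp : Fin (m + 1) → Eu (m + 2) := fun i => join 0 (S.points i)
  let a : Fin (m + 1) ⊕ Fin (m + 1) → (Eu (m + 2) × ℝ →ₗ[ℝ] ℝ) :=
    Sum.elim (fun j => ev (T.points j)) (fun j => - ev (sp j))
  by_cases hsep : ∃ y, (∀ j, a j y ≤ 0) ∧ ∃ i, 0 < ev (sp i) y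
  · obtain ⟨y, hy, i, hi⟩ := hsep
    have hcomb : ∀ (k : ℕ) (P : Affine.Simplex ℝ (Eu (m + 2)) k) (w : Fin (k + 1) → ℝ),
        ∑ i, w i = 1 → inner ℝ (Finset.univ.affineCombination ℝ P.points w) y.1 + y.2 =
          ∑ i, w i * ev (P.points i) y := by
      intro k P w hw
      rw [Finset.affineCombination_eq_linear_combination _ _ _ hw, sum_inner]
      simp only [hev, mul_add, Finset.sum_add_distrib, ← Finset.sum_mul, hw, one_mul,
        real_inner_smul_left]
    refine ⟨innerSL ℝ y.1, y.2, ?_, ?_⟩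
    · rintro x ⟨w, hw, hw', rfl⟩
      rw [innerSL_apply_apply, real_inner_comm, hcomb _ T w hw]
      exact Finset.sum_nonpos fun j _ => mul_nonpos_of_nonneg_of_nonpos (hw' j).1 (hy (Sum.inl j))
    · intro p hp
      have hw := (simplexBasis S).sum_coord_apply_eq_one p
      have hpos := (mem_interior_iff S hm p).1 hp
      have h1 : join 0 p = ∑ i, (simplexBasis S).coord i p • sp i := by
        have h2 := affineCombination_coord S p
        rw [Finset.affineCombination_eq_linear_combination _ _ _ hw] at h2
        have h3 := congrArg (fun q => joinL m ((0 : Eu 2), q)) h2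
        have h4 : ∀ q : Eu m, joinL m ((0 : Eu 2), q) =
            ((joinL m).comp (ContinuousLinearMap.inr ℝ (Eu 2) (Eu m))) q := fun q => by simp
        simp only [h4, map_sum, map_smul] at h3
        simpa [sp] using h3.symm
      have h5 : inner ℝ (join 0 p) y.1 + y.2 = ∑ i, (simplexBasis S).coord i p * ev (sp i) y := by
        rw [h1, sum_inner]
        simp only [hev, mul_add, Finset.sum_add_distrib, ← Finset.sum_mul, hw, one_mul,
          real_inner_smul_left]
      rw [innerSL_apply_apply, real_inner_comm, h5]
      refine Finset.sum_pos' (fun j _ => mul_nonneg (hpos j).le ?_)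
        ⟨i, Finset.mem_univ _, mul_pos (hpos i) hi⟩
      have := hy (Sum.inr j)
      simp only [a, Sum.elim_inr, LinearMap.neg_apply] at this
      linarith
  · exfalso
    push Not at hsep
    have hf : ∀ i, ∃ c : Fin (m + 1) ⊕ Fin (m + 1) → ℝ, (∀ j, 0 ≤ c j) ∧
        ev (sp i) = ∑ j, c j • a j := fun i =>
      farkas_fintype a (ev (sp i)) fun y hy => hsep y hy i
    choose c hc hci using hf
    have hrel : ∀ (i : Fin (m + 1)) (y : Eu (m + 2) × ℝ), ev (sp i) y +
        ∑ j, c i (Sum.inr j) * ev (sp j) y = ∑ j, c i (Sum.inl j) * ev (T.points j) y := by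
      intro i y
      have := LinearMap.congr_fun (hci i) y
      rw [this]
      simp [a, Fintype.sum_sum_type, LinearMap.sum_apply]
    set N : Fin (m + 1) → ℝ := fun j => 1 + ∑ i, c i (Sum.inr j) with hN
    set M : Fin (m + 1) → ℝ := fun j => ∑ i, c i (Sum.inl j) with hM
    have htot : ∀ y, ∑ j, N j * ev (sp j) y = ∑ j, M j * ev (T.points j) y := by
      intro y
      have := Finset.sum_congr rfl fun i (_ : i ∈ Finset.univ) => hrel i y
      rw [Finset.sum_add_distrib, Finset.sum_comm,
        Finset.sum_comm (f := fun i j => c i (Sum.inl j) * ev (T.points j) y)] at this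
      simp only [hN, hM, add_mul, one_mul, Finset.sum_add_distrib, Finset.sum_mul]
      exact this
    have hNpos : ∀ j, 0 < N j := fun j => by
      have : 0 ≤ ∑ i, c i (Sum.inr j) := Finset.sum_nonneg fun i _ => hc i _
      simp only [hN]
      linarith
    have hMpos : ∀ j, 0 ≤ M j := fun j => Finset.sum_nonneg fun i _ => hc i _
    set Z := ∑ j, N j with hZ
    have hZpos : 0 < Z := Finset.sum_pos (fun j _ => hNpos j) Finset.univ_nonempty
    have hZM : ∑ j, M j = Z := by
      have := htot (0, 1)
      simp only [hev, inner_zero_right, zero_add, mul_one] at this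
      exact this.symm
    have hvec : ∑ j, N j • sp j = ∑ j, M j • T.points j := by
      refine ext_inner_right ℝ fun g => ?_
      have := htot (g, 0)
      simpa only [hev, add_zero, sum_inner, real_inner_smul_left] using this
    have hw1 : ∑ j, N j / Z = 1 := by rw [← Finset.sum_div, div_self hZpos.ne']
    have hw2 : ∑ j, M j / Z = 1 := by rw [← Finset.sum_div, hZM, div_self hZpos.ne']
    set p := Finset.univ.affineCombination ℝ S.points (fun j => N j / Z) with hp
    have hpO : p ∈ S.interior := by
      rw [hp, mem_interior_iff S hm]
      intro i
      have := (simplexBasis S).coord_apply_combination_of_mem (Finset.mem_univ i) hw1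
      have h2 : (simplexBasis S).coord i (Finset.univ.affineCombination ℝ S.points
        (fun j => N j / Z)) = N i / Z := this
      rw [h2]
      exact div_pos (hNpos i) hZpos
    have hjoin : join 0 p = Finset.univ.affineCombination ℝ T.points (fun j => M j / Z) := by
      rw [hp, Finset.affineCombination_eq_linear_combination _ _ _ hw2,
        Finset.affineCombination_eq_linear_combination _ _ _ hw1]
      have h4 : ∀ q : Eu m, join (0 : Eu 2) q =
            ((joinL m).comp (ContinuousLinearMap.inr ℝ (Eu 2) (Eu m))) q := fun q => by simp
      rw [h4, map_sum]
      simp only [map_smul]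
      simp only [← h4]
      have := congrArg (fun q => Z⁻¹ • q) hvec
      simpa only [Finset.smul_sum, smul_smul, div_eq_inv_mul] using this
    have hpT : join 0 p ∈ T.closedInterior := by
      rw [hjoin, T.affineCombination_mem_closedInterior_iff hw2]
      intro j
      refine ⟨div_nonneg (hMpos j) hZpos.le, (div_le_one hZpos).2 ?_⟩
      rw [← hZM]
      exact Finset.single_le_sum (fun i _ => hMpos i) (Finset.mem_univ j)
    have := (hT ⟨hpT, tildePart_join _ _, by
      rw [hatPart_join]
      exact S.interior_subset_closedInterior hpO⟩).2
    rw [hatPart_join] at this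
    exact this.2 hpO

theorem mem_interior_of_mem_coneNhd {m : ℕ} {S : Affine.Simplex ℝ (Eu m) m} {ε : ℝ}
    {x : Eu (m + 2)} (hx : x ∈ coneNhd S ε \ flat (simplexBdry S)) : hatPart x ∈ S.interior := by
  by_contra h
  have hb : hatPart x ∈ simplexBdry S := ⟨hx.1.1, h⟩
  have h0 : Metric.infDist (hatPart x) (simplexBdry S) = 0 := Metric.infDist_zero_of_mem hb
  have h1 := hx.1.2
  rw [h0, mul_zero] at h1
  exact hx.2 ⟨norm_le_zero_iff.1 h1, hb⟩

/-- An affine function that is positive on `{0} × int S` is positive on narrow cone neighbourhoods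
of `S`, since on `{0} × S` it grows at least linearly in the distance to the boundary. -/
theorem eventually_pos_on_cone {m : ℕ} (hm : 1 ≤ m) (S : Affine.Simplex ℝ (Eu m) m)
    (l : Eu (m + 2) →L[ℝ] ℝ) (γ : ℝ) (h : ∀ p ∈ S.interior, 0 < l (join 0 p) + γ) :
    ∀ᶠ ε in 𝓝[>] (0 : ℝ), ∀ x ∈ coneNhd S ε \ flat (simplexBdry S), 0 < l x + γ := by
  obtain ⟨p₀, hp₀⟩ := nonempty_simplexInterior S hm
  obtain ⟨c, hc, hcp⟩ := exists_mul_infDist_le S hm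
    (l.comp ((joinL m).comp (ContinuousLinearMap.inr ℝ (Eu 2) (Eu m)))) γ
    (fun p hp => by simpa using (h p hp).le) hp₀ (by simpa using h p₀ hp₀)
  have hpos : 0 < c / (‖l‖ + 1) := by positivity
  filter_upwards [Ioo_mem_nhdsGT hpos] with ε hε x hx
  have hxO := mem_interior_of_mem_coneNhd hx
  have h1 := hcp _ hxO
  have hD := infDist_bdry_pos S hm hxO
  simp only [ContinuousLinearMap.comp_apply, ContinuousLinearMap.inr_apply, joinL_apply] at h1
  have h2 : l x = l (join (tildePart x) 0) + l (join 0 (hatPart x)) := by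
    rw [← map_add]
    conv_lhs => rw [← join_tildePart_hatPart x]
    rw [← joinL_apply (tildePart x, (0 : Eu m)), ← joinL_apply ((0 : Eu 2), hatPart x), ← map_add]
    simp
  have h3 : ‖join (tildePart x) (0 : Eu m)‖ = ‖tildePart x‖ := by
    have := norm_sq_join (tildePart x) (0 : Eu m)
    rw [norm_zero] at this
    exact (pow_left_inj₀ (norm_nonneg _) (norm_nonneg _) two_ne_zero).1 (by simpa using this)
  have h4 := l.le_opNorm (join (tildePart x) (0 : Eu m))
  rw [h3, Real.norm_eq_abs] at h4
  have h5 := hx.1.2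
  have h6 : ‖l‖ * ‖tildePart x‖ ≤ ‖l‖ * (ε * Metric.infDist (hatPart x) (simplexBdry S)) := by
    gcongr
  have h7 : ε * (‖l‖ + 1) < c := (lt_div_iff₀ (by positivity)).1 hε.2
  have h8 := neg_abs_le (l (join (tildePart x) (0 : Eu m)))
  have h9 : ‖l‖ * (ε * Metric.infDist (hatPart x) (simplexBdry S)) <
      c * Metric.infDist (hatPart x) (simplexBdry S) := by
    have h10 : ‖l‖ * ε < c := by nlinarith [hε.1]
    nlinarith
  rw [h2]
  linarith

/-- Narrow cone neighbourhoods of the simplex lie in the cube and avoid the other simplices. -/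
theorem eventually_coneNhd_subset {m : ℕ} (hm : 1 ≤ m)
    (Φ : Eu (m + 2) ≃ᵃⁱ[ℝ] Eu (m + 2)) (S : Affine.Simplex ℝ (Eu m) m)
    (hS : flat S.interior ⊆ Φ ⁻¹' cube (m + 2)) (k : ℕ)
    (T : Fin k → Affine.Simplex ℝ (Eu (m + 2)) m)
    (hT : ∀ i, (T i).closedInterior ∩ flat S.closedInterior ⊆ flat (simplexBdry S)) :
    ∀ᶠ ε in 𝓝[>] (0 : ℝ), coneNhd S ε \ flat (simplexBdry S) ⊆
      (Φ ⁻¹' cube (m + 2)) \ ⋃ i, (T i).closedInterior := by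
  have h1 : ∀ i, ∀ᶠ ε in 𝓝[>] (0 : ℝ), ∀ x ∈ coneNhd S ε \ flat (simplexBdry S),
      x ∉ (T i).closedInterior := by
    intro i
    obtain ⟨l, γ, hl1, hl2⟩ := exists_affine_separating hm S (T i) (hT i)
    filter_upwards [eventually_pos_on_cone hm S l γ hl2] with ε hε x hx hxT
    exact absurd (hl1 x hxT) (not_le.2 (hε x hx))
  have hΦ : ∀ x i, Φ x i =
      ((EuclideanSpace.proj i : Eu (m + 2) →L[ℝ] ℝ).comp
        (Φ.linearIsometryEquiv : Eu (m + 2) →L[ℝ] Eu (m + 2))) x + Φ 0 i := by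
    intro x i
    have := Φ.map_vadd 0 x
    simp only [vadd_eq_add, add_zero] at this
    rw [this]
    simp
  have hflat : ∀ p ∈ S.interior, ∀ i, |Φ (join 0 p) i| < 1 := fun p hp =>
    hS ⟨tildePart_join _ _, by rwa [hatPart_join]⟩
  have h2 : ∀ i, ∀ᶠ ε in 𝓝[>] (0 : ℝ), ∀ x ∈ coneNhd S ε \ flat (simplexBdry S),
      |Φ x i| < 1 := by
    intro i
    set l := ((EuclideanSpace.proj i : Eu (m + 2) →L[ℝ] ℝ).comp
        (Φ.linearIsometryEquiv : Eu (m + 2) →L[ℝ] Eu (m + 2))) with hl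
    filter_upwards [eventually_pos_on_cone hm S l (1 + Φ 0 i) (fun p hp => by
        have := (abs_lt.1 (hflat p hp i)).1
        rw [hΦ] at this
        linarith), eventually_pos_on_cone hm S (-l) (1 - Φ 0 i) (fun p hp => by
        have := (abs_lt.1 (hflat p hp i)).2
        rw [hΦ] at this
        simp only [neg_apply]
        linarith)] with ε he1 he2 x hx
    have e1 := he1 x hx
    have e2 := he2 x hx
    simp only [neg_apply] at e2
    rw [abs_lt, hΦ]
    constructor <;> linarith
  filter_upwards [eventually_all.2 h1, eventually_all.2 h2] with ε he1 he2 x hx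
  exact ⟨fun i => he2 i x hx, by simpa using fun i => he1 i x hx⟩

/-! ### Weak and classical gradients -/

theorem integrable_smul_of_support_subset {n : ℕ} {F : Type*} [NormedAddCommGroup F]
    [NormedSpace ℝ F] {U : Set (Eu n)} {f : Eu n → F} (hf : IntegrableOn f U)
    {h : Eu n → ℝ} (hh : Continuous h) (hc : HasCompactSupport h) (hU : tsupport h ⊆ U) :
    Integrable (fun x => h x • f x) := by
  obtain ⟨C, hC⟩ := hh.bounded_above_of_compact_support hc
  rw [← integrableOn_iff_integrable_of_support_subset (s := U)]
  · exact Integrable.bdd_smul hf C hh.aestronglyMeasurable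
      (Eventually.of_forall hC)
  · intro x hx
    refine hU (subset_tsupport _ fun h0 => hx ?_)
    simp [h0]

theorem continuous_fderiv_apply_of_contDiff {n : ℕ} {φ : Eu n → ℝ} (hφ : ContDiff ℝ ∞ φ)
    (e : Eu n) : Continuous (fun x => fderiv ℝ φ x e) :=
  (hφ.continuous_fderiv (by simp)).clm_apply continuous_const

/-- Integration by parts against a test function supported in an open set where the map is
smooth. -/
theorem setIntegral_fderiv_smul_eq {n : ℕ} {U : Set (Eu n)} (hU : IsOpen U)
    {v : Eu n → Eu 2} (hv : ContDiffOn ℝ ∞ v U) {φ : Eu n → ℝ} (hφ : ContDiff ℝ ∞ φ)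
    (hc : HasCompactSupport φ) (hs : tsupport φ ⊆ U) (e : Eu n) :
    ∫ x in U, (fderiv ℝ φ x e) • v x = - ∫ x in U, φ x • fderiv ℝ v x e := by
  have hvd : ∀ x ∈ U, DifferentiableAt ℝ v x := fun x hx =>
    (hv.contDiffAt (hU.mem_nhds hx)).differentiableAt (by simp)
  have hvc : ContinuousOn v (tsupport φ) := hv.continuousOn.mono hs
  have hdc : ContinuousOn (fderiv ℝ v) (tsupport φ) :=
    (hv.continuousOn_fderiv_of_isOpen hU (by simp)).mono hs
  have hiv : IntegrableOn v (tsupport φ) := hvc.integrableOn_compact hc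
  have hid : IntegrableOn (fun x => fderiv ℝ v x e) (tsupport φ) :=
    (hdc.clm_apply continuousOn_const).integrableOn_compact hc
  have hsd : tsupport (fun x => fderiv ℝ φ x e) ⊆ tsupport φ := tsupport_fderiv_apply_subset ℝ e
  have h0 : ∀ x, x ∉ U → φ x = 0 := fun x hx => image_eq_zero_of_notMem_tsupport fun h => hx (hs h)
  have h0' : ∀ x, x ∉ U → fderiv ℝ φ x e = 0 := fun x hx =>
    image_eq_zero_of_notMem_tsupport (f := fun x => fderiv ℝ φ x e) fun h => hx (hs (hsd h))
  rw [setIntegral_eq_integral_of_forall_compl_eq_zero fun x hx => by rw [h0' x hx, zero_smul],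
    setIntegral_eq_integral_of_forall_compl_eq_zero fun x hx => by rw [h0 x hx, zero_smul],
    integral_smul_fderiv_eq_neg_fderiv_smul_of_integrable, neg_neg]
  · exact integrable_smul_of_support_subset hiv (continuous_fderiv_apply_of_contDiff hφ e)
      (hc.fderiv_apply ℝ e) hsd
  · exact integrable_smul_of_support_subset hid hφ.continuous hc subset_rfl
  · exact integrable_smul_of_support_subset hiv hφ.continuous hc subset_rfl
  · exact fun x _ => hφ.differentiable (by simp) x
  · exact fun x hx => hvd x (hs hx)

theorem memW11_of_contDiffOn {n : ℕ} {U : Set (Eu n)} (hU : IsOpen U) {v : Eu n → Eu 2}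
    (hv : ContDiffOn ℝ ∞ v U) (hi : IntegrableOn v U) (hd : IntegrableOn (fderiv ℝ v) U) :
    MemW11 U v :=
  ⟨hi, fderiv ℝ v, hd, fun _ hφ hc hs e => setIntegral_fderiv_smul_eq hU hv hφ hc hs e⟩

/-- On an open set where a Sobolev map is smooth, its weak gradient is the classical one, which is
therefore summable. -/
theorem MemW11.integrableOn_fderiv {n : ℕ} {Q U : Set (Eu n)} {u : Eu n → Eu 2}
    (hu : MemW11 Q u) (hUQ : U ⊆ Q) (hU : IsOpen U) (hs : ContDiffOn ℝ ∞ u U) :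
    IntegrableOn (fderiv ℝ u) U := by
  obtain ⟨-, g, hg, hgw⟩ := hu
  have hgU : IntegrableOn g U := hg.mono_set hUQ
  have hdc : ContinuousOn (fderiv ℝ u) U := hs.continuousOn_fderiv_of_isOpen hU (by simp)
  have hloc : LocallyIntegrableOn (fderiv ℝ u) U := hdc.locallyIntegrableOn hU.measurableSet
  have hae : ∀ᵐ x, x ∈ U → g x - fderiv ℝ u x = 0 := by
    refine hU.ae_eq_zero_of_integral_contDiff_smul_eq_zero
      (f := fun x => g x - fderiv ℝ u x) (hgU.locallyIntegrableOn.sub hloc)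
      fun φ hφ hc hsupp => ?_
    have hi1 : Integrable (fun x => φ x • g x) :=
      integrable_smul_of_support_subset hgU hφ.continuous hc hsupp
    have hi2 : Integrable (fun x => φ x • fderiv ℝ u x) :=
      integrable_smul_of_support_subset
        ((hdc.mono hsupp).integrableOn_compact hc) hφ.continuous hc subset_rfl
    have h0 : ∀ x, x ∉ U → φ x = 0 := fun x hx =>
      image_eq_zero_of_notMem_tsupport fun h => hx (hsupp h)
    have h0' : ∀ e x, x ∉ U → fderiv ℝ φ x e = 0 := fun e x hx =>
      image_eq_zero_of_notMem_tsupport (f := fun x => fderiv ℝ φ x e)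
        fun h => hx (hsupp (tsupport_fderiv_apply_subset ℝ e h))
    simp only [smul_sub]
    rw [integral_sub hi1 hi2, sub_eq_zero]
    ext1 e
    rw [ContinuousLinearMap.integral_apply hi1, ContinuousLinearMap.integral_apply hi2]
    have e1 := hgw φ hφ hc (hsupp.trans hUQ) e
    have e2 := setIntegral_fderiv_smul_eq hU hs hφ hc hsupp e
    rw [setIntegral_eq_integral_of_forall_compl_eq_zero fun x hx => by
        rw [h0' e x fun h => hx (hUQ h), zero_smul],
      setIntegral_eq_integral_of_forall_compl_eq_zero fun x hx => by
        rw [h0 x fun h => hx (hUQ h), zero_smul]] at e1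
    rw [setIntegral_eq_integral_of_forall_compl_eq_zero fun x hx => by
        rw [h0' e x hx, zero_smul],
      setIntegral_eq_integral_of_forall_compl_eq_zero fun x hx => by
        rw [h0 x hx, zero_smul]] at e2
    simpa using neg_injective (e1.symm.trans e2)
  refine hgU.congr ?_
  rw [EventuallyEq, ae_restrict_iff' hU.measurableSet]
  filter_upwards [hae] with x hx hxU
  exact sub_eq_zero.1 (hx hxU)

/-! ### Removing the plane of codimension two -/

theorem volume_tildePart_eq_zero (m : ℕ) :
    volume {x : Eu (m + 2) | tildePart x = 0} = 0 := by
  have h : {x : Eu (m + 2) | tildePart x = 0} = (LinearMap.ker (tildeL m).toLinearMap : Set _) := by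
    ext x
    simp
  rw [h]
  refine Measure.addHaar_submodule _ _ fun htop => ?_
  have h1 : join (EuclideanSpace.single 0 1) 0 ∈ LinearMap.ker (tildeL m).toLinearMap := by
    rw [htop]
    trivial
  have h2 : tildePart (join (EuclideanSpace.single 0 1) (0 : Eu m)) = 0 := by simpa using h1
  rw [tildePart_join] at h2
  simpa using congrArg (fun a : Eu 2 => a 0) h2

theorem ae_tildePart_ne_zero (m : ℕ) : ∀ᵐ x : Eu (m + 2), tildePart x ≠ 0 := by
  rw [ae_iff]
  simpa using volume_tildePart_eq_zero m

/-- A cutoff vanishing for `|x̃| ≤ 1/k` and equal to one for `|x̃| ≥ 2/k`. -/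
def axisCutoff {m : ℕ} (k : ℝ) (x : Eu (m + 2)) : ℝ :=
  Real.smoothTransition (k ^ 2 * ‖tildePart x‖ ^ 2 - 1)

theorem contDiff_norm_sq_tildePart {m : ℕ} :
    ContDiff ℝ ∞ (fun x : Eu (m + 2) => ‖tildePart x‖ ^ 2) :=
  (contDiff_norm_sq ℝ).comp (tildeL m).contDiff

theorem contDiff_axisCutoff {m : ℕ} (k : ℝ) :
    ContDiff ℝ ∞ (axisCutoff k : Eu (m + 2) → ℝ) :=
  Real.smoothTransition.contDiff.comp
    ((contDiff_const.mul contDiff_norm_sq_tildePart).sub contDiff_const)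

/-- The derivative of the smooth transition function is bounded. -/
theorem exists_abs_deriv_smoothTransition_le :
    ∃ C : ℝ, 0 ≤ C ∧ ∀ s, |deriv Real.smoothTransition s| ≤ C := by
  have hc : Continuous (deriv Real.smoothTransition) :=
    (Real.smoothTransition.contDiff (n := 1)).continuous_deriv le_rfl
  obtain ⟨C, hC⟩ := isCompact_Icc.exists_bound_of_continuousOn
    (hc.continuousOn (s := Icc (0 : ℝ) 1))
  refine ⟨max C 0, le_max_right _ _, fun s => ?_⟩
  by_cases hs : s ∈ Icc (0 : ℝ) 1
  · exact (hC s hs).trans (le_max_left _ _)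
  · have h0 : deriv Real.smoothTransition s = 0 := by
      rw [mem_Icc, not_and_or, not_le, not_le] at hs
      rcases hs with hs | hs
      · have : Real.smoothTransition =ᶠ[𝓝 s] fun _ => 0 := by
          filter_upwards [Iio_mem_nhds hs] with t ht
          exact Real.smoothTransition.zero_of_nonpos (le_of_lt ht)
        rw [this.deriv_eq, deriv_const]
      · have : Real.smoothTransition =ᶠ[𝓝 s] fun _ => 1 := by
          filter_upwards [Ioi_mem_nhds hs] with t ht
          exact Real.smoothTransition.one_of_one_le (le_of_lt ht)
        rw [this.deriv_eq, deriv_const]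
    rw [h0, abs_zero]
    exact le_max_right _ _

theorem hasFDerivAt_axisCutoff {m : ℕ} (k : ℝ) (x : Eu (m + 2)) :
    HasFDerivAt (axisCutoff k) ((deriv Real.smoothTransition (k ^ 2 * ‖tildePart x‖ ^ 2 - 1) *
      (2 * k ^ 2)) • (innerSL ℝ (tildePart x)).comp (tildeL m)) x := by
  have h1 : HasFDerivAt (fun x : Eu (m + 2) => ‖tildePart x‖ ^ 2)
      ((2 : ℝ) • (innerSL ℝ (tildePart x)).comp (tildeL m)) x := by
    have := (hasStrictFDerivAt_norm_sq (tildeL m x)).hasFDerivAt.comp x (tildeL m).hasFDerivAt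
    simpa [Function.comp_def, two_smul] using this
  have h2 := (h1.const_mul (k ^ 2)).sub_const 1
  have h3 : HasDerivAt Real.smoothTransition
      (deriv Real.smoothTransition (k ^ 2 * ‖tildePart x‖ ^ 2 - 1))
      (k ^ 2 * ‖tildePart x‖ ^ 2 - 1) :=
    ((Real.smoothTransition.contDiff (n := 1)).differentiable (by simp) _).hasDerivAt
  have h4 := h3.comp_hasFDerivAt x h2
  refine HasFDerivAt.congr_fderiv h4 ?_
  rw [smul_smul, smul_smul]
  congr 1
  ring

theorem axisCutoff_eq_one {m : ℕ} {k : ℝ} {x : Eu (m + 2)} (h : 2 ≤ k ^ 2 * ‖tildePart x‖ ^ 2) :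
    axisCutoff k x = 1 :=
  Real.smoothTransition.one_of_one_le (by linarith)

theorem eventually_two_le_mul {a : ℝ} (ha : 0 < a) :
    ∀ᶠ k : ℕ in atTop, 2 < (k : ℝ) ^ 2 * a ^ 2 := by
  have : Tendsto (fun k : ℕ => (k : ℝ) ^ 2 * a ^ 2) atTop atTop :=
    ((tendsto_pow_atTop two_ne_zero).comp tendsto_natCast_atTop_atTop).atTop_mul_const (by positivity)
  exact this.eventually_gt_atTop 2

theorem abs_fderiv_axisCutoff_le {m : ℕ} {C : ℝ} (hC : ∀ s, |deriv Real.smoothTransition s| ≤ C)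
    (k : ℝ) {x : Eu (m + 2)} (hx : tildePart x ≠ 0) (e : Eu (m + 2)) :
    |fderiv ℝ (axisCutoff k) x e| ≤ 4 * C * ‖tildePart x‖⁻¹ * ‖e‖ := by
  have hC0 : 0 ≤ C := (abs_nonneg _).trans (hC 0)
  have hr : 0 < ‖tildePart x‖ := norm_pos_iff.2 hx
  by_cases h : 2 < k ^ 2 * ‖tildePart x‖ ^ 2
  · have : axisCutoff k =ᶠ[𝓝 x] fun _ => 1 := by
      have hopen : IsOpen {y : Eu (m + 2) | 2 < k ^ 2 * ‖tildePart y‖ ^ 2} :=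
        isOpen_lt continuous_const
          (continuous_const.mul (contDiff_norm_sq_tildePart (m := m)).continuous)
      filter_upwards [hopen.mem_nhds h] with y hy
      exact axisCutoff_eq_one (le_of_lt hy)
    rw [this.fderiv_eq]
    simp
    positivity
  · push Not at h
    rw [(hasFDerivAt_axisCutoff k x).fderiv]
    simp only [smul_apply, ContinuousLinearMap.comp_apply, innerSL_apply_apply, tildeL_apply,
      smul_eq_mul, abs_mul]
    have h1 : |inner ℝ (tildePart x) (tildePart e)| ≤ ‖tildePart x‖ * ‖e‖ :=
      (abs_real_inner_le_norm _ _).trans (by gcongr; exact norm_tildePart_le e)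
    have h2 : |(2 : ℝ)| * |k ^ 2| ≤ 4 * (‖tildePart x‖ ^ 2)⁻¹ := by
      rw [abs_of_pos two_pos, abs_of_nonneg (sq_nonneg k), ← div_eq_mul_inv,
        le_div_iff₀ (by positivity)]
      linarith
    calc _ ≤ C * (4 * (‖tildePart x‖ ^ 2)⁻¹) * (‖tildePart x‖ * ‖e‖) := by
          gcongr
          exact hC _
      _ = _ := by field_simp

/-- A map that is differentiable off the plane `x̃ = 0` of codimension two and has a summable
gradient is a Sobolev map across that plane, provided `w / |x̃|` is summable. -/
theorem memW11_univ_of_differentiableAt {m : ℕ} {w : Eu (m + 2) → Eu 2}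
    (hdiff : ∀ x, tildePart x ≠ 0 → DifferentiableAt ℝ w x) (hw : Integrable w)
    (hw' : Integrable (fun x => ‖tildePart x‖⁻¹ * ‖w x‖)) (hd : Integrable (fderiv ℝ w)) :
    MemW11 univ w := by
  refine ⟨hw.integrableOn, fderiv ℝ w, hd.integrableOn, fun φ hφ hc _ e => ?_⟩
  rw [setIntegral_univ, setIntegral_univ]
  obtain ⟨C, hC0, hC⟩ := exists_abs_deriv_smoothTransition_le
  obtain ⟨M, hM⟩ := hφ.continuous.bounded_above_of_compact_support hc
  have hφ' := continuous_fderiv_apply_of_contDiff hφ e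
  obtain ⟨M', hM'⟩ := hφ'.bounded_above_of_compact_support (hc.fderiv_apply ℝ e)
  have hM0 : 0 ≤ M := (norm_nonneg _).trans (hM 0)
  have hM0' : 0 ≤ M' := (norm_nonneg _).trans (hM' 0)
  have hde : Integrable (fun x => fderiv ℝ w x e) := hd.apply_continuousLinearMap e
  have hfd : ∀ (k : ℕ) (x : Eu (m + 2)), fderiv ℝ (fun y => axisCutoff k y * φ y) x e =
      axisCutoff k x * fderiv ℝ φ x e + φ x * fderiv ℝ (axisCutoff k) x e := by
    intro k x
    have := fderiv_fun_mul ((contDiff_axisCutoff (m := m) k).differentiable (by simp) x)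
      (hφ.differentiable (by simp) x)
    rw [this]
    simp
  have hχ1 : ∀ (k : ℕ) (x : Eu (m + 2)), ‖axisCutoff (k : ℝ) x‖ ≤ 1 := fun k x => by
    rw [axisCutoff, Real.norm_eq_abs, abs_of_nonneg (Real.smoothTransition.nonneg _)]
    exact Real.smoothTransition.le_one _
  have hsm : ∀ k : ℕ, ContDiff ℝ ∞ (fun y : Eu (m + 2) => axisCutoff k y * φ y) := fun k =>
    (contDiff_axisCutoff k).mul hφ
  have hcs : ∀ k : ℕ, HasCompactSupport (fun y : Eu (m + 2) => axisCutoff k y * φ y) := fun k =>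
    hc.mul_left
  have hparts : ∀ k : ℕ, 0 < k → ∫ x, (axisCutoff k x * φ x) • fderiv ℝ w x e =
      - ∫ x, fderiv ℝ (fun y => axisCutoff k y * φ y) x e • w x := by
    intro k hk
    refine integral_smul_fderiv_eq_neg_fderiv_smul_of_integrable ?_ ?_ ?_ ?_ ?_
    · exact integrable_smul_of_support_subset hw.integrableOn
        (continuous_fderiv_apply_of_contDiff (hsm k) e) ((hcs k).fderiv_apply ℝ e)
        (subset_univ _)
    · exact integrable_smul_of_support_subset hde.integrableOn (hsm k).continuous (hcs k)
        (subset_univ _)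
    · exact integrable_smul_of_support_subset hw.integrableOn (hsm k).continuous (hcs k)
        (subset_univ _)
    · exact fun x _ => (hsm k).differentiable (by simp) x
    · intro x hx
      refine hdiff x fun h0 => ?_
      have hopen : IsOpen {y : Eu (m + 2) | (k : ℝ) ^ 2 * ‖tildePart y‖ ^ 2 < 1} :=
        isOpen_lt (continuous_const.mul (contDiff_norm_sq_tildePart (m := m)).continuous)
          continuous_const
      have hxm : x ∈ {y : Eu (m + 2) | (k : ℝ) ^ 2 * ‖tildePart y‖ ^ 2 < 1} := by
        simp [h0]
      obtain ⟨y, hy, hy'⟩ := mem_closure_iff.1 hx _ hopen hxm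
      refine hy' ?_
      have : axisCutoff (k : ℝ) y = 0 :=
        Real.smoothTransition.zero_of_nonpos (by linarith [hy.out])
      simp [this]
  -- Both sides of the identity for the truncated test functions converge, the gradient of the cutoff
  -- being bounded by a multiple of `1 / |x̃|` uniformly in `k`.
  have hlim1 : Tendsto (fun k : ℕ => ∫ x, (axisCutoff k x * φ x) • fderiv ℝ w x e) atTop
      (𝓝 (∫ x, φ x • fderiv ℝ w x e)) := by
    refine tendsto_integral_of_dominated_convergence (fun x => M * ‖fderiv ℝ w x e‖) ?_ ?_ ?_ ?_
    · exact fun k => (hsm k).continuous.aestronglyMeasurable.smul hde.aestronglyMeasurable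
    · exact hde.norm.const_mul _
    · intro k
      refine Eventually.of_forall fun x => ?_
      rw [norm_smul, norm_mul]
      gcongr
      calc _ ≤ 1 * M := mul_le_mul (hχ1 k x) (hM x) (norm_nonneg _) zero_le_one
        _ = M := one_mul M
    · filter_upwards [ae_tildePart_ne_zero m] with x hx
      refine tendsto_const_nhds.congr' ?_
      filter_upwards [eventually_two_le_mul (norm_pos_iff.2 hx)] with k hk
      rw [axisCutoff_eq_one hk.le, one_mul]
  have hlim2 : Tendsto (fun k : ℕ => ∫ x, fderiv ℝ (fun y => axisCutoff k y * φ y) x e • w x) atTop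
      (𝓝 (∫ x, fderiv ℝ φ x e • w x)) := by
    refine tendsto_integral_of_dominated_convergence
      (fun x => M' * ‖w x‖ + M * (4 * C * ‖e‖) * (‖tildePart x‖⁻¹ * ‖w x‖)) ?_ ?_ ?_ ?_
    · exact fun k => (continuous_fderiv_apply_of_contDiff (hsm k) e).aestronglyMeasurable.smul
        hw.aestronglyMeasurable
    · exact (hw.norm.const_mul _).add (hw'.const_mul _)
    · intro k
      filter_upwards [ae_tildePart_ne_zero m] with x hx
      rw [norm_smul, hfd]
      have h1 := abs_fderiv_axisCutoff_le hC k hx e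
      have h2 : ‖axisCutoff (k : ℝ) x * fderiv ℝ φ x e + φ x * fderiv ℝ (axisCutoff k) x e‖ ≤
          1 * M' + M * (4 * C * ‖tildePart x‖⁻¹ * ‖e‖) := by
        refine (norm_add_le _ _).trans ?_
        rw [norm_mul, norm_mul]
        gcongr
        · exact hχ1 k x
        · exact hM' x
        · exact hM x
        · exact h1
      calc _ ≤ (1 * M' + M * (4 * C * ‖tildePart x‖⁻¹ * ‖e‖)) * ‖w x‖ := by gcongr
        _ = _ := by ring
    · filter_upwards [ae_tildePart_ne_zero m] with x hx
      refine tendsto_const_nhds.congr' ?_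
      filter_upwards [eventually_two_le_mul (norm_pos_iff.2 hx)] with k hk
      have : (fun y : Eu (m + 2) => axisCutoff k y * φ y) =ᶠ[𝓝 x] φ := by
        have hopen : IsOpen {y : Eu (m + 2) | 2 < (k : ℝ) ^ 2 * ‖tildePart y‖ ^ 2} :=
          isOpen_lt continuous_const
            (continuous_const.mul (contDiff_norm_sq_tildePart (m := m)).continuous)
        filter_upwards [hopen.mem_nhds hk] with y hy
        rw [axisCutoff_eq_one (le_of_lt hy), one_mul]
      rw [this.fderiv_eq]
  have hlim3 := hlim1.congr' ((eventually_gt_atTop 0).mono hparts)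
  have := tendsto_nhds_unique hlim3 hlim2.neg
  rw [this, neg_neg]

/-! ### Integration in cylindrical coordinates -/

/-- The identification of `ℝ² × ℝᵐ`, with its Euclidean structure, with `ℝ^{m+2}`. -/
def joinIso (m : ℕ) : WithLp 2 (Eu 2 × Eu m) ≃ₗᵢ[ℝ] Eu (m + 2) where
  toFun q := join q.fst q.snd
  invFun x := WithLp.toLp 2 (tildePart x, hatPart x)
  left_inv q := by
    simp only [tildePart_join, hatPart_join]
    rfl
  right_inv x := join_tildePart_hatPart x
  map_add' a b := (joinL m).map_add (a.fst, a.snd) (b.fst, b.snd)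
  map_smul' c a := (joinL m).map_smul c (a.fst, a.snd)
  norm_map' q := by
    have h := WithLp.prod_norm_sq_eq_of_L2 q
    refine (pow_left_inj₀ (norm_nonneg _) (norm_nonneg _) two_ne_zero).1 ?_
    rw [h]
    exact norm_sq_join q.fst q.snd

/-- The identification of `ℂ` with `ℝ²`. -/
def planeIso : ℂ ≃ₗᵢ[ℝ] Eu 2 := Complex.orthonormalBasisOneI.repr

theorem planeIso_apply (z : ℂ) : planeIso z = WithLp.toLp 2 ![z.re, z.im] := by
  ext i
  simp [planeIso, Complex.orthonormalBasisOneI]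

theorem planeIso_polar (r t : ℝ) :
    planeIso (r * (Real.cos t + Real.sin t * Complex.I)) = circlePt r t := by
  rw [planeIso_apply, circlePt]
  simp [Complex.cos_ofReal_re, Complex.sin_ofReal_re]

theorem lintegral_join {m : ℕ} {f : Eu (m + 2) → ℝ≥0∞} (hf : Measurable f) :
    ∫⁻ x, f x = ∫⁻ p : Eu m, ∫⁻ a : Eu 2, f (join a p) := by
  have h1 : ∫⁻ x, f x = ∫⁻ q : Eu 2 × Eu m, f (join q.1 q.2) := by
    rw [← (joinIso m).measurePreserving.lintegral_comp hf,
      ← (WithLp.volume_preserving_toLp (Eu 2) (Eu m)).lintegral_comp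
        (f := fun q => f (joinIso m q)) (hf.comp (joinIso m).continuous.measurable)]
    rfl
  rw [h1, Measure.volume_eq_prod, lintegral_prod_symm]
  exact (hf.comp continuous_join.measurable).aemeasurable

theorem lintegral_plane_polar (f : Eu 2 → ℝ≥0∞) (hf : Measurable f) :
    ∫⁻ a, f a = ∫⁻ t in Ioo (-Real.pi) Real.pi, ∫⁻ r in Ioi (0 : ℝ),
      ENNReal.ofReal r * f (circlePt r t) := by
  have hm : Measurable fun q : ℝ × ℝ => f (circlePt q.1 q.2) := by
    refine hf.comp (Continuous.measurable ?_)
    simp_rw [← planeIso_polar]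
    fun_prop
  rw [← planeIso.measurePreserving.lintegral_comp hf, ← Complex.lintegral_comp_polarCoord_symm]
  simp only [Complex.polarCoord_symm_apply, planeIso_polar, smul_eq_mul]
  rw [polarCoord_target, Measure.volume_eq_prod, ← Measure.prod_restrict, lintegral_prod_symm]
  exact ((measurable_fst.ennreal_ofReal).mul hm).aemeasurable

/-- Integration in cylindrical coordinates around the plane `x̃ = 0`. -/
theorem lintegral_cyl {m : ℕ} {f : Eu (m + 2) → ℝ≥0∞} (hf : Measurable f) :
    ∫⁻ x, f x = ∫⁻ p : Eu m, ∫⁻ t in Ioo (-Real.pi) Real.pi, ∫⁻ r in Ioi (0 : ℝ),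
      ENNReal.ofReal r * f (join (circlePt r t) p) := by
  rw [lintegral_join hf]
  refine lintegral_congr fun p => lintegral_plane_polar _ ?_
  exact hf.comp (continuous_join.comp (by fun_prop : Continuous fun a : Eu 2 => (a, p))).measurable

theorem norm_circlePt (r t : ℝ) : ‖circlePt r t‖ = |r| := by
  rw [← planeIso_polar, LinearIsometryEquiv.norm_map, norm_mul, Complex.norm_real,
    Complex.ofReal_cos, Complex.ofReal_sin, Complex.norm_cos_add_sin_mul_I, mul_one,
    Real.norm_eq_abs]

/-- The Hausdorff measure of `{0} × A` is the Lebesgue measure of `A`. -/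
theorem euclideanHausdorffMeasure_flat {m : ℕ} (A : Set (Eu m)) :
    Measure.euclideanHausdorffMeasure m (flat A) = volume A := by
  have hiso : Isometry (fun p : Eu m => join (0 : Eu 2) p) := by
    refine AddMonoidHomClass.isometry_of_norm
      ((joinL m).comp (ContinuousLinearMap.inr ℝ (Eu 2) (Eu m))) fun p => ?_
    have := norm_sq_join (0 : Eu 2) p
    rw [norm_zero] at this
    exact (pow_left_inj₀ (norm_nonneg _) (norm_nonneg _) two_ne_zero).1 (by simpa using this)
  have himg : flat A = (fun p : Eu m => join (0 : Eu 2) p) '' A := by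
    ext x
    constructor
    · rintro ⟨h1, h2⟩
      exact ⟨hatPart x, h2, by
        conv_rhs => rw [← join_tildePart_hatPart x, h1]⟩
    · rintro ⟨p, hp, rfl⟩
      exact ⟨tildePart_join _ _, by rwa [hatPart_join]⟩
  rw [himg, hiso.euclideanHausdorffMeasure_image,
    EuclideanSpace.euclideanHausdorffMeasure_eq_volume]

/-! ### A Hardy inequality -/

/-- **Hardy's inequality** in `L¹` on an interval: `∫ |f|` is controlled by a boundary value and by
`∫ s |f'(s)| ds`. -/
theorem lintegral_abs_le_hardy {f f' : ℝ → ℝ} {κ b : ℝ} (hb : κ ≤ b)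
    (hf : ∀ s ∈ Ioc 0 b, HasDerivAt f (f' s) s) (hf' : ContinuousOn f' (Ioc 0 b)) :
    ∫⁻ r in Ioo 0 κ, ENNReal.ofReal |f r| ≤ ENNReal.ofReal (κ * |f b|) +
      ∫⁻ s in Ioo 0 b, ENNReal.ofReal s * ENNReal.ofReal |f' s| := by
  set g : ℝ → ℝ≥0∞ := (Ioo 0 b).indicator fun s => ENNReal.ofReal |f' s| with hg
  have hgm : Measurable g := by
    have h1 : ContinuousOn (fun s => ENNReal.ofReal |f' s|) (Ioo 0 b) :=
      ENNReal.continuous_ofReal.comp_continuousOn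
        ((hf'.mono Ioo_subset_Ioc_self).abs)
    classical
    rw [hg, ← piecewise_eq_indicator]
    exact h1.measurable_piecewise continuousOn_const measurableSet_Ioo
  have hpt : ∀ r ∈ Ioo 0 κ, ENNReal.ofReal |f r| ≤
      ENNReal.ofReal |f b| + ∫⁻ s in Ioi r, g s := by
    intro r hr
    have hrb : r ≤ b := hr.2.le.trans hb
    have hsub : Icc r b ⊆ Ioc 0 b := fun s hs => ⟨hr.1.trans_le hs.1, hs.2⟩
    have hint : IntervalIntegrable f' volume r b :=
      (hf'.mono (by rwa [uIcc_of_le hrb])).intervalIntegrable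
    have hftc : ∫ s in r..b, f' s = f b - f r :=
      intervalIntegral.integral_eq_sub_of_hasDerivAt
        (fun s hs => hf s (hsub (by rwa [uIcc_of_le hrb] at hs))) hint
    have hle : |f r| ≤ |f b| + |∫ s in r..b, f' s| := by
      rw [hftc]
      have h1 : f r = f b - (f b - f r) := by ring
      calc |f r| = |f b - (f b - f r)| := by rw [← h1]
        _ ≤ _ := abs_sub _ _
    refine (ENNReal.ofReal_le_ofReal hle).trans ?_
    rw [ENNReal.ofReal_add (abs_nonneg _) (abs_nonneg _)]
    gcongr
    rw [intervalIntegral.integral_of_le hrb, ← Real.enorm_eq_ofReal_abs]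
    refine (enorm_integral_le_lintegral_enorm _).trans ?_
    rw [← restrict_Ioo_eq_restrict_Ioc]
    simp only [Real.enorm_eq_ofReal_abs]
    calc ∫⁻ s in Ioo r b, ENNReal.ofReal |f' s| = ∫⁻ s in Ioo r b, g s := by
          refine setLIntegral_congr_fun measurableSet_Ioo fun s hs => ?_
          simp only [hg]
          rw [indicator_of_mem]
          exact ⟨hr.1.trans hs.1, hs.2⟩
      _ ≤ ∫⁻ s in Ioi r, g s := lintegral_mono_set fun s hs => hs.1
  have hswap : ∫⁻ r in Ioo 0 κ, ∫⁻ s in Ioi r, g s ≤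
      ∫⁻ s in Ioo 0 b, ENNReal.ofReal s * ENNReal.ofReal |f' s| := by
    have hmeas : Measurable (Function.uncurry fun r s : ℝ => (Ioi r).indicator g s) := by
      have : (Function.uncurry fun r s : ℝ => (Ioi r).indicator g s) =
          {q : ℝ × ℝ | q.1 < q.2}.indicator (fun q => g q.2) := by
        ext q
        simp [Function.uncurry, indicator]
      rw [this]
      exact (hgm.comp measurable_snd).indicator (measurableSet_lt measurable_fst measurable_snd)
    calc ∫⁻ r in Ioo 0 κ, ∫⁻ s in Ioi r, g s
        = ∫⁻ r in Ioo 0 κ, ∫⁻ s, (Ioi r).indicator g s := by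
          refine lintegral_congr fun r => ?_
          rw [lintegral_indicator measurableSet_Ioi]
      _ = ∫⁻ s, ∫⁻ r in Ioo 0 κ, (Ioi r).indicator g s :=
          lintegral_lintegral_swap hmeas.aemeasurable
      _ ≤ ∫⁻ s, (Ioo 0 b).indicator
            (fun s => ENNReal.ofReal s * ENNReal.ofReal |f' s|) s := by
          refine lintegral_mono fun s => ?_
          by_cases hs : s ∈ Ioo 0 b
          · rw [indicator_of_mem hs]
            calc ∫⁻ r in Ioo 0 κ, (Ioi r).indicator g s
                ≤ ∫⁻ r in Ioo 0 κ, (Iio s).indicator (fun _ => g s) r := by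
                  refine lintegral_mono fun r => ?_
                  by_cases hrs : r < s
                  · rw [indicator_of_mem (show s ∈ Ioi r from hrs),
                      indicator_of_mem (show r ∈ Iio s from hrs)]
                  · rw [indicator_of_notMem (show s ∉ Ioi r from hrs)]
                    exact zero_le
              _ = g s * volume (Iio s ∩ Ioo 0 κ) := by
                  rw [lintegral_indicator measurableSet_Iio, lintegral_const,
                    Measure.restrict_restrict measurableSet_Iio, Measure.restrict_apply_univ]
              _ ≤ g s * ENNReal.ofReal s := by
                  gcongr
                  calc volume (Iio s ∩ Ioo 0 κ) ≤ volume (Ioo 0 s) :=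
                        measure_mono fun r hr => ⟨hr.2.1, hr.1⟩
                    _ = ENNReal.ofReal s := by simp
              _ = _ := by
                  rw [mul_comm]
                  simp only [hg]
                  rw [indicator_of_mem hs]
          · have : g s = 0 := by
              simp only [hg]
              rw [indicator_of_notMem hs]
            have h0 : ∀ r, (Ioi r).indicator g s = 0 := fun r => by
              by_cases h : s ∈ Ioi r
              · rw [indicator_of_mem h, this]
              · rw [indicator_of_notMem h]
            simp [h0]
      _ = _ := lintegral_indicator measurableSet_Ioo _
  calc ∫⁻ r in Ioo 0 κ, ENNReal.ofReal |f r|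
      ≤ ∫⁻ r in Ioo 0 κ, (ENNReal.ofReal |f b| + ∫⁻ s in Ioi r, g s) :=
        setLIntegral_mono' measurableSet_Ioo hpt
    _ = (∫⁻ _ in Ioo 0 κ, ENNReal.ofReal |f b|) + ∫⁻ r in Ioo 0 κ, ∫⁻ s in Ioi r, g s :=
        lintegral_add_left measurable_const _
    _ ≤ _ := by
        gcongr
        rw [lintegral_const, Measure.restrict_apply_univ, Real.volume_Ioo, sub_zero, mul_comm]
        rcases le_or_gt 0 κ with h | h
        · rw [ENNReal.ofReal_mul h]
        · rw [ENNReal.ofReal_of_nonpos h.le]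
          simp

/-! ### Smooth functions below a given function -/

/-- Below a positive function `a` on a bounded open set `O` there is a smooth function on the whole
space that is positive exactly on `O`: integrate in `s` a smooth function with values in `[0, 1]`
whose support is `{(p, s) : p ∈ O, 0 < s < a p}`. -/
theorem exists_smooth_pos_le {m : ℕ} {O : Set (Eu m)} (hO : Bornology.IsBounded O) {a : Eu m → ℝ}
    (hV : IsOpen {q : Eu m × ℝ | q.1 ∈ O ∧ 0 < q.2 ∧ q.2 < a q.1}) (ha : ∀ p ∈ O, 0 < a p)
    (ha1 : ∀ p ∈ O, a p ≤ 1) :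
    ∃ κ : Eu m → ℝ, ContDiff ℝ ∞ κ ∧ HasCompactSupport κ ∧ (∀ p, 0 ≤ κ p) ∧
      (∀ p, p ∉ O → κ p = 0) ∧ ∀ p ∈ O, 0 < κ p ∧ κ p ≤ a p := by
  obtain ⟨F, hFs, hF, hF01⟩ := hV.exists_contDiff_support_eq (n := ⊤)
  have hF0 : ∀ p s, 0 ≤ F (p, s) := fun p s => (hF01 (mem_range_self _)).1
  have hF1 : ∀ p s, F (p, s) ≤ 1 := fun p s => (hF01 (mem_range_self _)).2
  have hFz : ∀ p s, ¬ (p ∈ O ∧ 0 < s ∧ s < a p) → F (p, s) = 0 := fun p s h => by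
    by_contra h'
    have : (p, s) ∈ Function.support F := h'
    rw [hFs] at this
    exact h this
  have hFc : ∀ p, Continuous fun s => F (p, s) := fun p => hF.continuous.comp (by fun_prop)
  have hFz1 : ∀ p s, s ∉ Icc (0 : ℝ) 1 → F (p, s) = 0 := fun p s hs =>
    hFz p s fun h => hs ⟨h.2.1.le, h.2.2.le.trans (ha1 p h.1)⟩
  have hFi : ∀ p, Integrable fun s => F (p, s) := fun p =>
    (hFc p).integrable_of_hasCompactSupport (HasCompactSupport.intro isCompact_Icc (hFz1 p))
  have hz : ∀ p, p ∉ O → ∫ s, F (p, s) = 0 := fun p hp => by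
    have : ∀ s, F (p, s) = 0 := fun s => hFz p s fun h => hp h.1
    simp [this]
  refine ⟨fun p => ∫ s, F (p, s), ?_, ?_, fun p => integral_nonneg (hF0 p), hz, fun p hp => ?_⟩
  · have h1 := contDiffOn_convolution_right_with_param (μ := (volume : Measure ℝ)) (n := ⊤)
      (f := fun _ : ℝ => (1 : ℝ)) (ContinuousLinearMap.mul ℝ ℝ) (g := fun p s => F (p, -s))
      (s := (univ : Set (Eu m))) (k := Icc (-1 : ℝ) 0) isOpen_univ isCompact_Icc
      (fun p s _ hs => hFz1 p _ fun h => hs ⟨by linarith [h.2], by linarith [h.1]⟩)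
      (continuous_const.locallyIntegrable)
      ((hF.comp (contDiff_fst.prodMk contDiff_snd.neg)).contDiffOn)
    rw [univ_prod_univ, contDiffOn_univ] at h1
    have h2 := h1.comp (contDiff_id.prodMk contDiff_const : ContDiff ℝ ∞ fun p : Eu m => (p, (0 : ℝ)))
    convert h2 using 1
    funext p
    simp [convolution]
  · refine HasCompactSupport.intro (hO.isCompact_closure) fun p hp => hz p fun h => hp ?_
    exact subset_closure h
  · constructor
    · rw [integral_pos_iff_support_of_nonneg (hF0 p) (hFi p)]
      have h1 : Function.support (fun s => F (p, s)) = Ioo 0 (a p) := by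
        ext s
        constructor
        · intro hs
          by_contra h
          exact hs (hFz p s fun h' => h h'.2)
        · intro hs
          have : (p, s) ∈ Function.support F := by
            rw [hFs]
            exact ⟨hp, hs⟩
          exact this
      rw [h1]
      simpa using ha p hp
    · calc ∫ s, F (p, s) ≤ ∫ s, (Ioo 0 (a p)).indicator (fun _ => (1 : ℝ)) s := by
            refine integral_mono (hFi p) ?_ fun s => ?_
            · exact (integrable_indicator_iff measurableSet_Ioo).2 (by simp)
            · by_cases hs : s ∈ Ioo 0 (a p)
              · rw [indicator_of_mem hs]
                exact hF1 p s
              · rw [indicator_of_notMem hs]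
                exact (hFz p s fun h => hs h.2).le
        _ = a p := by
            rw [integral_indicator measurableSet_Ioo]
            simp [(ha p hp).le]

/-! ### Angle functions -/

/-- The first component of `x`, as a complex number. -/
def zL (m : ℕ) : Eu (m + 2) →L[ℝ] ℂ :=
  (planeIso.symm : Eu 2 →L[ℝ] ℂ).comp (tildeL m)

theorem norm_zL {m : ℕ} (x : Eu (m + 2)) : ‖zL m x‖ = ‖tildePart x‖ := by
  simp [zL]

theorem norm_zL_le {m : ℕ} (x : Eu (m + 2)) : ‖zL m x‖ ≤ ‖x‖ :=
  (norm_zL x).trans_le (norm_tildePart_le x)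

theorem zL_ne_zero {m : ℕ} {x : Eu (m + 2)} : zL m x ≠ 0 ↔ tildePart x ≠ 0 := by
  rw [← norm_ne_zero_iff, norm_zL, norm_ne_zero_iff]

theorem circlePt_norm_arg {m : ℕ} (x : Eu (m + 2)) :
    circlePt ‖tildePart x‖ (zL m x).arg = tildePart x := by
  rw [← planeIso_polar, ← norm_zL, Complex.ofReal_cos, Complex.ofReal_sin,
    Complex.norm_mul_cos_add_sin_mul_I]
  simp [zL]

/-- The differential of the angle at a point with first component `z ≠ 0`. -/
def angleForm {m : ℕ} (x : Eu (m + 2)) : Eu (m + 2) →L[ℝ] ℝ :=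
  Complex.imCLM.comp ((ContinuousLinearMap.mul ℝ ℂ (zL m x)⁻¹).comp (zL m))

theorem angleForm_apply {m : ℕ} (x e : Eu (m + 2)) :
    angleForm x e = ((zL m x)⁻¹ * zL m e).im := rfl

theorem abs_angleForm_le {m : ℕ} (x e : Eu (m + 2)) :
    |angleForm x e| ≤ ‖tildePart x‖⁻¹ * ‖e‖ := by
  rw [angleForm_apply]
  refine (Complex.abs_im_le_norm _).trans ?_
  rw [norm_mul, norm_inv, norm_zL]
  gcongr
  exact norm_zL_le e

theorem contDiffAt_im {m : ℕ} {f : Eu m → ℂ} {x : Eu m} (hf : ContDiffAt ℝ ∞ f x) :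
    ContDiffAt ℝ ∞ (fun y => (f y).im) x :=
  ContDiffAt.comp (g := Complex.imCLM) (f := f) x Complex.imCLM.contDiff.contDiffAt hf

/-- A branch of the angle near `x₀`. -/
def angleBranch {m : ℕ} (x₀ x : Eu (m + 2)) : ℝ :=
  ((zL m x₀)⁻¹ * zL m x).arg + (zL m x₀).arg

theorem exists_angleBranch_eq {m : ℕ} {x₀ x : Eu (m + 2)} (h₀ : tildePart x₀ ≠ 0)
    (h : tildePart x ≠ 0) :
    ∃ k : ℤ, angleBranch x₀ x = (zL m x).arg + k * (2 * Real.pi) := by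
  have h1 := Complex.arg_mul_coe_angle (mul_ne_zero (inv_ne_zero (zL_ne_zero.2 h₀))
    (zL_ne_zero.2 h)) (zL_ne_zero.2 h₀)
  rw [mul_comm, mul_inv_cancel_left₀ (zL_ne_zero.2 h₀), ← Real.Angle.coe_add] at h1
  obtain ⟨k, hk⟩ := Real.Angle.angle_eq_iff_two_pi_dvd_sub.1 h1.symm
  refine ⟨k, ?_⟩
  rw [angleBranch]
  linarith

theorem angleBranch_eq_log {m : ℕ} (x₀ : Eu (m + 2)) :
    angleBranch x₀ = fun x => (Complex.log ((zL m x₀)⁻¹ * zL m x)).im + (zL m x₀).arg := by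
  funext x
  rw [Complex.log_im, angleBranch]

theorem contDiffAt_angleBranch {m : ℕ} {x₀ : Eu (m + 2)} (h : tildePart x₀ ≠ 0) :
    ContDiffAt ℝ ∞ (angleBranch x₀) x₀ := by
  have h1 : (zL m x₀)⁻¹ * zL m x₀ ∈ Complex.slitPlane := by
    rw [inv_mul_cancel₀ (zL_ne_zero.2 h)]
    exact Complex.one_mem_slitPlane
  rw [angleBranch_eq_log]
  refine ContDiffAt.add ?_ contDiffAt_const
  refine contDiffAt_im ?_
  exact ((Complex.contDiffAt_log h1).restrict_scalars ℝ).comp x₀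
    (contDiff_const.mul (zL m).contDiff).contDiffAt

theorem hasFDerivAt_angleBranch {m : ℕ} {x₀ : Eu (m + 2)} (h : tildePart x₀ ≠ 0) :
    HasFDerivAt (angleBranch x₀) (angleForm x₀) x₀ := by
  have h0 := inv_mul_cancel₀ (zL_ne_zero.2 h)
  have h1 : (zL m x₀)⁻¹ * zL m x₀ ∈ Complex.slitPlane := by
    rw [h0]
    exact Complex.one_mem_slitPlane
  rw [angleBranch_eq_log]
  have h2 : HasFDerivAt (fun x => (zL m x₀)⁻¹ * zL m x)
      ((ContinuousLinearMap.mul ℝ ℂ (zL m x₀)⁻¹).comp (zL m)) x₀ :=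
    ((ContinuousLinearMap.mul ℝ ℂ (zL m x₀)⁻¹).comp (zL m)).hasFDerivAt
  have h3 := (Complex.hasDerivAt_log h1).complexToReal_fderiv
  have h4 := Complex.imCLM.hasFDerivAt.comp x₀ (h3.comp x₀ h2)
  refine (h4.add_const _).congr_fderiv ?_
  ext e
  simp [angleForm_apply, h0]

/-- A continuous real function on a preconnected set with values in `2π ℤ` is constant. -/
theorem eq_of_values_two_pi_int {X : Type*} [TopologicalSpace X] {S : Set X}
    (hS : IsPreconnected S) {f : X → ℝ} (hf : ContinuousOn f S)
    (hv : ∀ x ∈ S, ∃ k : ℤ, f x = k * (2 * Real.pi)) {x y : X} (hx : x ∈ S) (hy : y ∈ S) :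
    f x = f y := by
  have hd : IsDiscrete (AddSubgroup.zmultiples (2 * Real.pi) : Set ℝ) := ⟨inferInstanceAs
    (DiscreteTopology (AddSubgroup.zmultiples (2 * Real.pi)))⟩
  refine hS.constant_of_mapsTo hd hf (fun z hz => ?_) hx hy
  obtain ⟨k, hk⟩ := hv z hz
  exact AddSubgroup.mem_zmultiples_iff.2 ⟨k, by rw [hk, zsmul_eq_mul]⟩

theorem exp_angle_eq_iff {a b : ℝ} : Complex.exp (a * Complex.I) = Complex.exp (b * Complex.I) ↔
    ∃ k : ℤ, a = b + k * (2 * Real.pi) := by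
  rw [Complex.exp_eq_exp_iff_exists_int]
  refine exists_congr fun k => ?_
  constructor
  · intro h
    have := congrArg Complex.im h
    simpa using this
  · intro h
    rw [h]
    push_cast
    ring

/-- A continuous phase of a smooth function is smooth. -/
theorem contDiffAt_of_exp {m : ℕ} {ψ : Eu m → ℝ} {W : Eu m → ℂ} {x₀ : Eu m}
    (hψ : ContinuousAt ψ x₀) (hW : ContDiffAt ℝ ∞ W x₀)
    (h : ∀ᶠ x in 𝓝 x₀, Complex.exp (ψ x * Complex.I) = W x) : ContDiffAt ℝ ∞ ψ x₀ := by
  have h0 : Complex.exp (ψ x₀ * Complex.I) = W x₀ := h.self_of_nhds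
  have hW0 : W x₀ ≠ 0 := h0 ▸ Complex.exp_ne_zero _
  have h1 : (W x₀)⁻¹ * W x₀ ∈ Complex.slitPlane := by
    rw [inv_mul_cancel₀ hW0]
    exact Complex.one_mem_slitPlane
  have h2 : ContDiffAt ℝ ∞ (fun x => (Complex.log ((W x₀)⁻¹ * W x)).im + ψ x₀) x₀ := by
    refine ContDiffAt.add ?_ contDiffAt_const
    refine contDiffAt_im ?_
    exact ((Complex.contDiffAt_log h1).restrict_scalars ℝ).comp x₀ (contDiffAt_const.mul hW)
  refine h2.congr_of_eventuallyEq ?_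
  have h3 : ∀ᶠ x in 𝓝 x₀, |ψ x - ψ x₀| < Real.pi := by
    have := Metric.continuousAt_iff'.1 hψ Real.pi Real.pi_pos
    simpa [Real.dist_eq] using this
  filter_upwards [h, h3] with x hx hx3
  rw [abs_lt] at hx3
  have h4 : (W x₀)⁻¹ * W x = Complex.exp (((ψ x - ψ x₀ : ℝ) : ℂ) * Complex.I) := by
    rw [← hx, ← h0, ← Complex.exp_neg, ← Complex.exp_add]
    congr 1
    push_cast
    ring
  rw [h4, Complex.log_exp (by simpa using hx3.1) (by simpa using hx3.2.le)]
  simp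

/-! ### The phase of a unit field on a punctured tube -/

/-- The punctured tube `{(x̃, x̂) : x̂ ∈ O, 0 < |x̃| < ρ(x̂)}`. -/
def tube {m : ℕ} (O : Set (Eu m)) (ρ : Eu m → ℝ) : Set (Eu (m + 2)) :=
  {x | hatPart x ∈ O ∧ 0 < ‖tildePart x‖ ∧ ‖tildePart x‖ < ρ (hatPart x)}

theorem isOpen_tube {m : ℕ} {O : Set (Eu m)} (hO : IsOpen O) {ρ : Eu m → ℝ}
    (hρ : ContinuousOn ρ O) : IsOpen (tube O ρ) := by
  have h1 : ContinuousOn (fun x : Eu (m + 2) => ρ (hatPart x) - ‖tildePart x‖) (hatPart ⁻¹' O) :=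
    (hρ.comp continuous_hatPart.continuousOn fun x hx => hx).sub
      continuous_tildePart.norm.continuousOn
  have h2 := h1.isOpen_inter_preimage (hO.preimage continuous_hatPart) isOpen_Ioi (t := Ioi 0)
  have h3 : IsOpen {x : Eu (m + 2) | 0 < ‖tildePart x‖} :=
    isOpen_lt continuous_const continuous_tildePart.norm
  convert h2.inter h3 using 1
  ext x
  simp only [tube, mem_ofPred_eq, mem_inter_iff, mem_preimage, mem_Ioi, sub_pos]
  tauto

theorem planeIso_exp (t : ℝ) : planeIso (Complex.exp (t * Complex.I)) = circlePt 1 t := by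
  rw [← planeIso_polar, Complex.exp_mul_I]
  simp

theorem continuous_circlePt : Continuous fun q : ℝ × ℝ => circlePt q.1 q.2 := by
  simp_rw [← planeIso_polar]
  fun_prop

theorem circlePt_add_two_pi (r t : ℝ) : circlePt r (t + 2 * Real.pi) = circlePt r t := by
  simp [circlePt]

/-- A unit vector field of degree `d` around the axis has a phase: on the tube it is
`exp (i (d t + ψ))`, where `t` is the angle around the axis and `ψ` is a smooth single-valued
function. In cylindrical coordinates the tube is convex, so that the field has a continuous angle
there, and the degree determines the increment of this angle over a period of `t`. -/
theorem exists_phase {m : ℕ} {O : Set (Eu m)} (hOo : IsOpen O) (hOc : Convex ℝ O) {ρ : Eu m → ℝ}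
    (hρ : ContinuousOn ρ O) (hρ0 : ∀ p ∈ O, 0 < ρ p) {u : Eu (m + 2) → Eu 2}
    (hu : ContDiffOn ℝ ∞ u (tube O ρ)) (hu1 : ∀ x ∈ tube O ρ, ‖u x‖ = 1) {d : ℤ} {p₀ : Eu m}
    (hp₀ : p₀ ∈ O) (hd : HasDegreeAround u p₀ d) :
    ∃ ψ : Eu (m + 2) → ℝ, ContDiffOn ℝ ∞ ψ (tube O ρ) ∧ ∀ x ∈ tube O ρ,
      u x = planeIso (Complex.exp ((d * (zL m x).arg + ψ x : ℝ) * Complex.I)) := by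
  set C : Set (ℝ × ℝ × Eu m) := univ ×ˢ Ioo 0 1 ×ˢ O with hC
  have hCo : IsOpen C := isOpen_univ.prod (isOpen_Ioo.prod hOo)
  have hCc : Convex ℝ C := convex_univ.prod ((convex_Ioo 0 1).prod hOc)
  have hCn : C.Nonempty := ⟨(0, 1 / 2, p₀), mem_univ _, by norm_num, hp₀⟩
  have hCs : IsSimplyConnected C := by
    have := hCc.contractibleSpace hCn
    exact SimplyConnectedSpace.ofContractible C
  set P : ℝ × ℝ × Eu m → Eu (m + 2) := fun q => join (circlePt (q.2.1 * ρ q.2.2) q.1) q.2.2 with hP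
  have hPm : MapsTo P C (tube O ρ) := by
    rintro ⟨t, s, p⟩ ⟨-, hs, hp⟩
    have hs' : s ∈ Ioo 0 1 := hs
    have hp' : p ∈ O := hp
    have h0 := hρ0 p hp'
    have h1 : 0 < s * ρ p := mul_pos hs'.1 h0
    simp only [tube, mem_ofPred_eq, hP, hatPart_join, tildePart_join, norm_circlePt, abs_of_pos h1]
    exact ⟨hp', h1, by nlinarith [hs'.2]⟩
  have hPc : ContinuousOn P C := by
    have h1 : ContinuousOn (fun q : ℝ × ℝ × Eu m => ρ q.2.2) C :=
      hρ.comp (by fun_prop) fun q hq => hq.2.2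
    have h2 : ContinuousOn (fun q : ℝ × ℝ × Eu m => circlePt (q.2.1 * ρ q.2.2) q.1) C :=
      continuous_circlePt.comp_continuousOn (ContinuousOn.prodMk (ContinuousOn.mul (by fun_prop) h1)
        (by fun_prop))
    exact continuous_join.comp_continuousOn (h2.prodMk (by fun_prop))
  set F : ℝ × ℝ × Eu m → ℂ := fun q => planeIso.symm (u (P q)) with hF
  have hF1 : ∀ q ∈ C, ‖F q‖ = 1 := fun q hq => by
    simp only [hF, LinearIsometryEquiv.norm_map]
    exact hu1 _ (hPm hq)
  have hFc : ContinuousOn F C :=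
    planeIso.symm.continuous.comp_continuousOn (hu.continuousOn.comp hPc hPm)
  obtain ⟨f, hfc, hf⟩ := Complex.exists_continuousOn_eqOn_exp_comp hCs hCo hFc (by
    rintro ⟨q, hq, h0⟩
    have := hF1 q hq
    rw [h0, norm_zero] at this
    exact zero_ne_one this)
  set Θ : ℝ × ℝ × Eu m → ℝ := fun q => (f q).im with hΘ
  have hΘc : ContinuousOn Θ C := Complex.continuous_im.comp_continuousOn hfc
  have hΘF : ∀ q ∈ C, u (P q) = planeIso (Complex.exp (Θ q * Complex.I)) := by
    intro q hq
    have h1 : Complex.exp (f q) = F q := hf hq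
    have h2 : (f q).re = 0 := by
      have := hF1 q hq
      rw [← h1, Complex.norm_exp] at this
      exact Real.exp_eq_one_iff _ |>.1 this
    have h3 : f q = Θ q * Complex.I := by
      apply Complex.ext <;> simp [hΘ, h2]
    rw [← h3, h1]
    simp [hF]
  have hinj : ∀ {a b : ℝ}, planeIso (Complex.exp (a * Complex.I)) =
      planeIso (Complex.exp (b * Complex.I)) → ∃ k : ℤ, a = b + k * (2 * Real.pi) := fun h =>
    exp_angle_eq_iff.1 (planeIso.injective h)
  -- The increment of the angle over a period, which is constant on the convex set `C`.
  have hper : ∀ t s p, s ∈ Ioo (0 : ℝ) 1 → p ∈ O →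
      Θ (t + 2 * Real.pi, s, p) = Θ (t, s, p) + 2 * Real.pi * d := by
    set D : ℝ × ℝ × Eu m → ℝ := fun q => Θ (q.1 + 2 * Real.pi, q.2) - Θ q with hD
    have hDc : ContinuousOn D C :=
      (hΘc.comp (by fun_prop) fun q hq => ⟨mem_univ _, hq.2⟩).sub hΘc
    have hDv : ∀ q ∈ C, ∃ k : ℤ, D q = k * (2 * Real.pi) := by
      intro q hq
      have h1 := hΘF (q.1 + 2 * Real.pi, q.2) ⟨mem_univ _, hq.2⟩
      have h2 : P (q.1 + 2 * Real.pi, q.2) = P q := by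
        simp only [hP, circlePt_add_two_pi]
      rw [h2, hΘF q hq] at h1
      obtain ⟨k, hk⟩ := hinj h1.symm
      exact ⟨k, by simp only [hD]; linarith⟩
    have hev := hd.and (Ioo_mem_nhdsGT (hρ0 p₀ hp₀))
    obtain ⟨r, ⟨θ, hθc, hθ, hθd⟩, hr⟩ := hev.exists
    have hs₀ : r / ρ p₀ ∈ Ioo (0 : ℝ) 1 :=
      ⟨div_pos hr.1 (hρ0 p₀ hp₀), (div_lt_one (hρ0 p₀ hp₀)).2 hr.2⟩
    have hline : ∀ t, (t, r / ρ p₀, p₀) ∈ C := fun t => ⟨mem_univ _, hs₀, hp₀⟩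
    have hconst : ∀ t t', Θ (t, r / ρ p₀, p₀) - θ t = Θ (t', r / ρ p₀, p₀) - θ t' := by
      intro t t'
      refine eq_of_values_two_pi_int (S := univ) isPreconnected_univ
        (f := fun t => Θ (t, r / ρ p₀, p₀) - θ t) ?_ ?_ (mem_univ t) (mem_univ t')
      · exact (hΘc.comp (by fun_prop) fun t _ => hline t).sub hθc.continuousOn
      · intro t _
        have h1 := hΘF _ (hline t)
        have h2 : P (t, r / ρ p₀, p₀) = join (circlePt r t) p₀ := by
          simp only [hP]
          rw [div_mul_cancel₀ _ (hρ0 p₀ hp₀).ne']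
        have h3 := hθ t
        simp only at h3
        rw [h2, h3, ← planeIso_exp] at h1
        obtain ⟨k, hk⟩ := hinj h1.symm
        exact ⟨k, by linarith⟩
    intro t s p hs hp
    have h1 := eq_of_values_two_pi_int hCc.isPreconnected hDc hDv
      (show (t, s, p) ∈ C from ⟨mem_univ _, hs, hp⟩) (hline 0)
    have h2 := hconst (0 + 2 * Real.pi) 0
    rw [hθd] at h2
    simp only [hD] at h1
    linarith
  set G : ℝ × ℝ × Eu m → ℝ := fun q => Θ q - d * q.1 with hG
  have hGc : ContinuousOn G C := hΘc.sub (by fun_prop)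
  have hGp : ∀ s ∈ Ioo (0 : ℝ) 1, ∀ p ∈ O, ∀ (t : ℝ) (k : ℤ),
      G (t + k * (2 * Real.pi), s, p) = G (t, s, p) := by
    intro s hs p hp t k
    have : Function.Periodic (fun t => G (t, s, p)) (2 * Real.pi) := fun t => by
      simp only [hG, hper t s p hs hp]
      ring
    exact this.int_mul k t
  set ψ : Eu (m + 2) → ℝ := fun x =>
    G ((zL m x).arg, ‖tildePart x‖ / ρ (hatPart x), hatPart x) with hψ
  have hs : ∀ x ∈ tube O ρ, ‖tildePart x‖ / ρ (hatPart x) ∈ Ioo (0 : ℝ) 1 := fun x hx =>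
    ⟨div_pos hx.2.1 (hρ0 _ hx.1), (div_lt_one (hρ0 _ hx.1)).2 hx.2.2⟩
  have hψu : ∀ x ∈ tube O ρ,
      u x = planeIso (Complex.exp ((d * (zL m x).arg + ψ x : ℝ) * Complex.I)) := by
    intro x hx
    have h1 := hΘF ((zL m x).arg, ‖tildePart x‖ / ρ (hatPart x), hatPart x)
      ⟨mem_univ _, hs x hx, hx.1⟩
    have h2 : P ((zL m x).arg, ‖tildePart x‖ / ρ (hatPart x), hatPart x) = x := by
      simp only [hP]
      rw [div_mul_cancel₀ _ (hρ0 _ hx.1).ne', circlePt_norm_arg, join_tildePart_hatPart]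
    rw [h2] at h1
    rw [h1]
    congr 4
    simp [hψ, hG]
  have htube : IsOpen (tube O ρ) := isOpen_tube hOo hρ
  have hψc : ∀ x ∈ tube O ρ, ContinuousAt ψ x := by
    intro x hx
    have hx0 : tildePart x ≠ 0 := norm_pos_iff.1 hx.2.1
    have h1 : ContinuousAt (fun y : Eu (m + 2) =>
        (angleBranch x y, ‖tildePart y‖ / ρ (hatPart y), hatPart y)) x := by
      have h2 : ContinuousAt (fun y : Eu (m + 2) => ρ (hatPart y)) x :=
        ContinuousAt.comp (g := ρ) (hρ.continuousAt (hOo.mem_nhds hx.1))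
          continuous_hatPart.continuousAt
      exact (contDiffAt_angleBranch hx0).continuousAt.prodMk
        ((continuous_tildePart.norm.continuousAt.div h2 (hρ0 _ hx.1).ne').prodMk
          continuous_hatPart.continuousAt)
    have h3 : ContinuousAt (fun y : Eu (m + 2) =>
        G (angleBranch x y, ‖tildePart y‖ / ρ (hatPart y), hatPart y)) x :=
      ContinuousAt.comp (g := G)
        (hGc.continuousAt (hCo.mem_nhds ⟨mem_univ _, hs x hx, hx.1⟩)) h1
    refine h3.congr ?_
    filter_upwards [htube.mem_nhds hx] with y hy
    obtain ⟨k, hk⟩ := exists_angleBranch_eq hx0 (norm_pos_iff.1 hy.2.1)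
    simp only [hψ]
    rw [hk, hGp _ (hs y hy) _ hy.1]
  refine ⟨ψ, fun x hx => ContDiffAt.contDiffWithinAt ?_, hψu⟩
  have hx0 : tildePart x ≠ 0 := norm_pos_iff.1 hx.2.1
  refine contDiffAt_of_exp (W := fun y => planeIso.symm (u y) *
    Complex.exp ((-(d * angleBranch x y) : ℝ) * Complex.I)) (hψc x hx) ?_ ?_
  · refine ContDiffAt.mul ?_ ?_
    · exact ContDiffAt.comp (g := planeIso.symm) x planeIso.symm.contDiff.contDiffAt
        (hu.contDiffAt (htube.mem_nhds hx))
    · refine Complex.contDiff_exp.contDiffAt.comp x (ContDiffAt.mul ?_ contDiffAt_const)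
      exact ContDiffAt.comp (g := Complex.ofRealCLM) x Complex.ofRealCLM.contDiff.contDiffAt
        (contDiffAt_const.mul (contDiffAt_angleBranch hx0)).neg
  · filter_upwards [htube.mem_nhds hx] with y hy
    obtain ⟨k, hk⟩ := exists_angleBranch_eq hx0 (norm_pos_iff.1 hy.2.1)
    rw [hψu y hy, LinearIsometryEquiv.symm_apply_apply, ← Complex.exp_add, ← add_mul,
      ← Complex.ofReal_add, exp_angle_eq_iff]
    refine ⟨d * k, ?_⟩
    rw [hk]
    push_cast
    ring

/-! ### Maps in polar form -/

/-- The differential of `f exp (i θ)`, for differentials `f'` and `θ'` of modulus and phase. -/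
def polarDeriv {n : ℕ} (f θ : ℝ) (f' θ' : Eu n →L[ℝ] ℝ) : Eu n →L[ℝ] Eu 2 :=
  (planeIso : ℂ →L[ℝ] Eu 2).comp ((ContinuousLinearMap.mul ℝ ℂ (Complex.exp (θ * Complex.I))).comp
    (Complex.ofRealCLM.comp f' + (f * Complex.I) • Complex.ofRealCLM.comp θ'))

theorem polarDeriv_apply {n : ℕ} (f θ : ℝ) (f' θ' : Eu n →L[ℝ] ℝ) (e : Eu n) :
    polarDeriv f θ f' θ' e =
      planeIso (Complex.exp (θ * Complex.I) * (f' e + f * Complex.I * θ' e)) := rfl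

theorem hasFDerivAt_polar {n : ℕ} {f θ : Eu n → ℝ} {f' θ' : Eu n →L[ℝ] ℝ} {x : Eu n}
    (hf : HasFDerivAt f f' x) (hθ : HasFDerivAt θ θ' x) :
    HasFDerivAt (fun y => planeIso (f y * Complex.exp (θ y * Complex.I)))
      (polarDeriv (f x) (θ x) f' θ') x := by
  have h1 : HasFDerivAt (fun y => (f y : ℂ)) (Complex.ofRealCLM.comp f') x :=
    Complex.ofRealCLM.hasFDerivAt.comp x hf
  have h2 : HasFDerivAt (fun y => (θ y : ℂ)) (Complex.ofRealCLM.comp θ') x :=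
    Complex.ofRealCLM.hasFDerivAt.comp x hθ
  have h3 := h1.mul (h2.mul_const Complex.I).cexp
  have h4 := (planeIso : ℂ →L[ℝ] Eu 2).hasFDerivAt.comp x h3
  refine HasFDerivAt.congr_fderiv h4 ?_
  ext1 e
  rw [polarDeriv_apply]
  simp only [ContinuousLinearMap.comp_apply, add_apply, smul_apply, smul_eq_mul,
    Complex.ofRealCLM_apply]
  refine congrArg planeIso ?_
  ring

theorem norm_polarDeriv_le {n : ℕ} (f θ : ℝ) (f' θ' : Eu n →L[ℝ] ℝ) (e : Eu n) :
    ‖polarDeriv f θ f' θ' e‖ ≤ |f' e| + |f| * |θ' e| := by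
  rw [polarDeriv_apply, LinearIsometryEquiv.norm_map, norm_mul, Complex.norm_exp_ofReal_mul_I,
    one_mul]
  refine (norm_add_le _ _).trans ?_
  simp

theorem norm_polarDeriv_one_zero {n : ℕ} (θ : ℝ) (θ' : Eu n →L[ℝ] ℝ) (e : Eu n) :
    ‖polarDeriv 1 θ 0 θ' e‖ = |θ' e| := by
  rw [polarDeriv_apply, LinearIsometryEquiv.norm_map, norm_mul, Complex.norm_exp_ofReal_mul_I,
    one_mul]
  simp

/-- The `2 × 2` minors of a map in polar form. -/
theorem polarDeriv_minor {n : ℕ} (f θ : ℝ) (f' θ' : Eu n →L[ℝ] ℝ) (a b : Eu n) :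
    polarDeriv f θ f' θ' a 0 * polarDeriv f θ f' θ' b 1 -
      polarDeriv f θ f' θ' a 1 * polarDeriv f θ f' θ' b 0 = f * (f' a * θ' b - f' b * θ' a) := by
  simp only [polarDeriv_apply, planeIso_apply, Complex.exp_mul_I]
  simp [Complex.cos_ofReal_re, Complex.sin_ofReal_re]
  linear_combination (f * (f' a * θ' b - f' b * θ' a)) * Real.cos_sq_add_sin_sq θ

/-- The differential of `|x̃|`. -/
def radialForm {m : ℕ} (x : Eu (m + 2)) : Eu (m + 2) →L[ℝ] ℝ :=
  ‖zL m x‖ • Complex.reCLM.comp ((ContinuousLinearMap.mul ℝ ℂ (zL m x)⁻¹).comp (zL m))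

theorem radialForm_apply {m : ℕ} (x e : Eu (m + 2)) :
    radialForm x e = ‖zL m x‖ * ((zL m x)⁻¹ * zL m e).re := rfl

theorem hasFDerivAt_norm_tildePart {m : ℕ} {x : Eu (m + 2)} (h : tildePart x ≠ 0) :
    HasFDerivAt (fun y : Eu (m + 2) => ‖tildePart y‖) (radialForm x) x := by
  have h1 := (hasStrictFDerivAt_norm_sq (zL m x)).hasFDerivAt.comp x (zL m).hasFDerivAt
  have hz : ‖zL m x‖ ≠ 0 := norm_ne_zero_iff.2 (zL_ne_zero.2 h)
  have h2 := HasFDerivAt.sqrt h1 (pow_ne_zero 2 hz)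
  have h3 : (fun y : Eu (m + 2) => ‖tildePart y‖) = fun y => √(((fun x => ‖x‖ ^ 2) ∘ zL m) y) := by
    funext y
    simp [norm_zL, Real.sqrt_sq (norm_nonneg _)]
  rw [h3]
  refine h2.congr_fderiv ?_
  ext e
  rw [radialForm_apply]
  simp only [Function.comp_apply, Real.sqrt_sq (norm_nonneg _)]
  have h4 : ((zL m x)⁻¹ * zL m e).re = (‖zL m x‖ ^ 2)⁻¹ * inner ℝ (zL m x) (zL m e) := by
    rw [Complex.inv_def, Complex.normSq_eq_norm_sq, mul_right_comm, Complex.re_mul_ofReal,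
      Complex.inner, mul_comm (starRingEnd ℂ (zL m x)), mul_comm]
  rw [h4]
  simp [Complex.inner]
  field_simp

theorem abs_radialForm_le {m : ℕ} {x : Eu (m + 2)} (h : tildePart x ≠ 0) (e : Eu (m + 2)) :
    |radialForm x e| ≤ ‖e‖ := by
  have hz : ‖zL m x‖ ≠ 0 := norm_ne_zero_iff.2 (zL_ne_zero.2 h)
  rw [radialForm_apply, abs_mul, abs_norm]
  calc _ ≤ ‖zL m x‖ * (‖zL m x‖⁻¹ * ‖zL m e‖) := by
        gcongr
        refine (Complex.abs_re_le_norm _).trans ?_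
        rw [norm_mul, norm_inv]
    _ = ‖zL m e‖ := by field_simp
    _ ≤ ‖e‖ := norm_zL_le e

/-- The area form of the plane is `r dr ∧ dt`. -/
theorem abs_radialForm_wedge_angleForm_le {m : ℕ} {x : Eu (m + 2)} (h : tildePart x ≠ 0)
    (a b : Eu (m + 2)) :
    |radialForm x a * angleForm x b - radialForm x b * angleForm x a| ≤
      ‖tildePart x‖⁻¹ * ‖a‖ * ‖b‖ := by
  have hz : ‖zL m x‖ ≠ 0 := norm_ne_zero_iff.2 (zL_ne_zero.2 h)
  simp only [radialForm_apply, angleForm_apply]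
  set A := (zL m x)⁻¹ * zL m a with hA
  set B := (zL m x)⁻¹ * zL m b with hB
  have h1 : ‖zL m x‖ * A.re * B.im - ‖zL m x‖ * B.re * A.im =
      ‖zL m x‖ * ((starRingEnd ℂ A) * B).im := by
    simp
    ring
  rw [h1, abs_mul, abs_norm]
  calc _ ≤ ‖zL m x‖ * (‖A‖ * ‖B‖) := by
        gcongr
        refine (Complex.abs_im_le_norm _).trans ?_
        rw [norm_mul, Complex.norm_conj]
    _ = ‖zL m x‖⁻¹ * ‖zL m a‖ * ‖zL m b‖ := by
        rw [hA, hB, norm_mul, norm_mul, norm_inv]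
        field_simp
    _ ≤ ‖zL m x‖⁻¹ * ‖a‖ * ‖b‖ := by
        gcongr
        · exact norm_zL_le a
        · exact norm_zL_le b
    _ = _ := by rw [norm_zL]

/-! ### Filling the tube -/

/-- A unit field `u` with phase `d t + ψ` on the punctured tube of radius `ρ` around `O`, together
with a smooth radius function `κ`, positive on `O` and so small that `κ ≤ ρ / 2` and that
`κ |ψ| ≤ 1` at distance `ρ / 2` from the axis. -/
structure TubeData (m : ℕ) where
  /-- the base of the tube -/
  O : Set (Eu m)
  /-- the radius of the tube -/
  ρ : Eu m → ℝ
  /-- the field -/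
  u : Eu (m + 2) → Eu 2
  /-- the degree -/
  d : ℤ
  /-- the single-valued part of the phase -/
  ψ : Eu (m + 2) → ℝ
  /-- the radius of the tube to be filled -/
  κ : Eu m → ℝ
  /-- a bound for the slope of `κ` -/
  C : ℝ
  isOpen_O : IsOpen O
  isBounded_O : Bornology.IsBounded O
  continuous_ρ : Continuous ρ
  bound_ρ : ℝ
  ρ_le : ∀ p ∈ O, ρ p ≤ bound_ρ
  ρ_pos : ∀ p ∈ O, 0 < ρ p
  smooth_ψ : ContDiffOn ℝ ∞ ψ (tube O ρ)
  u_eq : ∀ x ∈ tube O ρ,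
    u x = planeIso (Complex.exp ((d * (zL m x).arg + ψ x : ℝ) * Complex.I))
  smooth_κ : ContDiff ℝ ∞ κ
  κ_nonneg : ∀ p, 0 ≤ κ p
  κ_eq_zero : ∀ p, p ∉ O → κ p = 0
  κ_pos : ∀ p ∈ O, 0 < κ p
  κ_le : ∀ p ∈ O, κ p ≤ ρ p / 2
  κ_mul_le : ∀ p ∈ O, ∀ t, κ p * |ψ (join (circlePt (ρ p / 2) t) p)| ≤ 1
  C_nonneg : 0 ≤ C
  norm_fderiv_κ_le : ∀ p, ‖fderiv ℝ κ p‖ ≤ C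

/-- The modulus profile: zero for `q ≤ 1/4`, one for `q ≥ 1/2`. -/
def profileMod (q : ℝ) : ℝ := Real.smoothTransition (4 * q - 1)

/-- The phase profile: zero for `q ≤ 1/2`, one for `q ≥ 3/4`. -/
def profilePhase (q : ℝ) : ℝ := Real.smoothTransition (4 * q - 2)

theorem contDiff_profileMod : ContDiff ℝ ∞ profileMod :=
  Real.smoothTransition.contDiff.comp ((contDiff_const.mul contDiff_id).sub contDiff_const)

theorem contDiff_profilePhase : ContDiff ℝ ∞ profilePhase :=
  Real.smoothTransition.contDiff.comp ((contDiff_const.mul contDiff_id).sub contDiff_const)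

theorem profileMod_mem (q : ℝ) : profileMod q ∈ Icc (0 : ℝ) 1 :=
  ⟨Real.smoothTransition.nonneg _, Real.smoothTransition.le_one _⟩

theorem profilePhase_mem (q : ℝ) : profilePhase q ∈ Icc (0 : ℝ) 1 :=
  ⟨Real.smoothTransition.nonneg _, Real.smoothTransition.le_one _⟩

theorem profileMod_of_le {q : ℝ} (h : q ≤ 1 / 4) : profileMod q = 0 :=
  Real.smoothTransition.zero_of_nonpos (by linarith)

theorem profileMod_of_ge {q : ℝ} (h : 1 / 2 ≤ q) : profileMod q = 1 :=
  Real.smoothTransition.one_of_one_le (by linarith)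

theorem profilePhase_of_le {q : ℝ} (h : q ≤ 1 / 2) : profilePhase q = 0 :=
  Real.smoothTransition.zero_of_nonpos (by linarith)

theorem profilePhase_of_ge {q : ℝ} (h : 3 / 4 ≤ q) : profilePhase q = 1 :=
  Real.smoothTransition.one_of_one_le (by linarith)

theorem monotone_profileMod : Monotone profileMod := fun a b h =>
  Real.smoothTransition.monotone (by linarith)

theorem deriv_profileMod_nonneg (q : ℝ) : 0 ≤ deriv profileMod q :=
  monotone_profileMod.deriv_nonneg

theorem deriv_profileMod_of_ge {q : ℝ} (h : 1 / 2 ≤ q) : deriv profileMod q = 0 := by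
  have : IsLocalMax profileMod q := Eventually.of_forall fun s => by
    rw [profileMod_of_ge h]
    exact (profileMod_mem s).2
  exact this.deriv_eq_zero

theorem deriv_profilePhase_of_le {q : ℝ} (h : q ≤ 1 / 2) : deriv profilePhase q = 0 := by
  have : IsLocalMin profilePhase q := Eventually.of_forall fun s => by
    rw [profilePhase_of_le h]
    exact (profilePhase_mem s).1
  exact this.deriv_eq_zero

theorem abs_deriv_smoothTransition_comp_le {C : ℝ}
    (hC : ∀ s, |deriv Real.smoothTransition s| ≤ C) (c q : ℝ) :
    |deriv (fun q : ℝ => Real.smoothTransition (4 * q - c)) q| ≤ 4 * C := by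
  have h1 : HasDerivAt (fun q : ℝ => 4 * q - c) (4 : ℝ) q := by
    simpa using ((hasDerivAt_id q).const_mul (4 : ℝ)).sub_const c
  have h2 := ((Real.smoothTransition.contDiff (n := 1)).differentiable (by simp)
    (4 * q - c)).hasDerivAt.comp q h1
  have h3 : deriv (fun q : ℝ => Real.smoothTransition (4 * q - c)) q =
      deriv Real.smoothTransition (4 * q - c) * 4 := h2.deriv
  rw [h3, abs_mul, abs_of_pos (by norm_num : (0 : ℝ) < 4)]
  nlinarith [hC (4 * q - c)]

/-- A bound for the slopes of the profiles. -/
theorem exists_slope_bound : ∃ K : ℝ, 0 ≤ K ∧ ∀ q, |deriv profileMod q| ≤ K ∧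
    |deriv profilePhase q| ≤ K := by
  obtain ⟨C, hC0, hC⟩ := exists_abs_deriv_smoothTransition_le
  exact ⟨4 * C, by positivity, fun q => ⟨abs_deriv_smoothTransition_comp_le hC 1 q,
    abs_deriv_smoothTransition_comp_le hC 2 q⟩⟩

namespace TubeData

variable {m : ℕ} (X : TubeData m)

/-- The normalised distance `|x̃| / (δ κ(x̂))` to the axis. -/
def q (δ : ℝ) (x : Eu (m + 2)) : ℝ := ‖tildePart x‖ / (δ * X.κ (hatPart x))

/-- The filling of the tube of radius `δ κ`: for decreasing distance to the axis the phase is first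
deformed to `d t`, and then the modulus decreases to zero. -/
def core (δ : ℝ) (x : Eu (m + 2)) : Eu 2 :=
  planeIso (profileMod (X.q δ x) * Complex.exp
    ((X.d * (zL m x).arg + profilePhase (X.q δ x) * X.ψ x : ℝ) * Complex.I))

open Classical in
/-- The field `u` with the tube of radius `δ κ` filled. -/
def filled (δ : ℝ) (x : Eu (m + 2)) : Eu 2 :=
  if ‖tildePart x‖ < δ * X.κ (hatPart x) then X.core δ x else X.u x

/-- The punctured tube on which the phase is defined. -/
abbrev Ω : Set (Eu (m + 2)) := tube X.O X.ρ

theorem isOpen_Ω : IsOpen X.Ω := isOpen_tube X.isOpen_O X.continuous_ρ.continuousOn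

variable {X} {δ : ℝ} {x : Eu (m + 2)}

theorem core_eq_u (hx : x ∈ X.Ω) (hq : 3 / 4 ≤ X.q δ x) : X.core δ x = X.u x := by
  rw [core, profileMod_of_ge (by linarith), profilePhase_of_ge hq, X.u_eq x hx]
  simp

theorem filled_eq_core (hδ : 0 < δ) (hx : x ∈ X.Ω) : X.filled δ x = X.core δ x := by
  rw [filled]
  split_ifs with h
  · rfl
  · push Not at h
    have h1 : 0 < δ * X.κ (hatPart x) := mul_pos hδ (X.κ_pos _ hx.1)
    refine (core_eq_u hx ?_).symm
    have : 1 ≤ X.q δ x := (one_le_div h1).2 h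
    linarith

theorem filled_of_le (h : δ * X.κ (hatPart x) ≤ ‖tildePart x‖) : X.filled δ x = X.u x := by
  rw [filled, if_neg (not_lt.2 h)]

/-- Near a point of the tube the filling is in polar form with a branch of the angle. -/
theorem core_eventuallyEq (δ : ℝ) (hx : x ∈ X.Ω) : X.core δ =ᶠ[𝓝 x] fun y =>
    planeIso ((profileMod (X.q δ y) : ℝ) * Complex.exp
      ((X.d * angleBranch x y + profilePhase (X.q δ y) * X.ψ y : ℝ) * Complex.I)) := by
  filter_upwards [X.isOpen_Ω.mem_nhds hx] with y hy
  rw [core]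
  congr 2
  rw [exp_angle_eq_iff]
  obtain ⟨k, hk⟩ := exists_angleBranch_eq (norm_pos_iff.1 hx.2.1) (norm_pos_iff.1 hy.2.1)
  refine ⟨-(X.d * k), ?_⟩
  rw [hk]
  push_cast
  ring

theorem u_eventuallyEq (hx : x ∈ X.Ω) : X.u =ᶠ[𝓝 x] fun y =>
    planeIso (((fun _ => 1 : Eu (m + 2) → ℝ) y : ℝ) * Complex.exp
      ((X.d * angleBranch x y + X.ψ y : ℝ) * Complex.I)) := by
  filter_upwards [X.isOpen_Ω.mem_nhds hx] with y hy
  rw [X.u_eq y hy, Complex.ofReal_one, one_mul]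
  congr 1
  rw [exp_angle_eq_iff]
  obtain ⟨k, hk⟩ := exists_angleBranch_eq (norm_pos_iff.1 hx.2.1) (norm_pos_iff.1 hy.2.1)
  refine ⟨-(X.d * k), ?_⟩
  rw [hk]
  push_cast
  ring

theorem contDiffAt_q (hδ : 0 < δ) (hx : x ∈ X.Ω) : ContDiffAt ℝ ∞ (X.q δ) x := by
  refine ContDiffAt.div ?_ ?_ (mul_pos hδ (X.κ_pos _ hx.1)).ne'
  · exact ContDiffAt.norm ℝ (tildeL m).contDiff.contDiffAt (norm_pos_iff.1 hx.2.1)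
  · exact contDiffAt_const.mul (X.smooth_κ.comp (hatL m).contDiff).contDiffAt

theorem contDiffAt_core (hδ : 0 < δ) (hx : x ∈ X.Ω) : ContDiffAt ℝ ∞ (X.core δ) x := by
  refine ContDiffAt.congr_of_eventuallyEq ?_ (core_eventuallyEq δ hx)
  refine ContDiffAt.comp (g := planeIso) x planeIso.contDiff.contDiffAt ?_
  have hψ : ContDiffAt ℝ ∞ X.ψ x := X.smooth_ψ.contDiffAt (X.isOpen_Ω.mem_nhds hx)
  have hq := contDiffAt_q hδ hx
  refine ContDiffAt.mul ?_ ?_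
  · exact ContDiffAt.comp (g := Complex.ofRealCLM) x Complex.ofRealCLM.contDiff.contDiffAt
      (contDiff_profileMod.contDiffAt.comp x hq)
  · refine Complex.contDiff_exp.contDiffAt.comp x (ContDiffAt.mul ?_ contDiffAt_const)
    refine ContDiffAt.comp (g := Complex.ofRealCLM) x Complex.ofRealCLM.contDiff.contDiffAt ?_
    exact (contDiffAt_const.mul (contDiffAt_angleBranch (norm_pos_iff.1 hx.2.1))).add
      ((contDiff_profilePhase.contDiffAt.comp x hq).mul hψ)

theorem filled_eventuallyEq_core (hδ : 0 < δ) (hx : x ∈ X.Ω) : X.filled δ =ᶠ[𝓝 x] X.core δ := by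
  filter_upwards [X.isOpen_Ω.mem_nhds hx] with y hy using filled_eq_core hδ hy

theorem continuous_κ_hat : Continuous fun x : Eu (m + 2) => X.κ (hatPart x) :=
  X.smooth_κ.continuous.comp continuous_hatPart

theorem filled_eventuallyEq_u (h : δ * X.κ (hatPart x) < ‖tildePart x‖) :
    X.filled δ =ᶠ[𝓝 x] X.u := by
  have hopen : IsOpen {y : Eu (m + 2) | δ * X.κ (hatPart y) < ‖tildePart y‖} :=
    isOpen_lt (continuous_const.mul continuous_κ_hat) continuous_tildePart.norm
  filter_upwards [hopen.mem_nhds h] with y hy using filled_of_le (le_of_lt hy)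

theorem filled_eventuallyEq_zero (hδ : 0 < δ) (hx : hatPart x ∈ X.O) (h0 : tildePart x = 0) :
    X.filled δ =ᶠ[𝓝 x] fun _ => 0 := by
  have hopen : IsOpen {y : Eu (m + 2) | ‖tildePart y‖ < 1 / 4 * (δ * X.κ (hatPart y))} :=
    isOpen_lt continuous_tildePart.norm
      (continuous_const.mul (continuous_const.mul continuous_κ_hat))
  have hmem : x ∈ {y : Eu (m + 2) | ‖tildePart y‖ < 1 / 4 * (δ * X.κ (hatPart y))} := by
    have := mul_pos hδ (X.κ_pos _ hx)
    rw [mem_ofPred_eq, h0, norm_zero]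
    positivity
  filter_upwards [hopen.mem_nhds hmem] with y hy
  have hy' : ‖tildePart y‖ < 1 / 4 * (δ * X.κ (hatPart y)) := hy
  have hpos : 0 < δ * X.κ (hatPart y) := by
    have := norm_nonneg (tildePart y)
    linarith
  rw [filled, if_pos (by linarith), core, profileMod_of_le]
  · simp
  · rw [q, div_le_iff₀ hpos]
    exact hy'.le

/-- The filled field is smooth over `O`, wherever the field `u` is smooth off the axis. -/
theorem contDiffAt_filled (hδ : 0 < δ) (hδ1 : δ ≤ 1) (hx : hatPart x ∈ X.O)
    (hu : tildePart x ≠ 0 → ContDiffAt ℝ ∞ X.u x) : ContDiffAt ℝ ∞ (X.filled δ) x := by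
  by_cases h0 : tildePart x = 0
  · exact contDiffAt_const.congr_of_eventuallyEq (filled_eventuallyEq_zero hδ hx h0)
  · by_cases hr : ‖tildePart x‖ < X.ρ (hatPart x)
    · have hΩ : x ∈ X.Ω := ⟨hx, norm_pos_iff.2 h0, hr⟩
      exact (contDiffAt_core hδ hΩ).congr_of_eventuallyEq (filled_eventuallyEq_core hδ hΩ)
    · refine (hu h0).congr_of_eventuallyEq (filled_eventuallyEq_u ?_)
      push Not at hr
      have h1 := X.κ_le _ hx
      have h2 := X.κ_pos _ hx
      have h3 := X.ρ_pos _ hx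
      nlinarith

theorem norm_core_le (δ : ℝ) (x : Eu (m + 2)) : ‖X.core δ x‖ ≤ 1 := by
  rw [core, LinearIsometryEquiv.norm_map, norm_mul, Complex.norm_exp_ofReal_mul_I, mul_one,
    Complex.norm_real, Real.norm_eq_abs, abs_of_nonneg (profileMod_mem _).1]
  exact (profileMod_mem _).2

/-- The differential of the normalised distance. -/
def qDeriv (X : TubeData m) (δ : ℝ) (x : Eu (m + 2)) : Eu (m + 2) →L[ℝ] ℝ :=
  (δ * X.κ (hatPart x))⁻¹ •
    (radialForm x - (X.q δ x * δ) • (fderiv ℝ X.κ (hatPart x)).comp (hatL m))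

theorem hasFDerivAt_q (hδ : 0 < δ) (hx : x ∈ X.Ω) : HasFDerivAt (X.q δ) (X.qDeriv δ x) x := by
  have hk := mul_pos hδ (X.κ_pos _ hx.1)
  have h1 : HasFDerivAt (fun y : Eu (m + 2) => X.κ (hatPart y))
      ((fderiv ℝ X.κ (hatPart x)).comp (hatL m)) x :=
    HasFDerivAt.comp (g := X.κ) x ((X.smooth_κ.differentiable (by simp) _).hasFDerivAt)
      (hatL m).hasFDerivAt
  have h2 := (hasFDerivAt_norm_tildePart (norm_pos_iff.1 hx.2.1)).mul
    ((hasDerivAt_inv hk.ne').comp_hasFDerivAt x (h1.const_mul δ))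
  refine (h2.congr_fderiv ?_).congr_of_eventuallyEq ?_
  · ext e
    have hδ' := hδ.ne'
    have hκ' := (X.κ_pos _ hx.1).ne'
    simp only [qDeriv, q, add_apply, smul_apply, sub_apply, smul_eq_mul, Function.comp_apply]
    field_simp
    ring
  · exact Eventually.of_forall fun y => div_eq_mul_inv _ _

theorem abs_qDeriv_le (hδ : 0 < δ) (hδ1 : δ ≤ 1) (hx : x ∈ X.Ω) (hq : X.q δ x ≤ 1)
    (e : Eu (m + 2)) : |X.qDeriv δ x e| ≤ (1 + X.C) * ‖tildePart x‖⁻¹ * ‖e‖ := by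
  have hk := mul_pos hδ (X.κ_pos _ hx.1)
  have hr : ‖tildePart x‖ ≤ δ * X.κ (hatPart x) := by
    rw [q, div_le_one hk] at hq
    exact hq
  have hq0 : 0 ≤ X.q δ x := div_nonneg (norm_nonneg _) hk.le
  simp only [qDeriv, smul_apply, sub_apply, smul_eq_mul, abs_mul, ContinuousLinearMap.comp_apply]
  have h1 := abs_radialForm_le (norm_pos_iff.1 hx.2.1) e
  have h2 : |fderiv ℝ X.κ (hatPart x) (hatL m e)| ≤ X.C * ‖e‖ :=
    ((fderiv ℝ X.κ (hatPart x)).le_opNorm _).trans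
      (mul_le_mul (X.norm_fderiv_κ_le _) (norm_hatPart_le e) (norm_nonneg _) X.C_nonneg)
  have h3 : |radialForm x e - X.q δ x * δ * fderiv ℝ X.κ (hatPart x) (hatL m e)| ≤
      ‖e‖ + 1 * (X.C * ‖e‖) := by
    refine (abs_sub _ _).trans (add_le_add h1 ?_)
    rw [abs_mul]
    refine mul_le_mul ?_ h2 (abs_nonneg _) zero_le_one
    rw [abs_of_nonneg (by positivity)]
    nlinarith
  calc _ ≤ ‖tildePart x‖⁻¹ * (‖e‖ + 1 * (X.C * ‖e‖)) := by
        rw [abs_of_pos (inv_pos.2 hk)]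
        have := inv_anti₀ hx.2.1 hr
        gcongr
    _ = _ := by ring

/-- The differential of the single-valued part of the phase is controlled by that of `u`. -/
theorem abs_fderiv_ψ_le (hx : x ∈ X.Ω) (e : Eu (m + 2)) :
    |fderiv ℝ X.ψ x e| ≤ (‖fderiv ℝ X.u x‖ + |(X.d : ℝ)| * ‖tildePart x‖⁻¹) * ‖e‖ := by
  have hψ : HasFDerivAt X.ψ (fderiv ℝ X.ψ x) x :=
    ((X.smooth_ψ.contDiffAt (X.isOpen_Ω.mem_nhds hx)).differentiableAt (by simp)).hasFDerivAt
  have h1 := (hasFDerivAt_polar (hasFDerivAt_const (1 : ℝ) x)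
    (((hasFDerivAt_angleBranch (norm_pos_iff.1 hx.2.1)).const_mul (X.d : ℝ)).add
      hψ)).congr_of_eventuallyEq (u_eventuallyEq hx)
  have h2 := (fderiv ℝ X.u x).le_opNorm e
  rw [h1.fderiv, norm_polarDeriv_one_zero] at h2
  rw [h1.fderiv]
  simp only [add_apply, smul_apply, smul_eq_mul] at h2
  have h3 := abs_angleForm_le x e
  have h4 : |(X.d : ℝ) * angleForm x e| ≤ |(X.d : ℝ)| * (‖tildePart x‖⁻¹ * ‖e‖) := by
    rw [abs_mul]
    gcongr
  have h5 : fderiv ℝ X.ψ x e = (X.d * angleForm x e + fderiv ℝ X.ψ x e) - X.d * angleForm x e := by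
    ring
  calc _ ≤ |X.d * angleForm x e + fderiv ℝ X.ψ x e| + |X.d * angleForm x e| := by
        conv_lhs => rw [h5]
        exact abs_sub _ _
    _ ≤ _ := by
        rw [add_mul, mul_assoc]
        exact add_le_add h2 h4

theorem hasFDerivAt_core (hδ : 0 < δ) (hx : x ∈ X.Ω) :
    HasFDerivAt (X.core δ) (polarDeriv (profileMod (X.q δ x))
      (X.d * angleBranch x x + profilePhase (X.q δ x) * X.ψ x)
      (deriv profileMod (X.q δ x) • X.qDeriv δ x)
      ((X.d : ℝ) • angleForm x + (profilePhase (X.q δ x) • fderiv ℝ X.ψ x +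
        X.ψ x • (deriv profilePhase (X.q δ x) • X.qDeriv δ x)))) x := by
  have hψ : HasFDerivAt X.ψ (fderiv ℝ X.ψ x) x :=
    ((X.smooth_ψ.contDiffAt (X.isOpen_Ω.mem_nhds hx)).differentiableAt (by simp)).hasFDerivAt
  have hq := hasFDerivAt_q hδ hx
  have hm : HasFDerivAt (fun y => profileMod (X.q δ y))
      (deriv profileMod (X.q δ x) • X.qDeriv δ x) x :=
    (contDiff_profileMod.differentiable (by simp) _).hasDerivAt.comp_hasFDerivAt x hq
  have hp : HasFDerivAt (fun y => profilePhase (X.q δ y))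
      (deriv profilePhase (X.q δ x) • X.qDeriv δ x) x :=
    (contDiff_profilePhase.differentiable (by simp) _).hasDerivAt.comp_hasFDerivAt x hq
  exact (hasFDerivAt_polar hm (((hasFDerivAt_angleBranch (norm_pos_iff.1 hx.2.1)).const_mul
    (X.d : ℝ)).add (hp.mul hψ))).congr_of_eventuallyEq (core_eventuallyEq δ hx)

/-- The gradient of the filling is bounded by `1/|x̃|`, `|ψ|/|x̃|` and the gradient of `u`, with
constants independent of `δ`. -/
theorem norm_fderiv_core_le {K : ℝ} (hK : ∀ q, |deriv profileMod q| ≤ K ∧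
    |deriv profilePhase q| ≤ K) (hδ : 0 < δ) (hδ1 : δ ≤ 1) (hx : x ∈ X.Ω)
    (hq : X.q δ x ≤ 1) :
    ‖fderiv ℝ (X.core δ) x‖ ≤ (K * (1 + X.C) + 2 * |(X.d : ℝ)|) * ‖tildePart x‖⁻¹ +
      K * (1 + X.C) * (|X.ψ x| * ‖tildePart x‖⁻¹) + ‖fderiv ℝ X.u x‖ := by
  have hK0 : 0 ≤ K := (abs_nonneg _).trans (hK 0).1
  have hC := X.C_nonneg
  rw [(hasFDerivAt_core hδ hx).fderiv]
  refine ContinuousLinearMap.opNorm_le_bound _ (by positivity) fun e => ?_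
  refine (norm_polarDeriv_le _ _ _ _ _).trans ?_
  have h1 := abs_qDeriv_le hδ hδ1 hx hq e
  have h2 := abs_fderiv_ψ_le hx e
  have h3 := abs_angleForm_le x e
  have hm := profileMod_mem (X.q δ x)
  have hp := profilePhase_mem (X.q δ x)
  simp only [add_apply, smul_apply, smul_eq_mul]
  set Q := (1 + X.C) * ‖tildePart x‖⁻¹ * ‖e‖ with hQ
  have hQ0 : 0 ≤ Q := by positivity
  have e1 : |deriv profileMod (X.q δ x) * X.qDeriv δ x e| ≤ K * Q := by
    rw [abs_mul]
    exact mul_le_mul (hK _).1 h1 (abs_nonneg _) hK0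
  have e2 : |X.ψ x * (deriv profilePhase (X.q δ x) * X.qDeriv δ x e)| ≤ |X.ψ x| * (K * Q) := by
    rw [abs_mul, abs_mul]
    gcongr
    exact (hK _).2
  have e3 : |profilePhase (X.q δ x) * fderiv ℝ X.ψ x e| ≤
      1 * ((‖fderiv ℝ X.u x‖ + |(X.d : ℝ)| * ‖tildePart x‖⁻¹) * ‖e‖) := by
    rw [abs_mul, abs_of_nonneg hp.1]
    exact mul_le_mul hp.2 h2 (abs_nonneg _) zero_le_one
  have e4 : |(X.d : ℝ) * angleForm x e| ≤ |(X.d : ℝ)| * (‖tildePart x‖⁻¹ * ‖e‖) := by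
    rw [abs_mul]
    gcongr
  have e5 : |profileMod (X.q δ x)| ≤ 1 := by
    rw [abs_of_nonneg hm.1]
    exact hm.2
  calc _ ≤ K * Q + 1 * (|(X.d : ℝ)| * (‖tildePart x‖⁻¹ * ‖e‖) +
        (1 * ((‖fderiv ℝ X.u x‖ + |(X.d : ℝ)| * ‖tildePart x‖⁻¹) * ‖e‖) +
          |X.ψ x| * (K * Q))) := by
        refine add_le_add e1 (mul_le_mul e5 ?_ (abs_nonneg _) zero_le_one)
        exact (abs_add_le _ _).trans (add_le_add e4 ((abs_add_le _ _).trans (add_le_add e3 e2)))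
    _ = _ := by
        rw [hQ]
        ring

/-- The bound for the `2 × 2` minors of the filling. -/
def minorBound (X : TubeData m) (δ : ℝ) (x : Eu (m + 2)) : ℝ :=
  |(X.d : ℝ)| * (1 + 2 * X.C * δ) * (profileMod (X.q δ x) * deriv profileMod (X.q δ x) *
    (δ * X.κ (hatPart x))⁻¹ * ‖tildePart x‖⁻¹)

theorem minorBound_nonneg (hδ : 0 < δ) (x : Eu (m + 2)) : 0 ≤ X.minorBound δ x := by
  have h1 := (profileMod_mem (X.q δ x)).1
  have h2 := deriv_profileMod_nonneg (X.q δ x)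
  have h3 := X.C_nonneg
  have h4 := X.κ_nonneg (hatPart x)
  rw [minorBound]
  positivity

/-- Where the modulus varies the phase is `d t`, so that the minors are those of `f exp (i d t)`. -/
theorem abs_minor_core_le (hδ : 0 < δ) (hx : x ∈ X.Ω) (a b : Eu (m + 2)) :
    |fderiv ℝ (X.core δ) x a 0 * fderiv ℝ (X.core δ) x b 1 -
      fderiv ℝ (X.core δ) x a 1 * fderiv ℝ (X.core δ) x b 0| ≤
        X.minorBound δ x * ‖a‖ * ‖b‖ := by
  have hk := mul_pos hδ (X.κ_pos _ hx.1)
  have h0 : tildePart x ≠ 0 := norm_pos_iff.1 hx.2.1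
  rw [(hasFDerivAt_core hδ hx).fderiv, polarDeriv_minor]
  by_cases hq : 1 / 2 ≤ X.q δ x
  · rw [minorBound, deriv_profileMod_of_ge hq]
    simp
  push Not at hq
  rw [profilePhase_of_le hq.le, deriv_profilePhase_of_le hq.le]
  simp only [smul_apply, add_apply, smul_eq_mul, zero_mul, mul_zero, add_zero]
  have hm := (profileMod_mem (X.q δ x)).1
  have hd := deriv_profileMod_nonneg (X.q δ x)
  have hQ : 0 ≤ X.q δ x := div_nonneg (norm_nonneg _) hk.le
  have hC := X.C_nonneg
  have hκ : ∀ e, |fderiv ℝ X.κ (hatPart x) (hatL m e)| ≤ X.C * ‖e‖ := fun e =>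
    ((fderiv ℝ X.κ (hatPart x)).le_opNorm _).trans
      (mul_le_mul (X.norm_fderiv_κ_le _) (norm_hatPart_le e) (norm_nonneg _) X.C_nonneg)
  have hα := abs_angleForm_le x
  have hw := abs_radialForm_wedge_angleForm_le h0 a b
  set k := δ * X.κ (hatPart x) with hkdef
  set W := (radialForm x a * angleForm x b - radialForm x b * angleForm x a) -
    X.q δ x * δ * (fderiv ℝ X.κ (hatPart x) (hatL m a) * angleForm x b -
      fderiv ℝ X.κ (hatPart x) (hatL m b) * angleForm x a) with hW
  have hWle : |W| ≤ (1 + 2 * X.C * δ) * (‖tildePart x‖⁻¹ * ‖a‖ * ‖b‖) := by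
    have e1 : |fderiv ℝ X.κ (hatPart x) (hatL m a) * angleForm x b -
        fderiv ℝ X.κ (hatPart x) (hatL m b) * angleForm x a| ≤
        2 * X.C * (‖tildePart x‖⁻¹ * ‖a‖ * ‖b‖) := by
      refine (abs_sub _ _).trans ?_
      rw [abs_mul, abs_mul]
      calc _ ≤ X.C * ‖a‖ * (‖tildePart x‖⁻¹ * ‖b‖) + X.C * ‖b‖ * (‖tildePart x‖⁻¹ * ‖a‖) := by
            refine add_le_add (mul_le_mul (hκ a) (hα b) (abs_nonneg _) (by positivity))
              (mul_le_mul (hκ b) (hα a) (abs_nonneg _) (by positivity))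
        _ = _ := by ring
    have e2 : |X.q δ x * δ| ≤ δ := by
      rw [abs_of_nonneg (by positivity)]
      nlinarith
    refine (abs_sub _ _).trans ?_
    rw [abs_mul]
    calc _ ≤ ‖tildePart x‖⁻¹ * ‖a‖ * ‖b‖ + δ * (2 * X.C * (‖tildePart x‖⁻¹ * ‖a‖ * ‖b‖)) :=
          add_le_add hw (mul_le_mul e2 e1 (abs_nonneg _) hδ.le)
      _ = _ := by ring
  have hform : profileMod (X.q δ x) * (deriv profileMod (X.q δ x) * X.qDeriv δ x a *
      (X.d * angleForm x b) - deriv profileMod (X.q δ x) * X.qDeriv δ x b *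
        (X.d * angleForm x a)) =
      (profileMod (X.q δ x) * deriv profileMod (X.q δ x) * k⁻¹) * (X.d * W) := by
    simp only [qDeriv, smul_apply, sub_apply, smul_eq_mul, ContinuousLinearMap.comp_apply, hW,
      ← hkdef]
    ring
  rw [hform, abs_mul _ ((X.d : ℝ) * W), abs_mul (X.d : ℝ) W, abs_of_nonneg (by positivity)]
  calc _ ≤ profileMod (X.q δ x) * deriv profileMod (X.q δ x) * k⁻¹ *
        (|(X.d : ℝ)| * ((1 + 2 * X.C * δ) * (‖tildePart x‖⁻¹ * ‖a‖ * ‖b‖))) := by gcongr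
    _ = _ := by
        rw [minorBound]
        ring

/-- A unit field has vanishing minors. -/
theorem minor_u_eq_zero (hx : x ∈ X.Ω) (a b : Eu (m + 2)) :
    fderiv ℝ X.u x a 0 * fderiv ℝ X.u x b 1 - fderiv ℝ X.u x a 1 * fderiv ℝ X.u x b 0 = 0 := by
  have hψ : HasFDerivAt X.ψ (fderiv ℝ X.ψ x) x :=
    ((X.smooth_ψ.contDiffAt (X.isOpen_Ω.mem_nhds hx)).differentiableAt (by simp)).hasFDerivAt
  have h1 := (hasFDerivAt_polar (hasFDerivAt_const (1 : ℝ) x)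
    (((hasFDerivAt_angleBranch (norm_pos_iff.1 hx.2.1)).const_mul (X.d : ℝ)).add
      hψ)).congr_of_eventuallyEq (u_eventuallyEq hx)
  rw [h1.fderiv, polarDeriv_minor]
  simp

end TubeData

/-! ### Integrals over tubes -/

section Tube

variable {m : ℕ} {O : Set (Eu m)} {ρ : Eu m → ℝ}

theorem join_circlePt_mem_tube {r t : ℝ} {p : Eu m} (hp : p ∈ O) (hr : 0 < r) (hrρ : r < ρ p) :
    join (circlePt r t) p ∈ tube O ρ := by
  refine ⟨?_, ?_, ?_⟩ <;> simp [tildePart_join, hatPart_join, norm_circlePt, abs_of_pos hr, *]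

theorem lintegral_tube (hO : IsOpen O) (hρ : Continuous ρ) {f : Eu (m + 2) → ℝ≥0∞}
    (hf : Measurable f) :
    ∫⁻ x in tube O ρ, f x = ∫⁻ p in O, ∫⁻ t in Ioo (-Real.pi) Real.pi, ∫⁻ r in Ioo 0 (ρ p),
      ENNReal.ofReal r * f (join (circlePt r t) p) := by
  have hm : MeasurableSet (tube O ρ) := (isOpen_tube hO hρ.continuousOn).measurableSet
  rw [← lintegral_indicator hm, lintegral_cyl (hf.indicator hm),
    ← lintegral_indicator hO.measurableSet]
  refine lintegral_congr fun p => ?_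
  have key : ∀ t r, 0 < r → (tube O ρ).indicator f (join (circlePt r t) p) =
      O.indicator (fun p => (Iio (ρ p)).indicator (fun r => f (join (circlePt r t) p)) r) p := by
    intro t r hr
    by_cases hp : p ∈ O
    · rw [indicator_of_mem hp]
      by_cases hrp : r < ρ p
      · rw [indicator_of_mem (join_circlePt_mem_tube hp hr hrp), indicator_of_mem (mem_Iio.2 hrp)]
      · rw [indicator_of_notMem, indicator_of_notMem (by simpa using hrp)]
        intro h
        have := h.2.2
        rw [tildePart_join, hatPart_join, norm_circlePt, abs_of_pos hr] at this
        exact hrp this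
    · rw [indicator_of_notMem hp, indicator_of_notMem]
      intro h
      have := h.1
      rw [hatPart_join] at this
      exact hp this
  by_cases hp : p ∈ O
  · rw [indicator_of_mem hp]
    refine lintegral_congr fun t => ?_
    have : Ioo 0 (ρ p) = Iio (ρ p) ∩ Ioi 0 := by rw [inter_comm, Ioi_inter_Iio]
    rw [this, ← Measure.restrict_restrict measurableSet_Iio, ← lintegral_indicator measurableSet_Iio]
    refine setLIntegral_congr_fun measurableSet_Ioi fun r hr => ?_
    simp only [key t r hr, indicator_of_mem hp]
    by_cases h : r ∈ Iio (ρ p) <;> simp [h]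
  · rw [indicator_of_notMem hp]
    have : ∀ t, ∫⁻ r in Ioi (0 : ℝ), ENNReal.ofReal r *
        (tube O ρ).indicator f (join (circlePt r t) p) = 0 := fun t => by
      rw [setLIntegral_congr_fun measurableSet_Ioi (g := fun _ => 0)]
      · simp
      · intro r hr
        simp [key t r hr, indicator_of_notMem hp]
    simp [this]

/-- A bound for the integral over a tube by bounds on the radial integrals. -/
theorem lintegral_tube_le (hO : IsOpen O) (hρ : Continuous ρ) {f : Eu (m + 2) → ℝ≥0∞}
    (hf : Measurable f) {A : ℝ≥0∞} (hA : ∀ p ∈ O, ∀ t, ∫⁻ r in Ioo 0 (ρ p),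
      ENNReal.ofReal r * f (join (circlePt r t) p) ≤ A) :
    ∫⁻ x in tube O ρ, f x ≤ ENNReal.ofReal (2 * Real.pi) * A * volume O := by
  rw [lintegral_tube hO hρ hf]
  calc _ ≤ ∫⁻ _ in O, ∫⁻ _ in Ioo (-Real.pi) Real.pi, A :=
        setLIntegral_mono' hO.measurableSet fun p hp => lintegral_mono fun t => hA p hp t
    _ = _ := by
        rw [lintegral_const, lintegral_const, Measure.restrict_apply_univ,
          Measure.restrict_apply_univ, Real.volume_Ioo, mul_comm A]
        ring_nf

theorem volume_tube_le (hO : IsOpen O) (hρ : Continuous ρ) {c : ℝ} (hc : ∀ p ∈ O, ρ p ≤ c)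
    (hρ0 : ∀ p ∈ O, 0 ≤ ρ p) :
    volume (tube O ρ) ≤ ENNReal.ofReal (2 * Real.pi) * ENNReal.ofReal (c ^ 2) * volume O := by
  rw [← setLIntegral_one]
  refine lintegral_tube_le hO hρ measurable_const fun p hp t => ?_
  have h0 := hρ0 p hp
  have h1 := hc p hp
  calc _ ≤ ∫⁻ _ in Ioo 0 (ρ p), ENNReal.ofReal c :=
        setLIntegral_mono' measurableSet_Ioo fun r hr => by
          rw [mul_one]
          exact ENNReal.ofReal_le_ofReal (hr.2.le.trans h1)
    _ ≤ _ := by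
        rw [setLIntegral_const, Real.volume_Ioo, sub_zero, ← ENNReal.ofReal_mul (h0.trans h1)]
        refine ENNReal.ofReal_le_ofReal ?_
        nlinarith

theorem measurable_tildePart : Measurable (tildePart : Eu (m + 2) → Eu 2) :=
  continuous_tildePart.measurable

theorem lintegral_inv_norm_tube_le (hO : IsOpen O) (hρ : Continuous ρ) {c : ℝ}
    (hc : ∀ p ∈ O, ρ p ≤ c) :
    ∫⁻ x in tube O ρ, ENNReal.ofReal ‖tildePart x‖⁻¹ ≤
      ENNReal.ofReal (2 * Real.pi) * ENNReal.ofReal c * volume O := by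
  refine lintegral_tube_le hO hρ (f := fun x =>
    ENNReal.ofReal ‖tildePart x‖⁻¹) measurable_tildePart.norm.inv.ennreal_ofReal fun p hp t => ?_
  calc _ ≤ ∫⁻ _ in Ioo 0 (ρ p), 1 :=
        setLIntegral_mono' measurableSet_Ioo fun r hr => by
          rw [tildePart_join, norm_circlePt, abs_of_pos hr.1, ← ENNReal.ofReal_mul hr.1.le,
            mul_inv_cancel₀ hr.1.ne', ENNReal.ofReal_one]
    _ ≤ _ := by
        rw [setLIntegral_one, Real.volume_Ioo, sub_zero]
        exact ENNReal.ofReal_le_ofReal (hc p hp)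

theorem tube_subset_tube {ρ' : Eu m → ℝ} (h : ∀ p ∈ O, ρ p ≤ ρ' p) : tube O ρ ⊆ tube O ρ' :=
  fun _ hx => ⟨hx.1, hx.2.1, hx.2.2.trans_le (h _ hx.1)⟩

/-- The integral of a summable function over thin tubes is small. -/
theorem tendsto_setLIntegral_tube (hO : IsOpen O) (hOv : volume O ≠ ⊤) (hρ : Continuous ρ)
    {c : ℝ} (hc : ∀ p ∈ O, ρ p ≤ c) (hρ0 : ∀ p ∈ O, 0 ≤ ρ p) {f : Eu (m + 2) → ℝ≥0∞}
    (hf : ∫⁻ x in tube O ρ, f x ≠ ⊤) :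
    Tendsto (fun δ : ℝ => ∫⁻ x in tube O (fun p => δ * ρ p), f x) (𝓝[>] 0) (𝓝 0) := by
  have hvol : Tendsto (fun δ : ℝ => volume (tube O (fun p => δ * ρ p))) (𝓝[>] 0) (𝓝 0) := by
    have h1 : Tendsto (fun δ : ℝ => ENNReal.ofReal (2 * Real.pi) * ENNReal.ofReal ((δ * c) ^ 2) *
        volume O) (𝓝[>] 0) (𝓝 0) := by
      have h2 : Tendsto (fun δ : ℝ => ENNReal.ofReal ((δ * c) ^ 2)) (𝓝[>] 0) (𝓝 0) := by
        have : Tendsto (fun δ : ℝ => ENNReal.ofReal ((δ * c) ^ 2)) (𝓝 0)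
            (𝓝 (ENNReal.ofReal ((0 * c) ^ 2))) :=
          ENNReal.tendsto_ofReal (Continuous.tendsto (by fun_prop) 0)
        simpa using this.mono_left nhdsWithin_le_nhds
      have h3 := ENNReal.Tendsto.mul_const (b := volume O) (ENNReal.Tendsto.const_mul
        (a := ENNReal.ofReal (2 * Real.pi)) h2 (Or.inr ENNReal.ofReal_ne_top)) (Or.inr hOv)
      simpa using h3
    refine tendsto_of_tendsto_of_tendsto_of_le_of_le' tendsto_const_nhds h1
      (Eventually.of_forall fun _ => zero_le) ?_
    filter_upwards [self_mem_nhdsWithin] with δ hδ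
    have hδ' : 0 < δ := hδ
    exact volume_tube_le hO (by fun_prop) (fun p hp => by gcongr; exact hc p hp)
      fun p hp => mul_nonneg hδ'.le (hρ0 p hp)
  have h4 : Tendsto ((volume.restrict (tube O ρ)) ∘ fun δ : ℝ => tube O (fun p => δ * ρ p))
      (𝓝[>] 0) (𝓝 0) :=
    tendsto_of_tendsto_of_tendsto_of_le_of_le tendsto_const_nhds hvol (fun _ => zero_le)
      fun δ => Measure.restrict_apply_le _ _
  refine (tendsto_setLIntegral_zero hf h4).congr' ?_
  filter_upwards [self_mem_nhdsWithin, Ioo_mem_nhdsGT (zero_lt_one' ℝ)] with δ hδ hδ1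
  rw [Measure.restrict_restrict (isOpen_tube hO (by fun_prop)).measurableSet,
    inter_eq_left.2 (tube_subset_tube fun p hp => ?_)]
  nlinarith [hρ0 p hp, hδ1.2]

end Tube

namespace TubeData

variable {m : ℕ} {X : TubeData m} {δ : ℝ} {x : Eu (m + 2)}

theorem κ_le_bound {p : Eu m} (hp : p ∈ X.O) : X.κ p ≤ X.bound_ρ := by
  have h1 := X.κ_le p hp
  have h2 := X.ρ_le p hp
  have h3 := X.ρ_pos p hp
  linarith

theorem volume_O_ne_top : volume X.O ≠ ⊤ := X.isBounded_O.measure_lt_top.ne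

theorem lintegral_inv_norm_ne_top :
    ∫⁻ x in X.Ω, ENNReal.ofReal ‖tildePart x‖⁻¹ ≠ ⊤ := by
  refine ((lintegral_inv_norm_tube_le X.isOpen_O X.continuous_ρ X.ρ_le).trans_lt ?_).ne
  exact ENNReal.mul_lt_top (ENNReal.mul_lt_top ENNReal.ofReal_lt_top ENNReal.ofReal_lt_top)
    (lt_top_iff_ne_top.2 volume_O_ne_top)

/-- The single-valued part of the phase, restricted to rays, has the expected derivative. -/
theorem hasDerivAt_ψ_ray {p : Eu m} (hp : p ∈ X.O) (t : ℝ) {s : ℝ} (hs : 0 < s)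
    (hsρ : s < X.ρ p) :
    HasDerivAt (fun s => X.ψ (join (circlePt s t) p))
      (fderiv ℝ X.ψ (join (circlePt s t) p) (join (circlePt 1 t) 0)) s := by
  have hx : join (circlePt s t) p ∈ X.Ω := join_circlePt_mem_tube hp hs hsρ
  have hψ := ((X.smooth_ψ.contDiffAt (X.isOpen_Ω.mem_nhds hx)).differentiableAt
    (by simp)).hasFDerivAt
  have hray : HasDerivAt (fun s : ℝ => join (circlePt s t) p) (join (circlePt 1 t) 0) s := by
    have h1 : (fun s : ℝ => join (circlePt s t) p) =
        fun s : ℝ => s • join (circlePt 1 t) (0 : Eu m) + join 0 p := by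
      funext s
      ext i
      refine Fin.cases ?_ (fun i => Fin.cases ?_ (fun i => ?_) i) i <;>
        simp [join, circlePt]
    rw [h1]
    simpa using ((hasDerivAt_id s).smul_const (join (circlePt 1 t) (0 : Eu m))).add_const (join 0 p)
  exact hψ.comp_hasDerivAt s hray

theorem lintegral_abs_ψ_ne_top (hu : ∫⁻ x in X.Ω, ENNReal.ofReal ‖fderiv ℝ X.u x‖ ≠ ⊤) :
    ∫⁻ x in tube X.O X.κ, ENNReal.ofReal (|X.ψ x| * ‖tildePart x‖⁻¹) ≠ ⊤ := by
  have hκc : Continuous X.κ := X.smooth_κ.continuous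
  have hΩm : MeasurableSet X.Ω := X.isOpen_Ω.measurableSet
  have hsub : tube X.O X.κ ⊆ X.Ω := tube_subset_tube fun p hp => by
    linarith [X.κ_le p hp, X.ρ_pos p hp]
  -- the phase is measurable once it is cut off outside its domain
  have hψm : Measurable (X.Ω.indicator X.ψ) := by
    classical
    rw [← piecewise_eq_indicator]
    exact ContinuousOn.measurable_piecewise X.smooth_ψ.continuousOn continuousOn_const hΩm
  have hFm : Measurable fun x => ENNReal.ofReal (‖fderiv ℝ X.u x‖ + |(X.d : ℝ)| * ‖tildePart x‖⁻¹) :=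
    ((measurable_fderiv ℝ X.u).norm.add
      (measurable_const.mul measurable_tildePart.norm.inv)).ennreal_ofReal
  have hF : ∫⁻ x in X.Ω, ENNReal.ofReal (‖fderiv ℝ X.u x‖ + |(X.d : ℝ)| * ‖tildePart x‖⁻¹) ≠ ⊤ := by
    have h1 : ∀ x, ENNReal.ofReal (‖fderiv ℝ X.u x‖ + |(X.d : ℝ)| * ‖tildePart x‖⁻¹) =
        ENNReal.ofReal ‖fderiv ℝ X.u x‖ +
          ENNReal.ofReal |(X.d : ℝ)| * ENNReal.ofReal ‖tildePart x‖⁻¹ := fun x => by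
      rw [ENNReal.ofReal_add (by positivity) (by positivity), ENNReal.ofReal_mul (abs_nonneg _)]
    simp only [h1]
    rw [lintegral_add_left (measurable_fderiv ℝ X.u).norm.ennreal_ofReal,
      lintegral_const_mul' _ _ ENNReal.ofReal_ne_top]
    exact ENNReal.add_ne_top.2 ⟨hu, ENNReal.mul_ne_top ENNReal.ofReal_ne_top
      lintegral_inv_norm_ne_top⟩
  rw [setLIntegral_congr_fun (g := fun x => ENNReal.ofReal
    (|X.Ω.indicator X.ψ x| * ‖tildePart x‖⁻¹)) (isOpen_tube X.isOpen_O hκc.continuousOn).measurableSet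
    fun x hx => by simp only [indicator_of_mem (hsub hx)]]
  rw [lintegral_tube (f := fun x => ENNReal.ofReal (|X.Ω.indicator X.ψ x| * ‖tildePart x‖⁻¹))
    X.isOpen_O hκc (hψm.abs.mul measurable_tildePart.norm.inv).ennreal_ofReal]
  rw [lintegral_tube X.isOpen_O X.continuous_ρ hFm] at hF
  -- Hardy's inequality on every ray
  have key : ∀ p ∈ X.O, ∀ t, ∫⁻ r in Ioo 0 (X.κ p), ENNReal.ofReal r * ENNReal.ofReal
      (|X.Ω.indicator X.ψ (join (circlePt r t) p)| * ‖tildePart (join (circlePt r t) p)‖⁻¹) ≤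
      1 + ∫⁻ s in Ioo 0 (X.ρ p), ENNReal.ofReal s * ENNReal.ofReal
        (‖fderiv ℝ X.u (join (circlePt s t) p)‖ +
          |(X.d : ℝ)| * ‖tildePart (join (circlePt s t) p)‖⁻¹) := by
    intro p hp t
    have hρ := X.ρ_pos p hp
    have hκ := X.κ_le p hp
    have hcont : ContinuousOn (fun s => fderiv ℝ X.ψ (join (circlePt s t) p)
        (join (circlePt 1 t) 0)) (Ioc 0 (X.ρ p / 2)) := by
      refine ContinuousOn.clm_apply (ContinuousOn.comp (t := X.Ω)
        (X.smooth_ψ.continuousOn_fderiv_of_isOpen X.isOpen_Ω (by simp)) ?_ ?_) continuousOn_const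
      · have h1 : Continuous fun s : ℝ => (circlePt s t, p) :=
          (continuous_circlePt.comp (continuous_id.prodMk continuous_const)).prodMk
            continuous_const
        exact (continuous_join.comp h1).continuousOn
      · exact fun s hs => join_circlePt_mem_tube hp hs.1 (by linarith [hs.2])
    have hH := lintegral_abs_le_hardy hκ (fun s hs => hasDerivAt_ψ_ray hp t hs.1
      (by linarith [hs.2])) hcont
    calc _ = ∫⁻ r in Ioo 0 (X.κ p), ENNReal.ofReal |X.ψ (join (circlePt r t) p)| := by
          refine setLIntegral_congr_fun measurableSet_Ioo fun r hr => ?_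
          have hx : join (circlePt r t) p ∈ X.Ω :=
            join_circlePt_mem_tube hp hr.1 (by linarith [hr.2])
          simp only [indicator_of_mem hx, tildePart_join, norm_circlePt, abs_of_pos hr.1]
          rw [← ENNReal.ofReal_mul hr.1.le]
          congr 1
          have := hr.1.ne'
          field_simp
      _ ≤ _ := hH
      _ ≤ _ := by
          refine add_le_add ?_ ?_
          · exact ENNReal.ofReal_le_one.2 (X.κ_mul_le p hp t)
          · refine (setLIntegral_mono' measurableSet_Ioo fun s hs => ?_).trans
              (lintegral_mono_set (Ioo_subset_Ioo_right (by linarith)))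
            gcongr
            refine (abs_fderiv_ψ_le (join_circlePt_mem_tube hp hs.1 (by linarith [hs.2])) _).trans ?_
            have h1 : ‖join (circlePt 1 t) (0 : Eu m)‖ = 1 := by
              have := norm_sq_join (circlePt 1 t) (0 : Eu m)
              rw [norm_circlePt, abs_one, norm_zero] at this
              exact (sq_eq_sq₀ (norm_nonneg _) zero_le_one).1 (by linarith)
            rw [h1, mul_one]
  refine ne_top_of_le_ne_top ?_ (setLIntegral_mono' X.isOpen_O.measurableSet fun p hp =>
    lintegral_mono fun t => key p hp t)
  simp only [lintegral_add_left measurable_const, lintegral_const, Measure.restrict_apply_univ,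
    one_mul]
  refine ENNReal.add_ne_top.2 ⟨ENNReal.mul_ne_top ?_ volume_O_ne_top, hF⟩
  simp

/-- The part of the minors of the filling where the modulus varies: they are the area of the unit
disc, covered `d` times, over every point of `O`, up to a factor close to one. -/
theorem lintegral_minorBound_le (hδ : 0 < δ) :
    ∫⁻ x in tube X.O (fun p => δ * X.κ p), ENNReal.ofReal (X.minorBound δ x) ≤
      ENNReal.ofReal (Real.pi * |(X.d : ℝ)| * (1 + 2 * X.C * δ)) * volume X.O := by
  have hκc : Continuous X.κ := X.smooth_κ.continuous
  have hC := X.C_nonneg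
  have hκm : Measurable fun x : Eu (m + 2) => X.κ (hatPart x) := continuous_κ_hat.measurable
  have hq : Measurable fun x => X.q δ x :=
    measurable_tildePart.norm.div (measurable_const.mul hκm)
  have hJm : Measurable fun x => ENNReal.ofReal (X.minorBound δ x) := by
    refine Measurable.ennreal_ofReal (measurable_const.mul ?_)
    exact (((contDiff_profileMod.continuous.measurable.comp hq).mul
      ((measurable_deriv _).comp hq)).mul (measurable_const.mul hκm).inv).mul
        measurable_tildePart.norm.inv
  refine (lintegral_tube_le X.isOpen_O (by fun_prop) hJm
    (A := ENNReal.ofReal (|(X.d : ℝ)| * (1 + 2 * X.C * δ) / 2)) fun p hp t => ?_).trans ?_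
  · have hk : 0 < δ * X.κ p := mul_pos hδ (X.κ_pos p hp)
    set k := δ * X.κ p with hkdef
    set c := |(X.d : ℝ)| * (1 + 2 * X.C * δ) with hc
    have hc0 : 0 ≤ c := by positivity
    set h : ℝ → ℝ := fun r => c * (profileMod (r / k) * deriv profileMod (r / k) * k⁻¹) with hh
    have hderiv : ∀ r, HasDerivAt (fun r => c * (profileMod (r / k) ^ 2 / 2)) (h r) r := by
      intro r
      have h1 : HasDerivAt (fun r => profileMod (r / k)) (deriv profileMod (r / k) * k⁻¹) r := by
        have h2 : HasDerivAt (fun r : ℝ => r / k) k⁻¹ r := by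
          simpa using (hasDerivAt_id r).div_const k
        exact (contDiff_profileMod.differentiable (by simp) _).hasDerivAt.comp r h2
      refine (((h1.pow 2).div_const 2).const_mul c).congr_deriv ?_
      simp only [hh]
      push_cast
      ring
    have hcont : Continuous h := by
      have := contDiff_profileMod.continuous
      have := contDiff_profileMod.continuous_deriv (by simp)
      fun_prop
    have hpos : ∀ r, 0 ≤ h r := fun r => by
      have h1 := (profileMod_mem (r / k)).1
      have h2 := deriv_profileMod_nonneg (r / k)
      simp only [hh]
      positivity
    calc _ = ∫⁻ r in Ioc 0 k, ENNReal.ofReal (h r) := by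
          rw [← restrict_Ioo_eq_restrict_Ioc]
          refine setLIntegral_congr_fun measurableSet_Ioo fun r hr => ?_
          simp only [minorBound, q, tildePart_join, hatPart_join, norm_circlePt, abs_of_pos hr.1,
            ← hkdef, ← hc]
          rw [← ENNReal.ofReal_mul hr.1.le, hh]
          congr 1
          have := hr.1.ne'
          field_simp
      _ = ENNReal.ofReal (∫ r in (0 : ℝ)..k, h r) := by
          rw [intervalIntegral.integral_of_le hk.le, ofReal_integral_eq_lintegral_ofReal]
          · exact (hcont.integrableOn_Icc).mono_set Ioc_subset_Icc_self
          · exact Eventually.of_forall hpos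
      _ ≤ _ := by
          rw [intervalIntegral.integral_eq_sub_of_hasDerivAt (fun r _ => hderiv r)
            (hcont.intervalIntegrable _ _), div_self hk.ne', profileMod_of_ge (by norm_num),
            zero_div, profileMod_of_le (by norm_num)]
          refine ENNReal.ofReal_le_ofReal ?_
          linarith
  · rw [← ENNReal.ofReal_mul (by positivity)]
    refine mul_le_mul_left (ENNReal.ofReal_le_ofReal (le_of_eq ?_)) _
    ring

end TubeData

/-! ### The filled field as a Sobolev map -/

namespace TubeData

variable {m : ℕ} {X : TubeData m} {δ : ℝ} {x : Eu (m + 2)}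

/-- The punctured tube of radius `δ κ`, where the field is modified. -/
abbrev modTube (X : TubeData m) (δ : ℝ) : Set (Eu (m + 2)) := tube X.O fun p => δ * X.κ p

theorem isOpen_modTube : IsOpen (X.modTube δ) :=
  isOpen_tube X.isOpen_O (continuous_const.mul X.smooth_κ.continuous).continuousOn

theorem modTube_subset_one (hδ1 : δ ≤ 1) : X.modTube δ ⊆ tube X.O X.κ :=
  tube_subset_tube fun p _ => by nlinarith [X.κ_nonneg p]

theorem tube_κ_subset_Ω : tube X.O X.κ ⊆ X.Ω := tube_subset_tube fun p hp => by
  linarith [X.κ_le p hp, X.ρ_pos p hp]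

theorem q_le_one (hδ : 0 < δ) (hx : x ∈ X.modTube δ) : X.q δ x ≤ 1 :=
  (div_le_one (mul_pos hδ (X.κ_pos _ hx.1))).2 hx.2.2.le

theorem contDiffAt_u (hx : x ∈ X.Ω) : ContDiffAt ℝ ∞ X.u x := by
  refine ContDiffAt.congr_of_eventuallyEq ?_ (u_eventuallyEq hx)
  refine ContDiffAt.comp (g := planeIso) x planeIso.contDiff.contDiffAt ?_
  have hψ : ContDiffAt ℝ ∞ X.ψ x := X.smooth_ψ.contDiffAt (X.isOpen_Ω.mem_nhds hx)
  refine ContDiffAt.mul contDiffAt_const ?_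
  refine Complex.contDiff_exp.contDiffAt.comp x (ContDiffAt.mul ?_ contDiffAt_const)
  refine ContDiffAt.comp (g := Complex.ofRealCLM) x Complex.ofRealCLM.contDiff.contDiffAt ?_
  exact (contDiffAt_const.mul (contDiffAt_angleBranch (norm_pos_iff.1 hx.2.1))).add hψ

theorem norm_u (hx : x ∈ X.Ω) : ‖X.u x‖ = 1 := by
  rw [X.u_eq x hx, LinearIsometryEquiv.norm_map, Complex.norm_exp_ofReal_mul_I]

theorem norm_filled_le (hx : x ∈ X.Ω) : ‖X.filled δ x‖ ≤ 1 := by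
  rw [filled]
  split_ifs with h
  · exact norm_core_le δ x
  · exact (norm_u hx).le

/-- Outside the tube of radius `δ κ` the field is not modified, even infinitesimally. -/
theorem filled_eventuallyEq_u_of_le (hδ : 0 < δ) (h0 : tildePart x ≠ 0)
    (h : δ * X.κ (hatPart x) ≤ ‖tildePart x‖) (hδ1 : δ ≤ 1) : X.filled δ =ᶠ[𝓝 x] X.u := by
  rcases h.lt_or_eq with h | h
  · exact filled_eventuallyEq_u h
  · have hκ : 0 < X.κ (hatPart x) := by
      have := norm_pos_iff.2 h0
      rw [← h] at this
      exact (pos_iff_pos_of_mul_pos this).1 hδ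
    have hO : hatPart x ∈ X.O := by
      by_contra hO
      exact hκ.ne' (X.κ_eq_zero _ hO)
    have hΩ : x ∈ X.Ω := by
      refine ⟨hO, norm_pos_iff.2 h0, ?_⟩
      have := X.κ_le _ hO
      have := X.ρ_pos _ hO
      nlinarith
    have hk := mul_pos hδ hκ
    have hq : X.q δ x = 1 := by rw [q, ← h, div_self hk.ne']
    have hq' : ∀ᶠ y in 𝓝 x, 3 / 4 < X.q δ y :=
      (contDiffAt_q hδ hΩ).continuousAt.eventually (lt_mem_nhds (by rw [hq]; norm_num))
    filter_upwards [hq', X.isOpen_Ω.mem_nhds hΩ] with y hy hyΩ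
    rw [filled_eq_core hδ hyΩ, core_eq_u hyΩ hy.le]

theorem eventuallyEq_u_of_notMem (hδ : 0 < δ) (hδ1 : δ ≤ 1) (hx : x ∈ X.Ω)
    (h : x ∉ X.modTube δ) : X.filled δ =ᶠ[𝓝 x] X.u := by
  refine filled_eventuallyEq_u_of_le hδ (norm_pos_iff.1 hx.2.1) ?_ hδ1
  by_contra! hlt
  exact h ⟨hx.1, hx.2.1, hlt⟩

/-- The weight controlling the gradient of the filling. -/
def weight (X : TubeData m) (x : Eu (m + 2)) : ℝ :=
  ‖tildePart x‖⁻¹ + |X.ψ x| * ‖tildePart x‖⁻¹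

theorem exists_norm_fderiv_filled_le (X : TubeData m) : ∃ M : ℝ, 0 ≤ M ∧ ∀ δ, 0 < δ → δ ≤ 1 →
    ∀ x ∈ X.Ω, ‖fderiv ℝ (X.filled δ) x‖ ≤ ‖fderiv ℝ X.u x‖ +
      (X.modTube δ).indicator (fun x => M * X.weight x) x := by
  obtain ⟨K, hK0, hK⟩ := exists_slope_bound
  have hC := X.C_nonneg
  refine ⟨K * (1 + X.C) + 2 * |(X.d : ℝ)|, by positivity, fun δ hδ hδ1 x hx => ?_⟩
  by_cases h : x ∈ X.modTube δ
  · rw [indicator_of_mem h, (filled_eventuallyEq_core hδ hx).fderiv_eq]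
    refine (norm_fderiv_core_le hK hδ hδ1 hx (q_le_one hδ h)).trans ?_
    have h1 : 0 ≤ 2 * |(X.d : ℝ)| * (|X.ψ x| * ‖tildePart x‖⁻¹) := by positivity
    rw [weight]
    linarith
  · rw [indicator_of_notMem h, (eventuallyEq_u_of_notMem hδ hδ1 hx h).fderiv_eq, add_zero]

theorem lintegral_weight_ne_top (hu : ∫⁻ x in X.Ω, ENNReal.ofReal ‖fderiv ℝ X.u x‖ ≠ ⊤) :
    ∫⁻ x in tube X.O X.κ, ENNReal.ofReal (X.weight x) ≠ ⊤ := by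
  have h1 : ∀ x, ENNReal.ofReal (X.weight x) = ENNReal.ofReal ‖tildePart x‖⁻¹ +
      ENNReal.ofReal (|X.ψ x| * ‖tildePart x‖⁻¹) := fun x =>
    ENNReal.ofReal_add (by positivity) (by positivity)
  simp only [h1]
  rw [lintegral_add_left (f := fun x => ENNReal.ofReal ‖tildePart x‖⁻¹)
    measurable_tildePart.norm.inv.ennreal_ofReal]
  exact ENNReal.add_ne_top.2 ⟨ne_top_of_le_ne_top lintegral_inv_norm_ne_top
    (lintegral_mono_set tube_κ_subset_Ω), lintegral_abs_ψ_ne_top hu⟩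

theorem abs_minor_filled_le (hδ : 0 < δ) (hδ1 : δ ≤ 1) (hx : x ∈ X.Ω) (a b : Eu (m + 2)) :
    |fderiv ℝ (X.filled δ) x a 0 * fderiv ℝ (X.filled δ) x b 1 -
      fderiv ℝ (X.filled δ) x a 1 * fderiv ℝ (X.filled δ) x b 0| ≤
        (X.modTube δ).indicator (X.minorBound δ) x * ‖a‖ * ‖b‖ := by
  by_cases h : x ∈ X.modTube δ
  · rw [indicator_of_mem h, (filled_eventuallyEq_core hδ hx).fderiv_eq]
    exact abs_minor_core_le hδ hx a b
  · rw [indicator_of_notMem h, (eventuallyEq_u_of_notMem hδ hδ1 hx h).fderiv_eq,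
      minor_u_eq_zero hx]
    simp

theorem volume_Ω_ne_top : volume X.Ω ≠ ⊤ := by
  refine ((volume_tube_le X.isOpen_O X.continuous_ρ X.ρ_le
    fun p hp => (X.ρ_pos p hp).le).trans_lt ?_).ne
  exact ENNReal.mul_lt_top (ENNReal.mul_lt_top ENNReal.ofReal_lt_top ENNReal.ofReal_lt_top)
    (lt_top_iff_ne_top.2 volume_O_ne_top)

/-- A neighbourhood of the axis in the tube: an open set that consists, up to points of the
axis over `O`, of points of the punctured tube. -/
structure IsAxisNhd (X : TubeData m) (U : Set (Eu (m + 2))) : Prop where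
  isOpen : IsOpen U
  hat_mem : ∀ x ∈ U, hatPart x ∈ X.O
  mem_Ω : ∀ x ∈ U, tildePart x ≠ 0 → x ∈ X.Ω

variable {U : Set (Eu (m + 2))}

theorem IsAxisNhd.ae_le (hU : X.IsAxisNhd U) : U ≤ᵐ[volume] X.Ω := by
  filter_upwards [ae_tildePart_ne_zero m] with x hx hxU using hU.mem_Ω x hxU hx

theorem IsAxisNhd.ae_mem (hU : X.IsAxisNhd U) : ∀ᵐ x ∂(volume.restrict U), x ∈ X.Ω := by
  rw [ae_restrict_iff' hU.isOpen.measurableSet]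
  exact hU.ae_le

theorem IsAxisNhd.contDiffOn_filled (hU : X.IsAxisNhd U) (hδ : 0 < δ) (hδ1 : δ ≤ 1) :
    ContDiffOn ℝ ∞ (X.filled δ) U := fun x hx =>
  (contDiffAt_filled hδ hδ1 (hU.hat_mem x hx) fun h => contDiffAt_u
    (hU.mem_Ω x hx h)).contDiffWithinAt

/-- The total gradient of the filled field. -/
theorem IsAxisNhd.lintegral_fderiv_filled_le (hU : X.IsAxisNhd U) {M : ℝ} (hM0 : 0 ≤ M)
    (hM : ∀ x ∈ X.Ω, ‖fderiv ℝ (X.filled δ) x‖ ≤ ‖fderiv ℝ X.u x‖ +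
      (X.modTube δ).indicator (fun x => M * X.weight x) x) :
    ∫⁻ x in U, ENNReal.ofReal ‖fderiv ℝ (X.filled δ) x‖ ≤
      (∫⁻ x in U, ENNReal.ofReal ‖fderiv ℝ X.u x‖) +
        ENNReal.ofReal M * ∫⁻ x in X.modTube δ, ENNReal.ofReal (X.weight x) := by
  calc _ ≤ ∫⁻ x in U, (ENNReal.ofReal ‖fderiv ℝ X.u x‖ + (X.modTube δ).indicator
        (fun x => ENNReal.ofReal (M * X.weight x)) x) := by
        refine lintegral_mono_ae ?_
        filter_upwards [hU.ae_mem] with x hx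
        refine (ENNReal.ofReal_le_ofReal (hM x hx)).trans (ENNReal.ofReal_add_le.trans ?_)
        gcongr
        by_cases h : x ∈ X.modTube δ <;> simp [h]
    _ ≤ _ := by
        rw [lintegral_add_left (measurable_fderiv ℝ X.u).norm.ennreal_ofReal]
        gcongr
        refine (setLIntegral_le_lintegral _ _).trans ?_
        rw [lintegral_indicator isOpen_modTube.measurableSet,
          ← lintegral_const_mul' _ _ ENNReal.ofReal_ne_top]
        simp only [ENNReal.ofReal_mul hM0]
        exact le_rfl

theorem IsAxisNhd.memW11_filled (hU : X.IsAxisNhd U)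
    (hu : ∫⁻ x in X.Ω, ENNReal.ofReal ‖fderiv ℝ X.u x‖ ≠ ⊤) (hδ : 0 < δ) (hδ1 : δ ≤ 1) :
    MemW11 U (X.filled δ) := by
  have hc := hU.contDiffOn_filled hδ hδ1
  refine memW11_of_contDiffOn hU.isOpen hc ?_ ?_
  · refine IntegrableOn.of_bound ?_
      (hc.continuousOn.aestronglyMeasurable hU.isOpen.measurableSet) 1 ?_
    · exact (measure_mono_ae hU.ae_le).trans_lt (lt_top_iff_ne_top.2 volume_Ω_ne_top)
    · filter_upwards [hU.ae_mem] with x hx using norm_filled_le hx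
  · refine ⟨(measurable_fderiv ℝ _).aestronglyMeasurable, ?_⟩
    obtain ⟨M, hM0, hM⟩ := exists_norm_fderiv_filled_le X
    rw [hasFiniteIntegral_iff_norm]
    refine (hU.lintegral_fderiv_filled_le hM0 (hM δ hδ hδ1)).trans_lt (ENNReal.add_lt_top.2 ⟨?_, ?_⟩)
    · exact (lintegral_mono_set' hU.ae_le).trans_lt (lt_top_iff_ne_top.2 hu)
    · exact ENNReal.mul_lt_top ENNReal.ofReal_lt_top ((lintegral_mono_set
        (modTube_subset_one hδ1)).trans_lt (lt_top_iff_ne_top.2 (lintegral_weight_ne_top hu)))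

/-- The filled field has the trace of `u`: off the axis both agree near every point outside a tube
contained in `U`, so that extending the difference by zero does not create jumps. -/
theorem IsAxisNhd.eqTrace_filled (hU : X.IsAxisNhd U) (hUδ : X.modTube δ ⊆ U)
    (hu : ∫⁻ x in X.Ω, ENNReal.ofReal ‖fderiv ℝ X.u x‖ ≠ ⊤) (hδ : 0 < δ) (hδ1 : δ ≤ 1) :
    EqTrace U (X.filled δ) X.u := by
  set w := U.indicator fun x => X.filled δ x - X.u x with hw
  have hTm : MeasurableSet (X.modTube δ) := isOpen_modTube.measurableSet
  have hin : ∀ x ∈ X.modTube δ, w =ᶠ[𝓝 x] fun y => X.filled δ y - X.u y := fun x hx => by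
    filter_upwards [hU.isOpen.mem_nhds (hUδ hx)] with y hy
    rw [hw, indicator_of_mem hy]
  have hout : ∀ x, tildePart x ≠ 0 → x ∉ X.modTube δ → w =ᶠ[𝓝 x] fun _ => 0 := fun x h0 hx => by
    have hle : δ * X.κ (hatPart x) ≤ ‖tildePart x‖ := by
      by_contra! hlt
      refine hx ⟨?_, norm_pos_iff.2 h0, hlt⟩
      by_contra hO
      rw [X.κ_eq_zero _ hO, mul_zero] at hlt
      exact (norm_nonneg _).not_gt hlt
    filter_upwards [filled_eventuallyEq_u_of_le hδ h0 hle hδ1] with y hy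
    by_cases hyU : y ∈ U
    · rw [hw, indicator_of_mem hyU, hy, sub_self]
    · rw [hw, indicator_of_notMem hyU]
  have hΩ : X.modTube δ ⊆ X.Ω := (modTube_subset_one hδ1).trans tube_κ_subset_Ω
  have hdiff : ∀ x ∈ X.modTube δ, DifferentiableAt ℝ (X.filled δ) x ∧ DifferentiableAt ℝ X.u x :=
    fun x hx => ⟨(contDiffAt_filled hδ hδ1 hx.1 fun _ => contDiffAt_u (hΩ hx)).differentiableAt
      (by simp), (contDiffAt_u (hΩ hx)).differentiableAt (by simp)⟩
  have hwd : ∀ x, tildePart x ≠ 0 → DifferentiableAt ℝ w x := fun x h0 => by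
    by_cases hx : x ∈ X.modTube δ
    · exact ((hdiff x hx).1.sub (hdiff x hx).2).congr_of_eventuallyEq (hin x hx)
    · exact (differentiableAt_const _).congr_of_eventuallyEq (hout x h0 hx)
  have hwm : AEStronglyMeasurable w := by
    have hA : IsOpen {x : Eu (m + 2) | tildePart x ≠ 0} := isOpen_ne.preimage continuous_tildePart
    have h1 : AEStronglyMeasurable w (volume.restrict {x : Eu (m + 2) | tildePart x ≠ 0}) :=
      ContinuousOn.aestronglyMeasurable
        (fun x hx => (hwd x hx).continuousAt.continuousWithinAt) hA.measurableSet
    rwa [Measure.restrict_eq_self_of_ae_mem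
      (s := {x : Eu (m + 2) | tildePart x ≠ 0}) (ae_tildePart_ne_zero m)] at h1
  have hwb : ∀ x, tildePart x ≠ 0 → ‖w x‖ ≤ (X.modTube δ).indicator (fun _ => 2) x := fun x h0 => by
    by_cases hx : x ∈ X.modTube δ
    · rw [indicator_of_mem hx, (hin x hx).eq_of_nhds]
      refine (norm_sub_le _ _).trans ?_
      have h1 := norm_filled_le (δ := δ) (hΩ hx)
      have h2 := norm_u (hΩ hx)
      linarith
    · rw [indicator_of_notMem hx, (hout x h0 hx).eq_of_nhds, norm_zero]
  obtain ⟨M, hM0, hM⟩ := exists_norm_fderiv_filled_le X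
  have hwf : ∀ x, tildePart x ≠ 0 → ‖fderiv ℝ w x‖ₑ ≤ (X.modTube δ).indicator
      (fun x => 2 * ENNReal.ofReal ‖fderiv ℝ X.u x‖ +
        ENNReal.ofReal M * ENNReal.ofReal (X.weight x)) x := fun x h0 => by
    by_cases hx : x ∈ X.modTube δ
    · rw [indicator_of_mem hx, (hin x hx).fderiv_eq,
        fderiv_fun_sub (hdiff x hx).1 (hdiff x hx).2, ← ofReal_norm]
      have h1 := hM δ hδ hδ1 x (hΩ hx)
      rw [indicator_of_mem hx] at h1
      have h2 : ‖fderiv ℝ (X.filled δ) x - fderiv ℝ X.u x‖ ≤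
          2 * ‖fderiv ℝ X.u x‖ + M * X.weight x := by
        refine (norm_sub_le _ _).trans ?_
        linarith
      refine (ENNReal.ofReal_le_ofReal h2).trans (ENNReal.ofReal_add_le.trans (le_of_eq ?_))
      rw [ENNReal.ofReal_mul zero_le_two, ENNReal.ofReal_mul hM0, ENNReal.ofReal_ofNat]
    · rw [indicator_of_notMem hx, (hout x h0 hx).fderiv_eq, fderiv_fun_const, Pi.zero_apply,
        ← ofReal_norm, norm_zero, ENNReal.ofReal_zero]
  have hinv : ∫⁻ x in X.modTube δ, ENNReal.ofReal ‖tildePart x‖⁻¹ < ⊤ :=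
    (lintegral_mono_set hΩ).trans_lt (lt_top_iff_ne_top.2 lintegral_inv_norm_ne_top)
  refine memW11_univ_of_differentiableAt hwd ⟨hwm, ?_⟩ ⟨?_, ?_⟩ ⟨?_, ?_⟩
  · rw [hasFiniteIntegral_iff_norm]
    calc _ ≤ ∫⁻ x, (X.modTube δ).indicator (fun _ => 2) x := by
          refine lintegral_mono_ae ?_
          filter_upwards [ae_tildePart_ne_zero m] with x hx
          refine (ENNReal.ofReal_le_ofReal (hwb x hx)).trans ?_
          by_cases h : x ∈ X.modTube δ <;> simp [h]
      _ < ⊤ := by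
          rw [lintegral_indicator hTm, setLIntegral_const]
          exact ENNReal.mul_lt_top (by simp) ((measure_mono hΩ).trans_lt
            (lt_top_iff_ne_top.2 volume_Ω_ne_top))
  · exact measurable_tildePart.norm.inv.aestronglyMeasurable.mul hwm.norm
  · rw [hasFiniteIntegral_iff_norm]
    calc _ ≤ ∫⁻ x, (X.modTube δ).indicator (fun x => 2 * ENNReal.ofReal ‖tildePart x‖⁻¹) x := by
          refine lintegral_mono_ae ?_
          filter_upwards [ae_tildePart_ne_zero m] with x hx
          have h1 := hwb x hx
          rw [norm_mul, norm_inv, norm_norm, norm_norm, mul_comm,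
            ENNReal.ofReal_mul (norm_nonneg _)]
          by_cases h : x ∈ X.modTube δ
          · rw [indicator_of_mem h] at h1 ⊢
            gcongr
            exact (ENNReal.ofReal_le_ofReal h1).trans (by simp)
          · rw [indicator_of_notMem h] at h1 ⊢
            rw [le_antisymm h1 (norm_nonneg _), ENNReal.ofReal_zero, zero_mul]
      _ < ⊤ := by
          rw [lintegral_indicator hTm, lintegral_const_mul' _ _ (by simp)]
          exact ENNReal.mul_lt_top (by simp) hinv
  · exact (measurable_fderiv ℝ w).aestronglyMeasurable
  · calc _ ≤ ∫⁻ x, (X.modTube δ).indicator (fun x => 2 * ENNReal.ofReal ‖fderiv ℝ X.u x‖ +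
          ENNReal.ofReal M * ENNReal.ofReal (X.weight x)) x := by
          refine lintegral_mono_ae ?_
          filter_upwards [ae_tildePart_ne_zero m] with x hx using hwf x hx
      _ < ⊤ := by
          rw [lintegral_indicator hTm, lintegral_add_left
            ((measurable_fderiv ℝ X.u).norm.ennreal_ofReal.const_mul 2),
            lintegral_const_mul' _ _ (by simp), lintegral_const_mul' _ _ ENNReal.ofReal_ne_top]
          refine ENNReal.add_lt_top.2 ⟨ENNReal.mul_lt_top (by simp) ?_,
            ENNReal.mul_lt_top ENNReal.ofReal_lt_top ?_⟩
          · exact (lintegral_mono_set hΩ).trans_lt (lt_top_iff_ne_top.2 hu)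
          · exact (lintegral_mono_set (modTube_subset_one hδ1)).trans_lt
              (lt_top_iff_ne_top.2 (lintegral_weight_ne_top hu))

/-- The mass of the graph of the filled field: the modification contributes `|d|` times the area of
the unit disc over every point of `O`, and a term that vanishes with `δ`. -/
theorem exists_graphMass_filled_le (X : TubeData m)
    (hu : ∫⁻ x in X.Ω, ENNReal.ofReal ‖fderiv ℝ X.u x‖ ≠ ⊤) :
    ∃ E : ℝ → ℝ≥0∞, Tendsto E (𝓝[>] 0) (𝓝 0) ∧ ∀ δ, 0 < δ → δ ≤ 1 → ∀ U, X.IsAxisNhd U →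
      graphMass U (X.filled δ) ≤ ENNReal.ofReal (Real.pi * |(X.d : ℝ)|) * volume X.O +
        (volume U + 2 * ∫⁻ x in U, ENNReal.ofReal ‖fderiv ℝ X.u x‖) + E δ := by
  obtain ⟨M, hM0, hM⟩ := exists_norm_fderiv_filled_le X
  have hC := X.C_nonneg
  have hπ := Real.pi_pos
  refine ⟨fun δ => 2 * (ENNReal.ofReal M * ∫⁻ x in X.modTube δ, ENNReal.ofReal (X.weight x)) +
    ENNReal.ofReal (Real.pi * |(X.d : ℝ)| * (2 * X.C * δ)) * volume X.O, ?_, ?_⟩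
  · have h1 := tendsto_setLIntegral_tube X.isOpen_O volume_O_ne_top X.smooth_κ.continuous
      (fun p hp => κ_le_bound hp) (fun p _ => X.κ_nonneg p) (lintegral_weight_ne_top hu)
    have h2 : Tendsto (fun δ => ENNReal.ofReal (Real.pi * |(X.d : ℝ)| * (2 * X.C * δ))) (𝓝[>] 0)
        (𝓝 0) := by
      have : Tendsto (fun δ => ENNReal.ofReal (Real.pi * |(X.d : ℝ)| * (2 * X.C * δ))) (𝓝 0)
          (𝓝 (ENNReal.ofReal (Real.pi * |(X.d : ℝ)| * (2 * X.C * 0)))) :=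
        ENNReal.tendsto_ofReal (Continuous.tendsto (by fun_prop) 0)
      simpa using this.mono_left nhdsWithin_le_nhds
    have h3 := (ENNReal.Tendsto.const_mul (a := 2) (ENNReal.Tendsto.const_mul
      (a := ENNReal.ofReal M) h1 (Or.inr ENNReal.ofReal_ne_top)) (Or.inr (by simp))).add
      (ENNReal.Tendsto.mul_const (b := volume X.O) h2 (Or.inr volume_O_ne_top))
    simpa using h3
  · intro δ hδ hδ1 U hU
    have hJ0 : ∀ x, 0 ≤ (X.modTube δ).indicator (X.minorBound δ) x := fun x =>
      indicator_nonneg (fun x _ => minorBound_nonneg hδ x) x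
    refine (graphMass_le hU.isOpen.measurableSet (fun x _ => hJ0 x)
      (hU.ae_mem.mono fun x hx => abs_minor_filled_le hδ hδ1 hx)).trans ?_
    have hgm : Measurable fun x => ENNReal.ofReal ‖fderiv ℝ (X.filled δ) x‖ :=
      (measurable_fderiv ℝ _).norm.ennreal_ofReal
    have hsplit : ∀ x, ENNReal.ofReal (1 + 2 * ‖fderiv ℝ (X.filled δ) x‖ +
        (X.modTube δ).indicator (X.minorBound δ) x) = 1 +
          (2 * ENNReal.ofReal ‖fderiv ℝ (X.filled δ) x‖ +
            (X.modTube δ).indicator (fun x => ENNReal.ofReal (X.minorBound δ x)) x) := fun x => by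
      rw [ENNReal.ofReal_add (by positivity) (hJ0 x), ENNReal.ofReal_add (by positivity)
        (by positivity), ENNReal.ofReal_one, ENNReal.ofReal_mul zero_le_two, ENNReal.ofReal_ofNat,
        add_assoc]
      congr 2
      by_cases h : x ∈ X.modTube δ <;> simp [h]
    simp only [hsplit]
    rw [lintegral_add_left measurable_const, lintegral_add_left (hgm.const_mul 2),
      lintegral_const_mul' _ _ (by simp), setLIntegral_one]
    have h1 := hU.lintegral_fderiv_filled_le hM0 (hM δ hδ hδ1)
    have h2 : ∫⁻ x in U, (X.modTube δ).indicator (fun x => ENNReal.ofReal (X.minorBound δ x)) x ≤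
        ENNReal.ofReal (Real.pi * |(X.d : ℝ)|) * volume X.O +
          ENNReal.ofReal (Real.pi * |(X.d : ℝ)| * (2 * X.C * δ)) * volume X.O := by
      refine (setLIntegral_le_lintegral _ _).trans ?_
      rw [lintegral_indicator isOpen_modTube.measurableSet]
      refine (lintegral_minorBound_le hδ).trans (le_of_eq ?_)
      rw [← add_mul, ← ENNReal.ofReal_add (by positivity) (by positivity)]
      congr 2
      ring
    calc _ ≤ volume U + (2 * ((∫⁻ x in U, ENNReal.ofReal ‖fderiv ℝ X.u x‖) +
          ENNReal.ofReal M * ∫⁻ x in X.modTube δ, ENNReal.ofReal (X.weight x)) +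
            (ENNReal.ofReal (Real.pi * |(X.d : ℝ)|) * volume X.O +
          ENNReal.ofReal (Real.pi * |(X.d : ℝ)| * (2 * X.C * δ)) * volume X.O)) := by gcongr
      _ = _ := by ring

end TubeData

/-! ### Existence of the filling data -/

theorem circlePt_eq_smul (r t : ℝ) : circlePt r t = r • circlePt 1 t := by
  ext i
  fin_cases i <;> simp [circlePt]

/-- A continuous function on the punctured tube is bounded on the circles of half the radius of the
tube, locally uniformly in the centre. -/
theorem exists_bound_on_circles {m : ℕ} {O : Set (Eu m)} {ρ : Eu m → ℝ}
    (hρ : Continuous ρ) (hρ0 : ∀ p ∈ O, 0 < ρ p) {ψ : Eu (m + 2) → ℝ}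
    (hψ : ContinuousOn ψ (tube O ρ)) :
    ∃ A : Eu m → ℝ, ContinuousOn A O ∧ ∀ p ∈ O, ∀ t, |ψ (join (circlePt (ρ p / 2) t) p)| ≤ A p := by
  classical
  let f : O → Metric.sphere (0 : Eu 2) 1 → ℝ := fun p a => |ψ (join ((ρ p / 2) • (a : Eu 2)) p)|
  have hf : Continuous ↿f := by
    have h1 : Continuous fun q : O × Metric.sphere (0 : Eu 2) 1 =>
        join ((ρ q.1 / 2) • (q.2 : Eu 2)) (q.1 : Eu m) := by
      have h2 : Continuous fun q : O × Metric.sphere (0 : Eu 2) 1 =>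
          ((ρ q.1 / 2) • (q.2 : Eu 2), (q.1 : Eu m)) := by fun_prop
      exact continuous_join.comp h2
    refine Continuous.abs (hψ.comp_continuous h1 fun q => ?_)
    have hq := hρ0 q.1 q.1.2
    have ha : ‖(q.2 : Eu 2)‖ = 1 := by simp
    refine ⟨by rw [hatPart_join]; exact q.1.2, ?_, ?_⟩ <;>
      rw [tildePart_join, norm_smul, ha, Real.norm_of_nonneg (by positivity)]
    · positivity
    · rw [hatPart_join]
      linarith
  have hA : Continuous fun p : O => sSup (f p '' univ) := isCompact_univ.continuous_sSup hf
  refine ⟨fun p => if h : p ∈ O then sSup (f ⟨p, h⟩ '' univ) else 0, ?_, fun p hp t => ?_⟩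
  · rw [continuousOn_iff_continuous_domRestrict]
    convert hA using 1
    funext p
    simp [p.2]
  · simp only [dif_pos hp]
    have hbdd : BddAbove (f ⟨p, hp⟩ '' univ) :=
      (isCompact_univ.image (hf.comp (Continuous.prodMk_right _))).bddAbove
    have ha : circlePt 1 t ∈ Metric.sphere (0 : Eu 2) 1 := by simp [norm_circlePt]
    rw [circlePt_eq_smul]
    exact le_csSup hbdd ⟨⟨circlePt 1 t, ha⟩, mem_univ _, rfl⟩

theorem exists_tubeData {m : ℕ} {O : Set (Eu m)} (hOo : IsOpen O) (hOc : Convex ℝ O)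
    (hOb : Bornology.IsBounded O) {ρ : Eu m → ℝ} (hρ : Continuous ρ) (hρ0 : ∀ p ∈ O, 0 < ρ p)
    {b : ℝ} (hb : ∀ p ∈ O, ρ p ≤ b) {u : Eu (m + 2) → Eu 2} (hu : ContDiffOn ℝ ∞ u (tube O ρ))
    (hu1 : ∀ x ∈ tube O ρ, ‖u x‖ = 1) {d : ℤ} {p₀ : Eu m} (hp₀ : p₀ ∈ O)
    (hd : HasDegreeAround u p₀ d) :
    ∃ X : TubeData m, X.O = O ∧ X.ρ = ρ ∧ X.u = u ∧ X.d = d := by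
  obtain ⟨ψ, hψ, hψu⟩ := exists_phase hOo hOc hρ.continuousOn hρ0 hu hu1 hp₀ hd
  obtain ⟨A, hA, hψA⟩ := exists_bound_on_circles hρ hρ0 hψ.continuousOn
  have hA0 : ∀ p ∈ O, 0 ≤ A p := fun p hp => (abs_nonneg _).trans (hψA p hp 0)
  -- `κ ≤ ρ / 2` and `κ |ψ| ≤ κ A ≤ 1` on the circles of radius `ρ / 2`
  set a : Eu m → ℝ := fun p => min (ρ p / 2) (1 + A p)⁻¹ with ha
  have ha0 : ∀ p ∈ O, 0 < a p := fun p hp => by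
    have h1 := hρ0 p hp
    have h2 := hA0 p hp
    exact lt_min (by positivity) (by positivity)
  have ha1 : ∀ p ∈ O, a p ≤ 1 := fun p hp =>
    (min_le_right _ _).trans (inv_le_one_of_one_le₀ (by linarith [hA0 p hp]))
  have hac : ContinuousOn a O := ContinuousOn.inf (hρ.div_const 2).continuousOn
    ((continuousOn_const.add hA).inv₀ fun p hp =>
      (add_pos_of_pos_of_nonneg one_pos (hA0 p hp)).ne')
  have hV : IsOpen {q : Eu m × ℝ | q.1 ∈ O ∧ 0 < q.2 ∧ q.2 < a q.1} := by
    have h1 : ContinuousOn (fun q : Eu m × ℝ => (q.2, a q.1 - q.2)) (Prod.fst ⁻¹' O) :=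
      continuousOn_snd.prodMk
        ((hac.comp continuousOn_fst fun q hq => hq).sub continuousOn_snd)
    convert h1.isOpen_inter_preimage (hOo.preimage continuous_fst)
      ((isOpen_Ioi (a := (0 : ℝ))).prod (isOpen_Ioi (a := (0 : ℝ))))
      using 1
    ext q
    simp
  obtain ⟨κ, hκ, hκs, hκ0, hκO, hκa⟩ := exists_smooth_pos_le hOb hV ha0 ha1
  obtain ⟨C, hC⟩ := (hκ.continuous_fderiv (by simp)).bounded_above_of_compact_support
    (hκs.fderiv (𝕜 := ℝ))
  exact ⟨{
    O := O
    ρ := ρ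
    u := u
    d := d
    ψ := ψ
    κ := κ
    C := C
    isOpen_O := hOo
    isBounded_O := hOb
    continuous_ρ := hρ
    bound_ρ := b
    ρ_le := hb
    ρ_pos := hρ0
    smooth_ψ := hψ
    u_eq := hψu
    smooth_κ := hκ
    κ_nonneg := hκ0
    κ_eq_zero := hκO
    κ_pos := fun p hp => (hκa p hp).1
    κ_le := fun p hp => (hκa p hp).2.trans (min_le_left _ _)
    κ_mul_le := fun p hp t => by
      have h1 := (hκa p hp).2.trans (min_le_right _ _)
      have h2 := hA0 p hp
      calc _ ≤ (1 + A p)⁻¹ * (1 + A p) := by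
            have := hψA p hp t
            gcongr
            linarith
        _ = 1 := inv_mul_cancel₀ (by positivity)
    C_nonneg := (norm_nonneg _).trans (hC 0)
    norm_fderiv_κ_le := hC }, rfl, rfl, rfl, rfl⟩

/-! ### Cones over simplices -/

section Cone

variable {m : ℕ} {S : Affine.Simplex ℝ (Eu m) m} {ε : ℝ} {x : Eu (m + 2)}

theorem exists_infDist_le (hm : 1 ≤ m) (S : Affine.Simplex ℝ (Eu m) m) :
    ∃ b : ℝ, 0 ≤ b ∧ ∀ p ∈ S.interior, Metric.infDist p (simplexBdry S) ≤ b := by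
  obtain ⟨q, hq⟩ := nonempty_simplexBdry S hm
  exact ⟨Metric.diam S.closedInterior, Metric.diam_nonneg, fun p hp =>
    (Metric.infDist_le_dist_of_mem hq).trans (Metric.dist_le_diam_of_mem
      S.isCompact_closedInterior.isBounded (S.interior_subset_closedInterior hp) hq.1)⟩

theorem continuous_infDist_hat (S : Affine.Simplex ℝ (Eu m) m) :
    Continuous fun x : Eu (m + 2) => Metric.infDist (hatPart x) (simplexBdry S) :=
  (Metric.continuous_infDist_pt _).comp continuous_hatPart

theorem isClosed_coneNhd (S : Affine.Simplex ℝ (Eu m) m) (ε : ℝ) : IsClosed (coneNhd S ε) :=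
  (S.isClosed_closedInterior.preimage continuous_hatPart).inter
    (isClosed_le continuous_tildePart.norm (continuous_const.mul (continuous_infDist_hat S)))

theorem coneNhd_mono {ε' : ℝ} (h : ε ≤ ε') : coneNhd S ε ⊆ coneNhd S ε' := fun _ hx =>
  ⟨hx.1, hx.2.trans (mul_le_mul_of_nonneg_right h Metric.infDist_nonneg)⟩

theorem mem_interior_coneNhd (hm : 1 ≤ m) (hx : hatPart x ∈ S.interior)
    (h : ‖tildePart x‖ < ε * Metric.infDist (hatPart x) (simplexBdry S)) :
    x ∈ interior (coneNhd S ε) := by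
  have hopen : IsOpen (hatPart ⁻¹' S.interior ∩
      {x : Eu (m + 2) | ‖tildePart x‖ < ε * Metric.infDist (hatPart x) (simplexBdry S)}) :=
    ((isOpen_simplexInterior S hm).preimage continuous_hatPart).inter
      (isOpen_lt continuous_tildePart.norm (continuous_const.mul (continuous_infDist_hat S)))
  refine mem_interior.2 ⟨_, fun y hy => ?_, hopen, hx, h⟩
  exact ⟨S.interior_subset_closedInterior hy.1, le_of_lt hy.2⟩

theorem hatPart_mem_of_mem_interior_coneNhd (hx : x ∈ interior (coneNhd S ε)) :
    hatPart x ∈ S.interior := by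
  by_contra hp
  have hbd : hatPart x ∈ simplexBdry S := ⟨(interior_subset hx).1, hp⟩
  -- the slice of the cone over a boundary point is a single point, which is not open
  have h1 : Continuous fun s : ℝ => x + join (circlePt s 0) 0 := by
    have h2 : Continuous fun s : ℝ => (circlePt s 0, (0 : Eu m)) :=
      (continuous_circlePt.comp (continuous_id.prodMk continuous_const)).prodMk continuous_const
    exact continuous_const.add (continuous_join.comp h2)
  have htilde : ∀ s : ℝ, tildePart (x + join (circlePt s 0) 0) = tildePart x + circlePt s 0 := by
    intro s
    have := map_add (tildeL m) x (join (circlePt s 0) 0)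
    simpa [tildePart_join] using this
  have hhat : ∀ s : ℝ, hatPart (x + join (circlePt s 0) 0) = hatPart x := by
    intro s
    have := map_add (hatL m) x (join (circlePt s 0) 0)
    simpa [hatPart_join] using this
  have hzero : ∀ y ∈ coneNhd S ε, hatPart y = hatPart x → tildePart y = 0 := fun y hy hyx => by
    have h3 := hy.2
    rw [hyx, Metric.infDist_zero_of_mem hbd, mul_zero] at h3
    exact norm_le_zero_iff.1 h3
  have h0 : x + join (circlePt 0 0) 0 = x := by
    have : (join (circlePt 0 0) 0 : Eu (m + 2)) = 0 := by
      have h5 := norm_sq_join (circlePt 0 0) (0 : Eu m)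
      rw [norm_circlePt] at h5
      simpa using h5
    rw [this, add_zero]
  have hev : ∀ᶠ s in 𝓝 (0 : ℝ), x + join (circlePt s 0) 0 ∈ interior (coneNhd S ε) :=
    h1.continuousAt.eventually (isOpen_interior.mem_nhds (by simpa only [h0] using hx))
  obtain ⟨s, hs, hs0⟩ := ((hev.filter_mono nhdsWithin_le_nhds).and
    (self_mem_nhdsWithin : Ioi (0 : ℝ) ∈ 𝓝[>] 0)).exists
  have h4 := hzero _ (interior_subset hs) (hhat s)
  rw [htilde, hzero x (interior_subset hx) rfl, zero_add, ← norm_eq_zero, norm_circlePt,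
    abs_eq_zero] at h4
  exact (ne_of_gt hs0) h4

theorem hatPart_mem_of_tildePart_ne_zero (hx : x ∈ coneNhd S ε) (h0 : tildePart x ≠ 0) :
    hatPart x ∈ S.interior :=
  mem_interior_of_mem_coneNhd ⟨hx, fun h => h0 h.1⟩

/-- Away from the axis a cone is contained in any larger open tube. -/
theorem mem_tube_of_mem_coneNhd (hm : 1 ≤ m) {ε' : ℝ} (h : ε < ε') (hx : x ∈ coneNhd S ε)
    (h0 : tildePart x ≠ 0) :
    x ∈ tube S.interior fun p => ε' * Metric.infDist p (simplexBdry S) := by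
  have hp := hatPart_mem_of_tildePart_ne_zero hx h0
  exact ⟨hp, norm_pos_iff.2 h0, hx.2.trans_lt 
    (mul_lt_mul_of_pos_right h (infDist_bdry_pos S hm hp))⟩

theorem tube_subset_coneNhd {ε' : ℝ} :
    tube S.interior (fun p => ε' * Metric.infDist p (simplexBdry S)) ⊆
      coneNhd S ε' \ flat (simplexBdry S) := fun _ hx =>
  ⟨⟨S.interior_subset_closedInterior hx.1, hx.2.2.le⟩, fun h => (norm_pos_iff.1 hx.2.1) h.1⟩

theorem coneNhd_ae_le_tube (hm : 1 ≤ m) {ε' : ℝ} (h : ε < ε') : coneNhd S ε ≤ᵐ[volume]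
    tube S.interior fun p => ε' * Metric.infDist p (simplexBdry S) := by
  filter_upwards [ae_tildePart_ne_zero m] with x h0 hx using mem_tube_of_mem_coneNhd hm h hx h0

end Cone

/-! ### Filling the cones -/

section Cone

variable {m : ℕ} {S : Affine.Simplex ℝ (Eu m) m}

theorem norm_eq_one_of_ae {n : ℕ} {U : Set (Eu n)} (hU : IsOpen U) {u : Eu n → Eu 2}
    (hu : ContinuousOn u U) (h : ∀ᵐ x ∂(volume.restrict U), ‖u x‖ = 1) :
    ∀ x ∈ U, ‖u x‖ = 1 :=
  Measure.eqOn_open_of_ae_eq (f := fun x => ‖u x‖) (g := fun _ => 1) h hU hu.norm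
    continuousOn_const

/-- The cones shrink to the null set `{0} × Δ'`, so that the integrals of a summable gradient over
them tend to zero. -/
theorem tendsto_setIntegral_coneNhd (hm : 1 ≤ m) {f : Eu (m + 2) → ℝ} (hf0 : ∀ x, 0 ≤ f x)
    (hfm : Measurable f) {ε₁ : ℝ} (hε₁ : 0 < ε₁)
    (hf : ∫⁻ x in tube S.interior (fun p => ε₁ * Metric.infDist p (simplexBdry S)),
      ENNReal.ofReal (f x) ≠ ⊤) :
    Tendsto (fun ε => ∫ x in coneNhd S ε, f x) (𝓝[>] 0) (𝓝 0) := by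
  obtain ⟨b, hb0, hb⟩ := exists_infDist_le hm S
  have hcont : Continuous fun p => ε₁ * Metric.infDist p (simplexBdry S) :=
    continuous_const.mul (Metric.continuous_infDist_pt _)
  have hbdd : Bornology.IsBounded S.interior :=
    S.isCompact_closedInterior.isBounded.subset S.interior_subset_closedInterior
  have h1 := tendsto_setLIntegral_tube (isOpen_simplexInterior S hm) hbdd.measure_lt_top.ne
    hcont (c := ε₁ * b) (fun p hp => mul_le_mul_of_nonneg_left (hb p hp) hε₁.le)
    (fun p _ => mul_nonneg hε₁.le Metric.infDist_nonneg) hf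
  have h2 : Tendsto (fun ε : ℝ => 2 / ε₁ * ε) (𝓝[>] 0) (𝓝[>] 0) := by
    refine tendsto_nhdsWithin_iff.2 ⟨?_, ?_⟩
    · have : Tendsto (fun ε : ℝ => 2 / ε₁ * ε) (𝓝 0) (𝓝 (2 / ε₁ * 0)) :=
        Continuous.tendsto (by fun_prop) 0
      simpa using this.mono_left nhdsWithin_le_nhds
    · filter_upwards [self_mem_nhdsWithin] with ε hε
      have hε' : 0 < ε := hε
      exact mem_Ioi.2 (by positivity)
  have h3 : Tendsto (fun ε => ∫⁻ x in coneNhd S ε, ENNReal.ofReal (f x)) (𝓝[>] 0) (𝓝 0) := by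
    refine tendsto_of_tendsto_of_tendsto_of_le_of_le' tendsto_const_nhds (h1.comp h2)
      (Eventually.of_forall fun _ => zero_le) ?_
    filter_upwards [self_mem_nhdsWithin] with ε hε
    have hε' : 0 < ε := hε
    have h4 : (fun p => 2 / ε₁ * ε * (ε₁ * Metric.infDist p (simplexBdry S))) =
        fun p => 2 * ε * Metric.infDist p (simplexBdry S) := by
      funext p
      field_simp
    simp only [Function.comp_apply, h4]
    exact lintegral_mono_set' (coneNhd_ae_le_tube hm (by linarith))
  have h5 : ∀ ε, ∫ x in coneNhd S ε, f x = (∫⁻ x in coneNhd S ε, ENNReal.ofReal (f x)).toReal :=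
    fun ε => integral_eq_lintegral_of_nonneg_ae (Eventually.of_forall hf0)
      hfm.aestronglyMeasurable
  simp only [h5]
  have h6 := (ENNReal.tendsto_toReal ENNReal.zero_ne_top).comp h3
  rwa [ENNReal.toReal_zero] at h6

/-- The volume of the cones is of second order. -/
theorem exists_volume_coneNhd_le (hm : 1 ≤ m) (S : Affine.Simplex ℝ (Eu m) m) :
    ∃ K : ℝ, 0 ≤ K ∧ ∀ ε, 0 < ε → volume (coneNhd S ε) ≤ ENNReal.ofReal (K * ε ^ 2) := by
  obtain ⟨b, hb0, hb⟩ := exists_infDist_le hm S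
  have hbdd : Bornology.IsBounded S.interior :=
    S.isCompact_closedInterior.isBounded.subset S.interior_subset_closedInterior
  have hπ := Real.pi_pos
  refine ⟨2 * Real.pi * (2 * b) ^ 2 * (volume S.interior).toReal, by positivity, fun ε hε => ?_⟩
  refine (measure_mono_ae (coneNhd_ae_le_tube hm (by linarith : ε < 2 * ε))).trans ?_
  refine (volume_tube_le (isOpen_simplexInterior S hm)
    (continuous_const.mul (Metric.continuous_infDist_pt _)) (c := 2 * ε * b)
    (fun p hp => mul_le_mul_of_nonneg_left (hb p hp) (by linarith))
    (fun p _ => mul_nonneg (by linarith) Metric.infDist_nonneg)).trans (le_of_eq ?_)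
  rw [← ENNReal.ofReal_toReal hbdd.measure_lt_top.ne, ← ENNReal.ofReal_mul (by positivity),
    ← ENNReal.ofReal_mul (by positivity), ENNReal.toReal_ofReal ENNReal.toReal_nonneg]
  congr 1
  ring

theorem isAxisNhd_interior_coneNhd (hm : 1 ≤ m) {X : TubeData m} {ε ε' : ℝ} (h : ε < ε')
    (hO : X.O = S.interior) (hρ : X.ρ = fun p => ε' * Metric.infDist p (simplexBdry S)) :
    X.IsAxisNhd (interior (coneNhd S ε)) where
  isOpen := isOpen_interior
  hat_mem x hx := hO ▸ hatPart_mem_of_mem_interior_coneNhd hx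
  mem_Ω x hx h0 := by
    rw [TubeData.Ω, hO, hρ]
    exact mem_tube_of_mem_coneNhd hm h (interior_subset hx) h0

/-- The competitors on the cones for a unit field on an open tube with a summable gradient. -/
theorem exists_filling_of_cones (hm : 1 ≤ m) (S : Affine.Simplex ℝ (Eu m) m) {ε₁ : ℝ}
    (hε₁ : 0 < ε₁) (hε₁1 : ε₁ ≤ 1) {u : Eu (m + 2) → Eu 2} {d : ℤ}
    (hs : ContDiffOn ℝ ∞ u (tube S.interior fun p => ε₁ * Metric.infDist p (simplexBdry S)))
    (hu1 : ∀ x ∈ tube S.interior (fun p => ε₁ * Metric.infDist p (simplexBdry S)), ‖u x‖ = 1)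
    (hi : IntegrableOn (fderiv ℝ u)
      (tube S.interior fun p => ε₁ * Metric.infDist p (simplexBdry S)))
    {p₀ : Eu m} (hp₀ : p₀ ∈ S.interior) (hd : HasDegreeAround u p₀ d) :
    ∃ R : ℝ → ℝ, Tendsto R (𝓝[>] 0) (𝓝 0) ∧
      ((fun ε : ℝ => ∫ x in coneNhd S ε, ‖fderiv ℝ u x‖) =O[𝓝[>] 0] (fun ε : ℝ => ε) →
        R =O[𝓝[>] 0] (fun ε : ℝ => ε)) ∧
      ∀ ε ∈ Ioo 0 ε₁, ∃ v : Eu (m + 2) → Eu 2,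
        ContDiffOn ℝ ∞ v (coneNhd S ε \ flat (simplexBdry S)) ∧
        MemW11 (interior (coneNhd S ε)) v ∧ EqTrace (interior (coneNhd S ε)) v u ∧
        (∀ x ∈ frontier (coneNhd S ε) \ flat (simplexBdry S), v x = u x) ∧
        graphMass (interior (coneNhd S ε)) v ≤
          ENNReal.ofReal (Real.pi * |(d : ℝ)|) *
            Measure.euclideanHausdorffMeasure m (flat S.closedInterior) +
          ENNReal.ofReal (R ε) := by
  obtain ⟨b, hb0, hb⟩ := exists_infDist_le hm S
  obtain ⟨K, hK0, hK⟩ := exists_volume_coneNhd_le hm S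
  set ρ : Eu m → ℝ := fun p => ε₁ * Metric.infDist p (simplexBdry S) with hρ
  obtain ⟨X, hXO, hXρ, hXu, hXd⟩ := exists_tubeData (isOpen_simplexInterior S hm)
    (convex_simplexInterior S hm)
    (S.isCompact_closedInterior.isBounded.subset S.interior_subset_closedInterior)
    (ρ := ρ) (continuous_const.mul (Metric.continuous_infDist_pt _))
    (fun p hp => mul_pos hε₁ (infDist_bdry_pos S hm hp))
    (fun p hp => mul_le_mul_of_nonneg_left (hb p hp) hε₁.le) hs hu1 hp₀ hd
  have hΩ : X.Ω = tube S.interior ρ := by rw [TubeData.Ω, hXO, hXρ]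
  have hifin : ∫⁻ x in tube S.interior ρ, ENNReal.ofReal ‖fderiv ℝ u x‖ ≠ ⊤ := by
    have := hi.2
    rw [hasFiniteIntegral_iff_norm] at this
    exact this.ne
  have hXfin : ∫⁻ x in X.Ω, ENNReal.ofReal ‖fderiv ℝ X.u x‖ ≠ ⊤ := by rwa [hΩ, hXu]
  obtain ⟨E, hE, hmass⟩ := X.exists_graphMass_filled_le hXfin
  have hcone0 : ∀ ε, 0 ≤ ∫ x in coneNhd S ε, ‖fderiv ℝ u x‖ := fun ε =>
    integral_nonneg fun _ => norm_nonneg _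
  refine ⟨fun ε => 2 * (∫ x in coneNhd S ε, ‖fderiv ℝ u x‖) + (K + 1) * ε, ?_, ?_, ?_⟩
  · have h1 := tendsto_setIntegral_coneNhd hm (f := fun x => ‖fderiv ℝ u x‖)
      (fun _ => norm_nonneg _) (measurable_fderiv ℝ u).norm hε₁ hifin
    have h2 : Tendsto (fun ε : ℝ => (K + 1) * ε) (𝓝[>] 0) (𝓝 ((K + 1) * 0)) :=
      (Continuous.tendsto (by fun_prop) 0).mono_left nhdsWithin_le_nhds
    simpa using (h1.const_mul 2).add h2
  · intro hO
    exact (hO.const_mul_left 2).add ((isBigO_refl _ _).const_mul_left _)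
  · intro ε hε
    have hε1 : ε < 1 := hε.2.trans_le hε₁1
    -- the thickness of the filled tube is chosen in dependence of `ε`
    obtain ⟨δ, ⟨hδE, hδ0⟩, hδε⟩ : ∃ δ, (E δ ≤ ENNReal.ofReal ε ∧ 0 < δ) ∧ δ < ε := by
      have h1 : ∀ᶠ δ in 𝓝[>] (0 : ℝ), E δ ≤ ENNReal.ofReal ε :=
        hE.eventually (ge_mem_nhds (ENNReal.ofReal_pos.2 hε.1))
      exact ((h1.and self_mem_nhdsWithin).and (nhdsWithin_le_nhds (gt_mem_nhds hε.1))).exists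
    have hδ1 : δ ≤ 1 := by linarith
    have hU : X.IsAxisNhd (interior (coneNhd S ε)) := isAxisNhd_interior_coneNhd hm hε.2 hXO hXρ
    have hδκ : ∀ p ∈ S.interior, δ * X.κ p < ε * Metric.infDist p (simplexBdry S) := by
      intro p hp
      have h1 := X.κ_le p (hXO ▸ hp)
      have h2 := infDist_bdry_pos S hm hp
      have h3 := X.κ_nonneg p
      rw [hXρ, hρ] at h1
      -- `κ ≤ ρ / 2` and `ρ ≤ dist(·, ∂Δ')`, since `ε₁ ≤ 1`
      have h4 : X.κ p ≤ Metric.infDist p (simplexBdry S) := by nlinarith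
      nlinarith
    have hcone : ∀ x ∈ coneNhd S ε \ flat (simplexBdry S), hatPart x ∈ X.O := fun x hx =>
      hXO ▸ mem_interior_of_mem_coneNhd hx
    have hconeΩ : ∀ x ∈ coneNhd S ε, tildePart x ≠ 0 → x ∈ X.Ω := fun x hx h0 => by
      rw [hΩ]
      exact mem_tube_of_mem_coneNhd hm hε.2 hx h0
    refine ⟨X.filled δ, fun x hx => (TubeData.contDiffAt_filled hδ0 hδ1 (hcone x hx) fun h0 =>
      TubeData.contDiffAt_u (hconeΩ x hx.1 h0)).contDiffWithinAt, hU.memW11_filled hXfin hδ0 hδ1,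
      ?_, ?_, ?_⟩
    · rw [← hXu]
      refine hU.eqTrace_filled (fun x hx => ?_) hXfin hδ0 hδ1
      have hxS : hatPart x ∈ S.interior := hXO ▸ hx.1
      exact mem_interior_coneNhd hm hxS (hx.2.2.trans (hδκ _ hxS))
    · intro x hx
      have hxc : x ∈ coneNhd S ε := (isClosed_coneNhd S ε).frontier_subset hx.1
      have hxS := mem_interior_of_mem_coneNhd ⟨hxc, hx.2⟩
      rw [TubeData.filled_of_le, hXu]
      by_contra! hlt
      exact hx.1.2 (mem_interior_coneNhd hm hxS (hlt.trans (hδκ _ hxS)))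
    · refine (hmass δ hδ0 hδ1 _ hU).trans ?_
      rw [hXd, hXO, hXu]
      have h1 : volume S.interior ≤
          Measure.euclideanHausdorffMeasure m (flat S.closedInterior) := by
        rw [euclideanHausdorffMeasure_flat]
        exact measure_mono S.interior_subset_closedInterior
      have h2 : volume (interior (coneNhd S ε)) ≤ ENNReal.ofReal (K * ε) := by
        refine (measure_mono interior_subset).trans ((hK ε hε.1).trans
          (ENNReal.ofReal_le_ofReal (mul_le_mul_of_nonneg_left ?_ hK0)))
        nlinarith [hε.1]
      have h3 : ∫⁻ x in interior (coneNhd S ε), ENNReal.ofReal ‖fderiv ℝ u x‖ ≤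
          ENNReal.ofReal (∫ x in coneNhd S ε, ‖fderiv ℝ u x‖) := by
        have hint : IntegrableOn (fun x => ‖fderiv ℝ u x‖) (coneNhd S ε) :=
          (hi.mono_set_ae (coneNhd_ae_le_tube hm hε.2)).norm
        rw [ofReal_integral_eq_lintegral_ofReal hint (Eventually.of_forall fun _ => norm_nonneg _)]
        exact lintegral_mono_set interior_subset
      calc _ ≤ ENNReal.ofReal (Real.pi * |(d : ℝ)|) *
            Measure.euclideanHausdorffMeasure m (flat S.closedInterior) +
            (ENNReal.ofReal (K * ε) +
              2 * ENNReal.ofReal (∫ x in coneNhd S ε, ‖fderiv ℝ u x‖)) + ENNReal.ofReal ε := by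
            gcongr
        _ = _ := by
            have hKε : 0 ≤ K * ε := mul_nonneg hK0 hε.1.le
            have hε0 := hε.1.le
            have h4 := hcone0 ε
            have h5 : ∀ I : ℝ, 2 * ENNReal.ofReal I = ENNReal.ofReal (2 * I) := fun I => by
              rw [ENNReal.ofReal_mul zero_le_two, ENNReal.ofReal_ofNat]
            rw [add_assoc, h5,
              ← ENNReal.ofReal_add hKε (by positivity),
              ← ENNReal.ofReal_add (by positivity) hε0]
            congr 2
            ring

end Cone

end Dipole

end

theorem mainTheorem6 (m : ℕ) (hm : 1 ≤ m)
    -- the cube, after a rigid motion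
    (Φ : Dipole.Eu (m + 2) ≃ᵃⁱ[ℝ] Dipole.Eu (m + 2))
    (Q : Set (Dipole.Eu (m + 2))) (hQ : Q = Φ ⁻¹' Dipole.cube (m + 2))
    -- the simplex `Δ = {0} × Δ'` and the other simplices of the singular set
    (Δ' : Affine.Simplex ℝ (Dipole.Eu m) m)
    (hΔ : Dipole.flat Δ'.interior ⊆ Q)
    (k : ℕ) (T : Fin k → Affine.Simplex ℝ (Dipole.Eu (m + 2)) m)
    (hT : ∀ i, (T i).closedInterior ∩ Dipole.flat Δ'.closedInterior ⊆
      Dipole.flat (Dipole.simplexBdry Δ'))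
    (u : Dipole.Eu (m + 2) → Dipole.Eu 2)
    (hu : Dipole.MemW11Circle Q u)
    (hsmooth : ContDiffOn ℝ ∞ u
      (Q \ (Dipole.flat Δ'.closedInterior ∪ ⋃ i, (T i).closedInterior)))
    (d : ℤ) (hd : ∀ p ∈ Δ'.interior, Dipole.HasDegreeAround u p d) :
    ∃ ε₀ : ℝ, 0 < ε₀ ∧ ∃ R : ℝ → ℝ,
      Tendsto R (𝓝[>] 0) (𝓝 0) ∧
      ((fun ε : ℝ => ∫ x in Dipole.coneNhd Δ' ε, ‖fderiv ℝ u x‖) =O[𝓝[>] 0] (fun ε : ℝ => ε) →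
        R =O[𝓝[>] 0] (fun ε : ℝ => ε)) ∧
      ∀ᵐ ε : ℝ, ε ∈ Ioo 0 ε₀ →
        Dipole.coneNhd Δ' ε \ Dipole.flat (Dipole.simplexBdry Δ') ⊆
            Q \ ⋃ i, (T i).closedInterior ∧
        ∃ v : Dipole.Eu (m + 2) → Dipole.Eu 2,
          ContDiffOn ℝ ∞ v
            (Dipole.coneNhd Δ' ε \ Dipole.flat (Dipole.simplexBdry Δ')) ∧
          Dipole.MemW11 (interior (Dipole.coneNhd Δ' ε)) v ∧
          Dipole.EqTrace (interior (Dipole.coneNhd Δ' ε)) v u ∧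
          (∀ x ∈ frontier (Dipole.coneNhd Δ' ε) \ Dipole.flat (Dipole.simplexBdry Δ'),
            v x = u x) ∧
          Dipole.graphMass (interior (Dipole.coneNhd Δ' ε)) v ≤
            ENNReal.ofReal (Real.pi * |(d : ℝ)|) *
                Measure.euclideanHausdorffMeasure m (Dipole.flat Δ'.closedInterior) +
              ENNReal.ofReal (R ε) := by
  -- a cone that meets no other simplex, and whose open tubes are free of singularities of `u`
  obtain ⟨ε₁, ⟨hsub, hε₁1⟩, hε₁⟩ :=
    (((Dipole.eventually_coneNhd_subset hm Φ Δ' (hQ ▸ hΔ) k T hT).and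
      (nhdsWithin_le_nhds (ge_mem_nhds (zero_lt_one' ℝ)))).and
        (self_mem_nhdsWithin : Ioi (0 : ℝ) ∈ 𝓝[>] 0)).exists
  rw [← hQ] at hsub
  replace hε₁ : 0 < ε₁ := hε₁
  set O := Dipole.tube Δ'.interior
    (fun p => ε₁ * Metric.infDist p (Dipole.simplexBdry Δ')) with hO
  have hOo : IsOpen O := Dipole.isOpen_tube (Dipole.isOpen_simplexInterior Δ' hm)
    (continuous_const.mul (Metric.continuous_infDist_pt _)).continuousOn
  have hOsub : O ⊆ Q \ (Dipole.flat Δ'.closedInterior ∪ ⋃ i, (T i).closedInterior) :=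
    fun x hx => by
      have h1 := hsub (Dipole.tube_subset_coneNhd hx)
      exact ⟨h1.1, fun h => h.elim (fun h => (norm_pos_iff.1 hx.2.1) h.1) h1.2⟩
  have hOQ : O ⊆ Q := fun x hx => (hOsub hx).1
  have hs : ContDiffOn ℝ ∞ u O := hsmooth.mono hOsub
  have hu1 : ∀ x ∈ O, ‖u x‖ = 1 := Dipole.norm_eq_one_of_ae hOo hs.continuousOn
    (ae_restrict_of_ae_restrict_of_subset hOQ hu.2)
  obtain ⟨p₀, hp₀⟩ := Dipole.nonempty_simplexInterior Δ' hm
  obtain ⟨R, hR, hRO, hv⟩ := Dipole.exists_filling_of_cones hm Δ' hε₁ hε₁1 hs hu1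
    (hu.1.integrableOn_fderiv hOQ hOo hs) hp₀ (hd p₀ hp₀)
  refine ⟨ε₁, hε₁, R, hR, hRO, Eventually.of_forall fun ε hε => ⟨?_, hv ε hε⟩⟩
  exact (sdiff_subset_sdiff_left (Dipole.coneNhd_mono hε.2.le)).trans hsub
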